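/- **Setting.** There are $L$ propagation paths, four spatial modes $n=1,2,3,4$ and one frequency mode $n=5$. Mode $n\le 4$ has a beamforming matrix $\boldsymbol T_n\in\mathbb C^{M_n\times N_n}$, $\boldsymbol T_n^{\mathrm H}=[\boldsymbol t_{n,1},\dots,\boldsymbol t_{n,M_n}]$, and there are $M_5=K_5+L_5-1$ subcarriers with spacing $\Delta f>0$. Path $l$ has gain $\gamma_l\neq0$, angles of departure $(\phi_{\rm az}^l,\phi_{\rm el}^l)$, angles of arrival $(\theta_{\rm az}^l,\theta_{\rm el}^l)$ and delay $\tau_l>0$, where elevations lie in $(0,\pi)$, azimuths have nonzero cosine, and $2\Delta f\,\tau_l<1$. Put $\omega_{l,1}=\pi\sin\phi_{\rm az}^l\sin\phi_{\rm el}^l$, $\omega_{l,2}=\pi\cos\phi_{\rm el}^l$, $\omega_{l,3}=\pi\sin\theta_{\rm az}^l\sin\theta_{\rm el}^l$, $\omega_{l,4}=\pi\cos\theta_{\rm el}^l$, $\omega_{l,5}=-2\pi\Delta f\tau_l$, $\Phi_{l,n}=e^{\jmath\omega_{l,n}}$, $\boldsymbol A_n^{(k)}=[e^{\jmath i\omega_{l,n}}]_{0\le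 i<k,\,1\le l\le L}$, $\boldsymbol B_n=\boldsymbol T_n^{\mathrm H}\boldsymbol A_n^{(M_n)}$, $\boldsymbol P=\boldsymbol B_1\odot\cdots\odot\boldsymbol B_4\odot\boldsymbol A_5^{(K_5)}$, $\boldsymbol G=\boldsymbol A_5^{(L_5)}$ (with $\odot$ the Khatri-Rao product). The noise-free beamspace channel is $\boldsymbol h=(\boldsymbol B_1\odot\cdots\odot\boldsymbol B_4\odot\boldsymbol A_5^{(M_5)})\boldsymbol\gamma\in\mathbb C^{N}$, $N=N_1N_2N_3N_4M_5$. For $n\le4$ there is a nonsingular $\boldsymbol F_n$ such that $[\boldsymbol I,\boldsymbol 0]\boldsymbol T_n=[\boldsymbol 0,\boldsymbol I]\boldsymbol T_n\boldsymbol F_n$, and a matrix $\boldsymbol Q_n$ with $\boldsymbol Q_n\boldsymbol t_{n,M_n}=\boldsymbol 0$ and $\boldsymbol Q_n\boldsymbol F_n^{\mathrm H}\boldsymbol t_{n,1}=\boldsymbol 0$. For $i=1,2$ let $\breve{\boldsymbol J}_{n,i}$ be the Kronecker product of identity matrices in all modes (of size $K_5$ in mode $5$) except mode $n$, where the factor is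 $\boldsymbol Q_n$ ($i=1$) or $\boldsymbol Q_n\boldsymbol F_n^{\mathrm H}$ ($i=2$) for $n\le 4$, and $[\boldsymbol I_{K_5-1},\boldsymbol 0]$ ($i=1$) or $[\boldsymbol 0,\boldsymbol I_{K_5-1}]$ ($i=2$) for $n=5$. Assume that all $\breve{\boldsymbol J}_{n,1}\boldsymbol P$ and $\boldsymbol G$ have rank $L$, and that for given coefficients $\beta_1,\dots,\beta_5$ the numbers $\Lambda_l=\sum_n\beta_n\Phi_{l,n}$ are distinct. **Estimator.** For an observed vector $\boldsymbol x\in\mathbb C^N$, form the smoothed matrix with entries $x_{n_1,n_2,n_3,n_4,k+s-1}$ (rows $(n_1,n_2,n_3,n_4,k)$, $k\le K_5$; columns $s\le L_5$); let the columns of $\boldsymbol U$ be its $L$ leading left singular vectors, $\boldsymbol\Gamma_n=(\breve{\boldsymbol J}_{n,1}\boldsymbol U)^\dagger\breve{\boldsymbol J}_{n,2}\boldsymbol U$, and $\boldsymbol E$ an invertible matrix that diagonalizes $\sum_n\beta_n\boldsymbol\Gamma_n$ (each eigenvalue is labelled by a path whose $\Lambda_l$ is closest to it); then $\hat\omega_{l,n}=\Im\ln(\boldsymbol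 E^{-1}\boldsymbol\Gamma_n\boldsymbol E)_{ll}$. The estimated angles and delays are obtained by inverting the formulas for $\omega_{l,n}$ (the signs of $\cos\phi^l_{\rm az}$, $\cos\theta^l_{\rm az}$ being known). With $\boldsymbol f(\mathrm{az},\mathrm{el})=[\cos \mathrm{az}\sin \mathrm{el},\sin \mathrm{az}\sin \mathrm{el},\cos \mathrm{el}]^{\mathrm T}$, put $\boldsymbol f_{{\rm T},l}=\boldsymbol f(\phi_{\rm az}^l,\phi_{\rm el}^l)$, $\boldsymbol f_{{\rm R},l}=\boldsymbol f(\theta_{\rm az}^l,\theta_{\rm el}^l)$, $\boldsymbol\mu_l=c\tau_l(\boldsymbol f_{{\rm T},l}+\boldsymbol f_{{\rm R},l})$, $\boldsymbol\delta_l=\boldsymbol p_{\rm T}-c\tau_l\boldsymbol f_{{\rm R},l}$, and, for fixed weights $\iota_l\ge0$, $\boldsymbol C_l=\iota_l(\boldsymbol I-\boldsymbol\mu_l\boldsymbol\mu_l^{\mathrm T}/\|\boldsymbol\mu_l\|^2)$ for a non-line-of-sight path and $\boldsymbol C_l=\iota_l\boldsymbol I$ for a line-of-sight path (any number of paths, possibly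 none, may be line-of-sight). The position estimate is $\hat{\boldsymbol p}_{\rm R}(\boldsymbol x)=(\sum_l\boldsymbol C_l)^{-1}\sum_l\boldsymbol C_l\boldsymbol\delta_l$, evaluated at the estimated parameters. At the true parameters, $\sum_l\boldsymbol C_l$ is assumed to be nonsingular, $c>0$, line-of-sight paths are those with $\boldsymbol f_{{\rm R},l}=-\boldsymbol f_{{\rm T},l}$, and each path satisfies $\boldsymbol p_{\rm T}+r\boldsymbol f_{{\rm T},l}=\boldsymbol p_{\rm R}+(c\tau_l-r)\boldsymbol f_{{\rm R},l}$ for some $r\in[0,c\tau_l]$. **The matrix $\boldsymbol\Psi$.** With all quantities at the true parameters, let $\boldsymbol b_l$ be the $l$-th column of $\boldsymbol I_L$, $\boldsymbol\lambda_{l,n}^{\mathrm H}=\boldsymbol b_l^{\mathrm T}(\breve{\boldsymbol J}_{n,1}\boldsymbol P)^\dagger(\breve{\boldsymbol J}_{n,2}-\Phi_{l,n}\breve{\boldsymbol J}_{n,1})$, $\boldsymbol\chi_l^*=(\boldsymbol G^{\mathrm T})^\dagger\boldsymbol b_l$, let $\boldsymbol\xi_{l,n}\in\mathbb C^N$ be,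 for each $(n_1,\dots,n_4)$, the convolution of the corresponding block of $\boldsymbol\lambda_{l,n}$ with $\boldsymbol\chi_l$, and $\boldsymbol\upsilon_{l,n}=\Phi_{l,n}\boldsymbol\xi_{l,n}/\gamma_l^*$. Put $$\boldsymbol\kappa_{l,1}=\frac{\boldsymbol\upsilon_{l,1}}{\pi\cos\phi_{\rm az}^l\sin\phi_{\rm el}^l}+\frac{\sin\phi_{\rm az}^l\cos\phi_{\rm el}^l\,\boldsymbol\upsilon_{l,2}}{\pi\cos\phi_{\rm az}^l\sin^2\phi_{\rm el}^l},\quad \boldsymbol\kappa_{l,2}=-\frac{\boldsymbol\upsilon_{l,2}}{\pi\sin\phi_{\rm el}^l},\quad \boldsymbol\kappa_{l,5}=-\frac{\boldsymbol\upsilon_{l,5}}{2\pi\Delta f},$$ and define $\boldsymbol\kappa_{l,3},\boldsymbol\kappa_{l,4}$ like $\boldsymbol\kappa_{l,1},\boldsymbol\kappa_{l,2}$ with $\theta,\boldsymbol\upsilon_{l,3},\boldsymbol\upsilon_{l,4}$ in place of $\phi,\boldsymbol\upsilon_{l,1},\boldsymbol\upsilon_{l,2}$. Let $\boldsymbol\Omega_{{\rm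 T},l},\boldsymbol\Omega_{{\rm R},l}\in\mathbb R^{3\times2}$ be the Jacobians of $\boldsymbol f$ at the angles of departure and arrival, $\boldsymbol d_l=\boldsymbol\delta_l-\boldsymbol p_{\rm R}$, $\breve{\boldsymbol C}_l=\boldsymbol 0$ for line-of-sight paths and otherwise $$\breve{\boldsymbol C}_l=\iota_l\Big(\frac{2\boldsymbol\mu_l^{\mathrm T}\boldsymbol d_l\,\boldsymbol\mu_l\boldsymbol\mu_l^{\mathrm T}}{\|\boldsymbol\mu_l\|^4}-\frac{\boldsymbol\mu_l^{\mathrm T}\boldsymbol d_l\,\boldsymbol I+\boldsymbol\mu_l\boldsymbol d_l^{\mathrm T}}{\|\boldsymbol\mu_l\|^2}\Big),$$ $\breve{\boldsymbol D}_l=-c(\sum_\ell\boldsymbol C_\ell)^{-1}\boldsymbol C_l[\tau_l\boldsymbol\Omega_{{\rm R},l},\boldsymbol f_{{\rm R},l}]$, $\breve{\boldsymbol E}_l=c(\sum_\ell\boldsymbol C_\ell)^{-1}\breve{\boldsymbol C}_l[\tau_l\boldsymbol\Omega_{{\rm T},l},\tau_l\boldsymbol\Omega_{{\rm R},l},\boldsymbol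 f_{{\rm T},l}+\boldsymbol f_{{\rm R},l}]$, and $$\boldsymbol\Psi=\sum_{l=1}^L\Big(\breve{\boldsymbol D}_l[\boldsymbol\kappa_{l,3},\boldsymbol\kappa_{l,4},\boldsymbol\kappa_{l,5}]^{\mathrm H}+\breve{\boldsymbol E}_l[\boldsymbol\kappa_{l,1},\dots,\boldsymbol\kappa_{l,5}]^{\mathrm H}\Big)\in\mathbb C^{3\times N}.$$ **Claim.** The estimator returns an output for every $\boldsymbol x$ in a neighbourhood of $\boldsymbol h$. Every choice $\hat{\boldsymbol p}_{\rm R}(\cdot)$ of its outputs is (real) differentiable at $\boldsymbol h$ with $\hat{\boldsymbol p}_{\rm R}(\boldsymbol h)=\boldsymbol p_{\rm R}$. Let the entries of the channel estimation error $\Delta\boldsymbol h$ be i.i.d. circular complex Gaussian with mean zero and variance $N_0/(N_{\rm p}E_{\rm s})$ ($N_0\ge0$, $E_{\rm s}>0$, $N_{\rm p}\ge1$). Then the first-order perturbation $\Delta\boldsymbol p_{\rm R}=D\hat{\boldsymbol p}_{\rm R}(\boldsymbol h)[\Delta\boldsymbol h]$ of the position estimate satisfies $$\mathrm E(\Delta\boldsymbol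 p_{\rm R})=\boldsymbol 0,\qquad \mathrm E(\|\Delta\boldsymbol p_{\rm R}\|^2)=\frac{N_0\|\boldsymbol\Psi\|_{\mathrm F}^2}{2N_{\rm p}E_{\rm s}}.$$ -/

import Mathlib

open MeasureTheory ProbabilityTheory Filter Topology
open scoped NNReal Matrix Matrix.Norms.Frobenius

noncomputable section

namespace BeamspaceESPRIT

/-! ### Linear algebra -/

section LinearAlgebra

variable {m n : Type*} [Fintype m] [Fintype n]

/-- The four Penrose equations: `X` is the Moore-Penrose pseudoinverse of `A`. -/
def IsMoorePenrose (A : Matrix m n ℂ) (X : Matrix n m ℂ) : Prop :=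
  A * X * A = A ∧ X * A * X = X ∧ (A * X)ᴴ = A * X ∧ (X * A)ᴴ = X * A

open Classical in
/-- The Moore-Penrose pseudoinverse `A†` (it always exists, and it is unique). -/
def pinv (A : Matrix m n ℂ) : Matrix n m ℂ :=
  if h : ∃ X, IsMoorePenrose A X then h.choose else 0

/-- The columns of `U` are `L` leading left singular vectors of `A`: there is a singular value
decomposition `A = U Σₛ Vₛᴴ + Uₙ Σₙ Vₙᴴ` in which no singular value in `Σₙ` exceeds one in `Σₛ`. -/
def IsLeadingLeftSingular {L : ℕ} (A : Matrix m n ℂ) (U : Matrix m (Fin L) ℂ) : Prop :=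
  ∃ (q : ℕ) (V : Matrix n (Fin L) ℂ) (Un : Matrix m (Fin q) ℂ) (Vn : Matrix n (Fin q) ℂ)
    (σ : Fin L → ℝ) (σn : Fin q → ℝ),
    A = U * Matrix.diagonal (fun l => (σ l : ℂ)) * Vᴴ
        + Un * Matrix.diagonal (fun j => (σn j : ℂ)) * Vnᴴ ∧
    (Matrix.fromCols U Un)ᴴ * Matrix.fromCols U Un = 1 ∧
    (Matrix.fromCols V Vn)ᴴ * Matrix.fromCols V Vn = 1 ∧
    (∀ l, 0 ≤ σ l) ∧ (∀ j, 0 ≤ σn j) ∧ ∀ j l, σn j ≤ σ l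

/-- The selection matrix `[I, 0]`, which drops the last entry. -/
def selFirst (k : ℕ) : Matrix (Fin (k - 1)) (Fin k) ℂ :=
  Matrix.of fun i j => if j.val = i.val then 1 else 0

/-- The selection matrix `[0, I]`, which drops the first entry. -/
def selLast (k : ℕ) : Matrix (Fin (k - 1)) (Fin k) ℂ :=
  Matrix.of fun i j => if j.val = i.val + 1 then 1 else 0

end LinearAlgebra

/-! ### Index sets -/

/-- The five modes: `some n`, `n = 0, 1, 2, 3`, are the four spatial modes (two at the transmitter,
two at the receiver), and `none` is the frequency (subcarrier) mode. -/
abbrev Mode := Option (Fin 4)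

/-- Index of a beam: one index in each of the four spatial modes. -/
abbrev Beam (N : Fin 4 → ℕ) := (n : Fin 4) → Fin (N n)

/-- Index set of the beamspace channel vector: a beam and one of the `M₅ = K₅ + L₅ - 1` subcarriers.
Its cardinality is `N₁ N₂ N₃ N₄ M₅`. -/
abbrev Idx (N : Fin 4 → ℕ) (K₅ L₅ : ℕ) := Beam N × Fin (K₅ + L₅ - 1)

/-- Kronecker product of four matrices in the spatial modes and a matrix in the frequency mode. -/
def kron {N : Fin 4 → ℕ} {a b : ℕ} (X : (n : Fin 4) → Matrix (Fin (N n)) (Fin (N n)) ℂ)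
    (Y : Matrix (Fin a) (Fin b) ℂ) : Matrix (Beam N × Fin a) (Beam N × Fin b) ℂ :=
  Matrix.of fun r s => (∏ n, X n (r.1 n) (s.1 n)) * Y r.2 s.2

/-! ### Channel parameters of a path and the weighted-least-squares position -/

/-- Azimuth and elevation of departure (`ϕ`) and of arrival (`θ`), and delay of one path. -/
structure PathParams where
  ϕaz : ℝ
  ϕel : ℝ
  θaz : ℝ
  θel : ℝ
  τ : ℝ

/-- Unit vector with azimuth `az` and elevation `el` (measured from the `z`-axis). -/
def direction (az el : ℝ) : Fin 3 → ℝ :=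
  ![Real.cos az * Real.sin el, Real.sin az * Real.sin el, Real.cos el]

namespace PathParams

variable (p : PathParams)

/-- Direction of departure. -/
def fT : Fin 3 → ℝ := direction p.ϕaz p.ϕel

/-- Direction of arrival, seen from the receiver. -/
def fR : Fin 3 → ℝ := direction p.θaz p.θel

/-- `μ = c τ (f_T + f_R)`. -/
def μ (c : ℝ) : Fin 3 → ℝ := (c * p.τ) • (p.fT + p.fR)

/-- `δ = p_T - c τ f_R`. -/
def δ (c : ℝ) (pT : Fin 3 → ℝ) : Fin 3 → ℝ := pT - (c * p.τ) • p.fR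

/-- The five angular frequencies of a path, for subcarrier spacing `Δf`. -/
def freq (Δf : ℝ) : Mode → ℝ
  | some n => ![Real.pi * Real.sin p.ϕaz * Real.sin p.ϕel, Real.pi * Real.cos p.ϕel,
                Real.pi * Real.sin p.θaz * Real.sin p.θel, Real.pi * Real.cos p.θel] n
  | none => -(2 * Real.pi * Δf * p.τ)

end PathParams

/-- The weight matrix `ι (I - μ μᵀ / ‖μ‖²)` of a path. For a line-of-sight path, where `μ = 0`
in the absence of errors and the projection is meaningless, it is `ι I`. -/
def weightMatrix (isLOS : Prop) [Decidable isLOS] (ι : ℝ) (μ : Fin 3 → ℝ) :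
    Matrix (Fin 3) (Fin 3) ℝ :=
  if isLOS then ι • (1 : Matrix (Fin 3) (Fin 3) ℝ)
  else ι • (1 - (μ ⬝ᵥ μ)⁻¹ • Matrix.vecMulVec μ μ)

/-- Azimuth with `π sin az sin el = ω₁`. A planar array in the `y-z` plane does not distinguish the
half spaces `x > 0` (`front`) and `x < 0`, so this is prior knowledge. -/
def azimuthOf (front : Prop) [Decidable front] (ω₁ el : ℝ) : ℝ :=
  if front then Real.arcsin (ω₁ / (Real.pi * Real.sin el))
  else Real.pi - Real.arcsin (ω₁ / (Real.pi * Real.sin el))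

/-- Elevation with `π cos el = ω₂`. -/
def elevationOf (ω₂ : ℝ) : ℝ := Real.arccos (ω₂ / Real.pi)

/-- The channel parameters of a path from its five angular frequencies: the inverse of
`PathParams.freq`. -/
def paramsOf (ϕfront θfront : Prop) [Decidable ϕfront] [Decidable θfront] (Δf : ℝ)
    (ω : Mode → ℝ) : PathParams where
  ϕaz := azimuthOf ϕfront (ω (some 0)) (elevationOf (ω (some 1)))
  ϕel := elevationOf (ω (some 1))
  θaz := azimuthOf θfront (ω (some 2)) (elevationOf (ω (some 3)))
  θel := elevationOf (ω (some 3))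
  τ := -(ω none) / (2 * Real.pi * Δf)

/-! ### The scenario -/

/-- The data of the localization problem: `L` paths, `M n` antennas and `N n` beams in spatial mode
`n`, and `K₅ + L₅ - 1` subcarriers, of which windows of length `K₅` are used for smoothing. -/
structure Scenario (L : ℕ) (M N : Fin 4 → ℕ) (K₅ L₅ : ℕ) where
  /-- beamforming (transformation) matrices -/
  T : (n : Fin 4) → Matrix (Fin (M n)) (Fin (N n)) ℂ
  /-- matrices of the shift-invariance structure of `T` -/
  F : (n : Fin 4) → Matrix (Fin (N n)) (Fin (N n)) ℂ
  /-- matrices that restore the shift invariance in beamspace -/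
  Q : (n : Fin 4) → Matrix (Fin (N n)) (Fin (N n)) ℂ
  /-- coefficients of the joint eigenvalue decomposition -/
  β : Mode → ℂ
  /-- true path parameters -/
  par : Fin L → PathParams
  /-- complex path gains -/
  γ : Fin L → ℂ
  /-- the line-of-sight paths -/
  los : Finset (Fin L)
  /-- least-squares weights -/
  ι : Fin L → ℝ
  /-- position of the transmitter -/
  pT : Fin 3 → ℝ
  /-- position of the receiver -/
  pR : Fin 3 → ℝ
  /-- speed of light -/
  c : ℝ
  /-- subcarrier spacing -/
  Δf : ℝ

namespace Scenario

variable {L : ℕ} {M N : Fin 4 → ℕ} {K₅ L₅ : ℕ} (S : Scenario L M N K₅ L₅)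

/-- Angular frequencies `ω_{l,n}`. -/
def ω (l : Fin L) (n : Mode) : ℝ := (S.par l).freq S.Δf n

/-- `Φ_{l,n} = exp(j ω_{l,n})`. -/
def Φ (l : Fin L) (n : Mode) : ℂ := Complex.exp (Complex.I * S.ω l n)

/-- Vandermonde matrix `A_n^{(k)}` with entries `exp(j i ω_{l,n})`, `i = 0, …, k - 1`. -/
def A (n : Mode) (k : ℕ) : Matrix (Fin k) (Fin L) ℂ :=
  Matrix.of fun i l => Complex.exp (Complex.I * ((i.val : ℂ) * S.ω l n))

/-- `B_n = T_nᴴ A_n^{(M_n)}`. -/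
def B (n : Fin 4) : Matrix (Fin (N n)) (Fin L) ℂ := (S.T n)ᴴ * S.A (some n) (M n)

/-- Khatri-Rao product `B₁ ⊙ B₂ ⊙ B₃ ⊙ B₄ ⊙ A₅^{(k)}`. -/
def khatriRao (k : ℕ) : Matrix (Beam N × Fin k) (Fin L) ℂ :=
  Matrix.of fun r l => (∏ n, S.B n (r.1 n) l) * S.A none k r.2 l

/-- The noise-free beamspace channel vector. -/
def h : Idx N K₅ L₅ → ℂ := S.khatriRao (K₅ + L₅ - 1) *ᵥ S.γ

/-- `P = B₁ ⊙ B₂ ⊙ B₃ ⊙ B₄ ⊙ A₅^{(K₅)}`. -/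
def P : Matrix (Beam N × Fin K₅) (Fin L) ℂ := S.khatriRao K₅

/-- `G = A₅^{(L₅)}`. -/
def G : Matrix (Fin L₅) (Fin L) ℂ := S.A none L₅

/-- Spatial smoothing over the subcarriers. -/
def smooth (x : Idx N K₅ L₅ → ℂ) : Matrix (Beam N × Fin K₅) (Fin L₅) ℂ :=
  Matrix.of fun r s => x (r.1, ⟨r.2.val + s.val, by omega⟩)

/-- Length of the frequency part of the rows of the selection matrices in each mode. -/
def selRows (K : ℕ) : Mode → ℕ
  | some _ => K
  | none => K - 1

/-- First selection matrix in each mode, built from `L_{n,1} = Q_n` or from `[I, 0]`. -/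
def J₁ : (n : Mode) → Matrix (Beam N × Fin (selRows K₅ n)) (Beam N × Fin K₅) ℂ
  | some n => kron (Function.update (fun _ => 1) n (S.Q n)) (1 : Matrix (Fin K₅) (Fin K₅) ℂ)
  | none => kron (fun _ => 1) (selFirst K₅)

/-- Second selection matrix in each mode, built from `L_{n,2} = Q_n F_nᴴ` or from `[0, I]`. -/
def J₂ : (n : Mode) → Matrix (Beam N × Fin (selRows K₅ n)) (Beam N × Fin K₅) ℂ
  | some n => kron (Function.update (fun _ => 1) n (S.Q n * (S.F n)ᴴ))
      (1 : Matrix (Fin K₅) (Fin K₅) ℂ)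
  | none => kron (fun _ => 1) (selLast K₅)

/-- Noise-free eigenvalues `Λ_l = ∑ₙ βₙ Φ_{l,n}` of the joint eigenvalue decomposition. -/
def Λ (l : Fin L) : ℂ := ∑ n, S.β n * S.Φ l n

/-- Weight matrix `C_l` at the true parameters. -/
def C (l : Fin L) : Matrix (Fin 3) (Fin 3) ℝ :=
  weightMatrix (l ∈ S.los) (S.ι l) ((S.par l).μ S.c)

/-- Standing assumptions. -/
structure Admissible : Prop where
  /-- shift-invariance structure of the beamforming matrices -/
  shift : ∀ n, IsUnit (S.F n).det ∧ selFirst (M n) * S.T n = selLast (M n) * S.T n * S.F n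
  /-- `Q_n` annihilates the last column of `T_nᴴ` -/
  Q_last : ∀ n (i : Fin (M n)), i.val + 1 = M n → S.Q n *ᵥ (fun j => (S.T n)ᴴ j i) = 0
  /-- `Q_n` annihilates `F_nᴴ` times the first column of `T_nᴴ` -/
  Q_first : ∀ n (i : Fin (M n)), i.val = 0 →
    S.Q n *ᵥ ((S.F n)ᴴ *ᵥ (fun j => (S.T n)ᴴ j i)) = 0
  /-- the shift-invariance equation has a unique least-squares solution in each mode -/
  rank_P : ∀ n, (S.J₁ n * S.P).rank = L
  /-- together with `γ_ne`: the smoothed noise-free channel matrix has rank `L` -/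
  rank_G : S.G.rank = L
  γ_ne : ∀ l, S.γ l ≠ 0
  /-- the joint eigenvalues are distinct -/
  Λ_inj : Function.Injective S.Λ
  c_pos : 0 < S.c
  Δf_pos : 0 < S.Δf
  ϕel_mem : ∀ l, (S.par l).ϕel ∈ Set.Ioo 0 Real.pi
  θel_mem : ∀ l, (S.par l).θel ∈ Set.Ioo 0 Real.pi
  ϕaz_ne : ∀ l, Real.cos (S.par l).ϕaz ≠ 0
  θaz_ne : ∀ l, Real.cos (S.par l).θaz ≠ 0
  τ_pos : ∀ l, 0 < (S.par l).τ
  /-- the delays are not aliased: `ω_{l,5}` lies in `(-π, 0)` -/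
  τ_lt : ∀ l, 2 * S.Δf * (S.par l).τ < 1
  ι_nonneg : ∀ l, 0 ≤ S.ι l
  /-- the line-of-sight paths are those that arrive from the direction opposite to departure -/
  los_iff : ∀ l, l ∈ S.los ↔ (S.par l).fR = -(S.par l).fT
  /-- each path is a broken line of length `c τ` from transmitter to receiver with at most one
  point of incidence -/
  geometry : ∀ l, ∃ r : ℝ, 0 ≤ r ∧ r ≤ S.c * (S.par l).τ ∧
    S.pT + r • (S.par l).fT = S.pR + (S.c * (S.par l).τ - r) • (S.par l).fR
  /-- the normal equations of the position estimate are nonsingular -/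
  C_unit : IsUnit (∑ l, S.C l).det

/-! ### The estimator -/

/-- Least-squares solution `(J₁ U)† J₂ U` of the shift-invariance equation in mode `n`. -/
def Γ (U : Matrix (Beam N × Fin K₅) (Fin L) ℂ) (n : Mode) : Matrix (Fin L) (Fin L) ℂ :=
  pinv (S.J₁ n * U) * (S.J₂ n * U)

/-- `ω'` are angular frequencies returned by the matrix-based beamspace ESPRIT algorithm for the
observed channel vector `x`. The singular vectors and the eigenvectors are not unique, so this is a
relation. The last condition on `ev` only fixes the labels of the paths. -/
def IsFrequencyEstimate (x : Idx N K₅ L₅ → ℂ) (ω' : Fin L → Mode → ℝ) : Prop :=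
  ∃ (U : Matrix (Beam N × Fin K₅) (Fin L) ℂ) (E : Matrix (Fin L) (Fin L) ℂ) (ev : Fin L → ℂ),
    IsLeadingLeftSingular (smooth x) U ∧
    IsUnit E.det ∧
    (∑ n, S.β n • S.Γ U n) * E = E * Matrix.diagonal ev ∧
    (∀ l k, ‖ev l - S.Λ l‖ ≤ ‖ev l - S.Λ k‖) ∧
    ∀ l n, ω' l n = (Complex.log ((E⁻¹ * S.Γ U n * E) l l)).im

/-- Channel parameters of path `l` from its estimated angular frequencies. -/
def estParams (ω' : Fin L → Mode → ℝ) (l : Fin L) : PathParams :=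
  paramsOf (0 < Real.cos (S.par l).ϕaz) (0 < Real.cos (S.par l).θaz) S.Δf (ω' l)

/-- Weighted-least-squares position `(∑ C_l)⁻¹ ∑ C_l δ_l` from channel parameters `η`. -/
def wlsPosition (η : Fin L → PathParams) : Fin 3 → ℝ :=
  (∑ l, weightMatrix (l ∈ S.los) (S.ι l) ((η l).μ S.c))⁻¹ *ᵥ
    ∑ l, weightMatrix (l ∈ S.los) (S.ι l) ((η l).μ S.c) *ᵥ (η l).δ S.c S.pT

/-- `p` is a position estimate returned by the method for the observed channel vector `x`. -/
def IsPositionEstimate (x : Idx N K₅ L₅ → ℂ) (p : EuclideanSpace ℝ (Fin 3)) : Prop :=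
  ∃ ω', S.IsFrequencyEstimate x ω' ∧ p = WithLp.toLp 2 (S.wlsPosition (S.estParams ω'))

/-! ### The matrix `Ψ` -/

/-- `λ_{l,n}ᴴ = b_lᵀ (J₁ P)† (J₂ - Φ_{l,n} J₁)`. -/
def lam (l : Fin L) (n : Mode) : Beam N × Fin K₅ → ℂ := fun r =>
  star ((pinv (S.J₁ n * S.P) * (S.J₂ n - S.Φ l n • S.J₁ n)) l r)

/-- `χ_l^* = (Gᵀ)† b_l`. -/
def χ (l : Fin L) : Fin L₅ → ℂ := fun s => star (pinv S.Gᵀ s l)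

/-- `ξ_{l,n}`: for each beam, the convolution of `λ_{l,n}` and `χ_l`. -/
def ξ (l : Fin L) (n : Mode) : Idx N K₅ L₅ → ℂ := fun i =>
  ∑ k : Fin K₅, ∑ s : Fin L₅, if k.val + s.val = i.2.val then S.lam l n (i.1, k) * S.χ l s else 0

/-- `υ_{l,n} = Φ_{l,n} ξ_{l,n} / γ_l^*`. -/
def υ (l : Fin L) (n : Mode) : Idx N K₅ L₅ → ℂ := (S.Φ l n / star (S.γ l)) • S.ξ l n

/-- Vector of the azimuth perturbation, from those of the two angular frequencies. -/
def κaz (az el : ℝ) (υ₁ υ₂ : Idx N K₅ L₅ → ℂ) : Idx N K₅ L₅ → ℂ :=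
  (1 / (Real.pi * Real.cos az * Real.sin el)) • υ₁
    + (Real.sin az * Real.cos el / (Real.pi * Real.cos az * Real.sin el ^ 2)) • υ₂

/-- Vector of the elevation perturbation. The sign is that of
`Δω₂ = -π sin(el) Δel`. -/
def κel (el : ℝ) (υ₂ : Idx N K₅ L₅ → ℂ) : Idx N K₅ L₅ → ℂ :=
  (-(1 / (Real.pi * Real.sin el))) • υ₂

/-- The vectors `κ_{l,1}, …, κ_{l,5}`, such that the first-order perturbations of the azimuth and
elevation of departure, of those of arrival, and of the delay are `Im (κᴴ Δh)`. The sign of the last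
is that of `Δω₅ = -2π Δf Δτ`. -/
def κ (l : Fin L) : Fin 5 → Idx N K₅ L₅ → ℂ :=
  ![κaz (S.par l).ϕaz (S.par l).ϕel (S.υ l (some 0)) (S.υ l (some 1)),
    κel (S.par l).ϕel (S.υ l (some 1)),
    κaz (S.par l).θaz (S.par l).θel (S.υ l (some 2)) (S.υ l (some 3)),
    κel (S.par l).θel (S.υ l (some 3)),
    (-(1 / (2 * Real.pi * S.Δf))) • S.υ l none]

/-- Jacobian of the unit vector `direction az el`. -/
def Ω (az el : ℝ) : Matrix (Fin 3) (Fin 2) ℝ :=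
  !![-(Real.sin az * Real.sin el), Real.cos az * Real.cos el;
     Real.cos az * Real.sin el, Real.sin az * Real.cos el;
     0, -Real.sin el]

/-- The 3 × 3 matrix `[τ Ω_R, f_R]`. -/
def δJac (p : PathParams) : Matrix (Fin 3) (Fin 3) ℝ :=
  Matrix.of fun i => ![p.τ * Ω p.θaz p.θel i 0, p.τ * Ω p.θaz p.θel i 1, p.fR i]

/-- The 3 × 5 matrix `[τ Ω_T, τ Ω_R, f_T + f_R]`. -/
def μJac (p : PathParams) : Matrix (Fin 3) (Fin 5) ℝ :=
  Matrix.of fun i => ![p.τ * Ω p.ϕaz p.ϕel i 0, p.τ * Ω p.ϕaz p.ϕel i 1,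
    p.τ * Ω p.θaz p.θel i 0, p.τ * Ω p.θaz p.θel i 1, p.fT i + p.fR i]

/-- The matrix `C̆_l`, for which `ΔC_l (δ_l - p_R) = C̆_l Δμ_l` to first order. The weight matrix of
a line-of-sight path is constant. -/
def Cbreve (l : Fin L) : Matrix (Fin 3) (Fin 3) ℝ :=
  if l ∈ S.los then 0 else
    let μ := (S.par l).μ S.c
    let d := (S.par l).δ S.c S.pT - S.pR
    S.ι l • ((2 * (μ ⬝ᵥ d) / (μ ⬝ᵥ μ) ^ 2) • Matrix.vecMulVec μ μ
      - (μ ⬝ᵥ μ)⁻¹ • ((μ ⬝ᵥ d) • (1 : Matrix (Fin 3) (Fin 3) ℝ) + Matrix.vecMulVec μ d))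

/-- `D̆_l = -c (∑ C)⁻¹ C_l [τ Ω_R, f_R]`. -/
def Dbreve (l : Fin L) : Matrix (Fin 3) (Fin 3) ℝ :=
  (-S.c) • ((∑ k, S.C k)⁻¹ * S.C l * δJac (S.par l))

/-- `Ĕ_l = c (∑ C)⁻¹ C̆_l [τ Ω_T, τ Ω_R, f_T + f_R]`. -/
def Ebreve (l : Fin L) : Matrix (Fin 3) (Fin 5) ℝ :=
  S.c • ((∑ k, S.C k)⁻¹ * S.Cbreve l * μJac (S.par l))

/-- `Ψ = ∑ D̆_l [κ₃, κ₄, κ₅]ᴴ + Ĕ_l [κ₁, κ₂, κ₃, κ₄, κ₅]ᴴ`. -/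
def Ψ : Matrix (Fin 3) (Idx N K₅ L₅) ℂ :=
  ∑ l, ((S.Dbreve l).map (fun t : ℝ => (t : ℂ)) *
          (Matrix.of ![S.κ l 2, S.κ l 3, S.κ l 4]).map star
        + (S.Ebreve l).map (fun t : ℝ => (t : ℂ)) * (Matrix.of (S.κ l)).map star)

end Scenario

/-! ### The noise -/

/-- The circular complex Gaussian law with mean zero and variance `v`. -/
def circularGaussian (v : ℝ≥0) : Measure ℂ :=
  ((gaussianReal 0 (v / 2)).prod (gaussianReal 0 (v / 2))).map (fun z => (⟨z.1, z.2⟩ : ℂ))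

end BeamspaceESPRIT

end

noncomputable section

namespace BeamspaceESPRIT

/-! ### Moore-Penrose pseudoinverse -/

section Pinv

open scoped ComplexOrder

variable {m n : Type*} [Fintype m] [Fintype n]

/-! The singular vectors and eigenvectors used by the estimator are not unique and need not depend
continuously on the observation `x`, so they cannot be differentiated. The proof isolates what is
independent of these choices.

Write `W = diag(γ) Gᵀ`. The smoothed noise-free channel is `P W`, of rank `L`, and `W` has the right
inverse `WR = W†`. For a smoothed matrix `A` near `P W`, any leading left singular vectors satisfy
`U = (A Y) R` with `R` invertible and `Y → WR` (`exists_tendsto_signal_subspace`). This rests on a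
lower bound for the leading singular values that is uniform near `P W`
(`IsLeadingLeftSingular.exists_svd`).

Since `(J₁ U)†` turns `R` into `R⁻¹` on the left, every `Γ_n` equals `R⁻¹ H_n R` with one and the
same `R`, where `H_n` is the shift-invariance solution in the basis `A Y`. Here `H_n = diag(Φ_n) +
O(‖x - h‖)`, and its diagonal is linear in `x - h` up to `o(‖x - h‖)`
(`shift_solution_perturbation`). The auxiliary left inverse of `P` enters to first order only
through a commutator with a diagonal matrix, whose diagonal is zero.

The matrix `R E` diagonalizes `∑ β_n H_n`, which is close to a diagonal matrix with distinct
entries. After rescaling of its columns it is `1 + O(‖x - h‖)`, and conjugation by such a matrix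
changes the diagonal of `H_n` only by `o(‖x - h‖)`, again because commutators with diagonal matrices
have zero diagonal (`isLittleO_diag_conj_sub`). So each estimated phase factor is differentiable at
`h`, whatever the choices were. Existence of an output near `h` follows from the rank bound and from
diagonalizability near a diagonal matrix with distinct entries
(`eventually_exists_diagonalization`).

The chain rule does the rest. The true frequencies lie in `(-π, π)`, away from the cut of the
logarithm, and the inverse trigonometric functions are evaluated at interior points. With `d_l = δ_l
- p_R` the position estimate is `p_R + (∑ C_l)⁻¹ ∑ C_l d_l`; as each `C_l d_l` vanishes at the
truth, no derivative of the inverse is needed. The total derivative is `ε ↦ Im (Ψ ε)`. Finally, for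
circular Gaussian `z` of variance `v`, `Im (b z)` has mean zero and variance `v |b|² / 2`, and
variances of independent terms add up; this yields the Frobenius norm and the factor `1/2`. -/

theorem IsMoorePenrose.unique {A : Matrix m n ℂ} {X Y : Matrix n m ℂ}
    (hX : IsMoorePenrose A X) (hY : IsMoorePenrose A Y) : X = Y := by
  obtain ⟨x1, x2, x3, x4⟩ := hX
  obtain ⟨y1, y2, y3, y4⟩ := hY
  have h1 : A * X = A * Y := by
    calc A * X = (A * X)ᴴ := x3.symm
      _ = (A * Y * (A * X))ᴴ := by rw [← Matrix.mul_assoc, y1]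
      _ = A * X * (A * Y) := by rw [Matrix.conjTranspose_mul, x3, y3]
      _ = A * Y := by rw [← Matrix.mul_assoc, x1]
  have h2 : X * A = Y * A := by
    calc X * A = (X * A)ᴴ := x4.symm
      _ = (X * A * (Y * A))ᴴ := by
        rw [Matrix.mul_assoc, ← Matrix.mul_assoc A, y1]
      _ = Y * A * (X * A) := by rw [Matrix.conjTranspose_mul, x4, y4]
      _ = Y * A := by rw [Matrix.mul_assoc, ← Matrix.mul_assoc A, x1]
  calc X = X * A * X := x2.symm
    _ = Y * A * Y := by rw [h2, Matrix.mul_assoc, h1, ← Matrix.mul_assoc]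
    _ = Y := y2

theorem IsMoorePenrose.pinv_eq {A : Matrix m n ℂ} {X : Matrix n m ℂ}
    (hX : IsMoorePenrose A X) : pinv A = X := by
  have h : ∃ X, IsMoorePenrose A X := ⟨X, hX⟩
  rw [pinv, dif_pos h]
  exact h.choose_spec.unique hX

theorem isUnit_det_of_rank_eq [DecidableEq n] {A : Matrix n n ℂ}
    (h : A.rank = Fintype.card n) : IsUnit A.det := by
  rw [← Matrix.isUnit_iff_isUnit_det, ← Matrix.linearIndependent_cols_iff_isUnit,
    linearIndependent_iff_card_eq_finrank_span, ← h, Matrix.rank_eq_finrank_span_cols]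
  rfl

theorem isUnit_det_conjTranspose_mul_self [DecidableEq n] {A : Matrix m n ℂ}
    (h : A.rank = Fintype.card n) : IsUnit (Aᴴ * A).det :=
  isUnit_det_of_rank_eq (by rw [Matrix.rank_conjTranspose_mul_self, h])

theorem pinv_eq_of_isUnit [DecidableEq n] {A : Matrix m n ℂ} (h : IsUnit (Aᴴ * A).det) :
    pinv A = (Aᴴ * A)⁻¹ * Aᴴ := by
  apply IsMoorePenrose.pinv_eq
  have h1 : (Aᴴ * A)⁻¹ * Aᴴ * A = 1 := by
    rw [Matrix.mul_assoc, Matrix.nonsing_inv_mul _ h]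
  refine ⟨?_, ?_, ?_, ?_⟩
  · rw [Matrix.mul_assoc, h1, Matrix.mul_one]
  · rw [h1, Matrix.one_mul]
  · simp [Matrix.conjTranspose_mul, Matrix.conjTranspose_nonsing_inv, Matrix.mul_assoc]
  · rw [h1, Matrix.conjTranspose_one]

theorem pinv_mul_self [DecidableEq n] {A : Matrix m n ℂ} (h : A.rank = Fintype.card n) :
    pinv A * A = 1 := by
  have h' := isUnit_det_conjTranspose_mul_self h
  rw [pinv_eq_of_isUnit h', Matrix.mul_assoc, Matrix.nonsing_inv_mul _ h']

theorem pinv_eq_of_isUnit_mul_conjTranspose [DecidableEq m] {A : Matrix m n ℂ}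
    (h : IsUnit (A * Aᴴ).det) : pinv A = Aᴴ * (A * Aᴴ)⁻¹ := by
  apply IsMoorePenrose.pinv_eq
  have h1 : A * (Aᴴ * (A * Aᴴ)⁻¹) = 1 := by
    rw [← Matrix.mul_assoc, Matrix.mul_nonsing_inv _ h]
  refine ⟨?_, ?_, ?_, ?_⟩
  · rw [h1, Matrix.one_mul]
  · rw [Matrix.mul_assoc, h1, Matrix.mul_one]
  · rw [h1, Matrix.conjTranspose_one]
  · simp [Matrix.conjTranspose_mul, Matrix.conjTranspose_nonsing_inv, Matrix.mul_assoc]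

/-- The pseudoinverse of a matrix of full column rank commutes with a change of basis. -/
theorem pinv_mul_of_isUnit [DecidableEq n] {A : Matrix m n ℂ} {R : Matrix n n ℂ}
    (h : IsUnit (Aᴴ * A).det) (hR : IsUnit R.det) : pinv (A * R) = R⁻¹ * pinv A := by
  have hRH : IsUnit Rᴴ.det := by rw [Matrix.det_conjTranspose]; exact hR.star
  have h2 : (A * R)ᴴ * (A * R) = Rᴴ * (Aᴴ * A) * R := by
    simp only [Matrix.conjTranspose_mul, Matrix.mul_assoc]
  have h3 : IsUnit ((A * R)ᴴ * (A * R)).det := by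
    rw [h2, Matrix.det_mul, Matrix.det_mul]; exact (hRH.mul h).mul hR
  rw [pinv_eq_of_isUnit h3, pinv_eq_of_isUnit h, h2, Matrix.mul_inv_rev, Matrix.mul_inv_rev,
    Matrix.conjTranspose_mul]
  simp only [Matrix.mul_assoc]
  rw [← Matrix.mul_assoc (Rᴴ)⁻¹, Matrix.nonsing_inv_mul _ hRH, Matrix.one_mul]

end Pinv

/-! ### Compact singular value decomposition -/

section SVD

open scoped ComplexOrder

variable {m n : Type*} [Fintype m] [Fintype n]

/-- An orthonormal eigenbasis `V` of `Aᴴ A` makes the columns of `A V` orthogonal, with the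
eigenvalues as squared lengths; ordering the eigenvalues orders the singular values. -/
theorem exists_orthogonal_columns (A : Matrix m n ℂ) :
    ∃ (d : ℕ) (V : Matrix n (Fin d) ℂ) (B : Matrix m (Fin d) ℂ) (ev : Fin d → ℝ),
      Vᴴ * V = 1 ∧ B = A * V ∧ B * Vᴴ = A ∧ Bᴴ * B = Matrix.diagonal (fun k => (ev k : ℂ)) ∧
      Antitone ev ∧ ∀ k, 0 ≤ ev k := by
  classical
  have hH : (Aᴴ * A).IsHermitian := Matrix.isHermitian_conjTranspose_mul_self A
  have hpos : (Aᴴ * A).PosSemidef := Matrix.posSemidef_conjTranspose_mul_self A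
  -- The same enumeration as in the definition of `eigenvalues`, so `eigenvalues ∘ e` is the
  -- decreasing list `eigenvalues₀`.
  let e : Fin (Fintype.card n) ≃ n := Fintype.equivOfCardEq (Fintype.card_fin _)
  let W : Matrix n n ℂ := hH.eigenvectorUnitary
  have hW1 : Wᴴ * W = 1 := (Matrix.mem_unitaryGroup_iff'.1 hH.eigenvectorUnitary.2)
  have hW2 : W * Wᴴ = 1 := (Matrix.mem_unitaryGroup_iff.1 hH.eigenvectorUnitary.2)
  have hdiag : Wᴴ * (Aᴴ * A) * W = Matrix.diagonal (fun i => (hH.eigenvalues i : ℂ)) := by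
    have h1 : Aᴴ * A * W = W * Matrix.diagonal (fun i => (hH.eigenvalues i : ℂ)) := by
      ext i j
      have h2 := congrFun (hH.mulVec_eigenvectorBasis j) i
      rw [Matrix.mul_diagonal]
      simp only [Pi.smul_apply, Complex.real_smul] at h2
      rw [mul_comm]
      simpa [W, Matrix.mul_apply, Matrix.mulVec, dotProduct] using h2
    rw [Matrix.mul_assoc, h1, ← Matrix.mul_assoc, hW1, Matrix.one_mul]
  refine ⟨_, W.submatrix id e, _, fun k => hH.eigenvalues (e k), ?_, rfl, ?_, ?_, ?_, ?_⟩
  · rw [Matrix.conjTranspose_submatrix]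
    exact (Matrix.submatrix_mul_equiv Wᴴ W e (Equiv.refl n) e).trans (by simp [hW1])
  · have : A * W.submatrix id e = (A * W).submatrix id e := by
      ext; simp [Matrix.mul_apply]
    rw [this, Matrix.conjTranspose_submatrix, Matrix.submatrix_mul_equiv, Matrix.mul_assoc, hW2,
      Matrix.mul_one, Matrix.submatrix_id_id]
  · have : A * W.submatrix id e = (A * W).submatrix id e := by
      ext; simp [Matrix.mul_apply]
    have h3 : (A * W)ᴴ * (A * W) = Matrix.diagonal (fun i => (hH.eigenvalues i : ℂ)) := by
      rw [← hdiag, Matrix.conjTranspose_mul]; simp only [Matrix.mul_assoc]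
    rw [this, Matrix.conjTranspose_submatrix]
    refine (Matrix.submatrix_mul_equiv (A * W)ᴴ (A * W) e (Equiv.refl m) e).trans ?_
    rw [h3]
    simp [Matrix.submatrix_diagonal_equiv, Function.comp_def]
  · intro i j hij
    have h4 : ∀ k, hH.eigenvalues (e k) = hH.eigenvalues₀ k := by
      intro k
      simp only [Matrix.IsHermitian.eigenvalues]
      congr 1
      exact e.symm_apply_apply k
    simp only [h4]
    exact hH.eigenvalues₀_antitone hij
  · exact fun k => hpos.eigenvalues_nonneg (e k)

/-- Normalizing the nonzero columns of `A V` gives the left singular vectors. The columns of length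
zero cannot be normalized and are dropped, so exactly `rank A - L` pairs remain beside the leading
`L`. -/
theorem exists_isLeadingLeftSingular {L : ℕ} (A : Matrix m n ℂ) (hL : L ≤ A.rank) :
    ∃ U : Matrix m (Fin L) ℂ, IsLeadingLeftSingular A U := by
  classical
  obtain ⟨d, V, B, ev, hV, hB, hA, hd, hanti, hnn⟩ := exists_orthogonal_columns A
  have hrank : A.rank = Fintype.card {k // ev k ≠ 0} := by
    have h1 : A.rank = B.rank := by
      refine le_antisymm ?_ (hB ▸ Matrix.rank_mul_le_left A V)
      conv_lhs => rw [← hA]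
      exact Matrix.rank_mul_le_left _ _
    rw [h1, ← Matrix.rank_conjTranspose_mul_self, hd, Matrix.rank_diagonal]
    simp only [ne_eq, Complex.ofReal_eq_zero]
  -- As `ev` is decreasing and nonnegative with `rank A` nonzero entries, these are precisely the
  -- first `rank A` ones.
  have hpos : ∀ k : Fin d, ev k ≠ 0 ↔ k.val < A.rank := by
    intro k
    rw [hrank, Fintype.card_subtype]
    constructor
    · intro hk
      have h2 : Finset.Iic k ⊆ Finset.univ.filter fun k => ev k ≠ 0 := by
        intro j hj
        have h3 := hanti (Finset.mem_Iic.1 hj)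
        have h4 := lt_of_le_of_ne (hnn k) (Ne.symm hk)
        simp only [Finset.mem_filter, Finset.mem_univ, true_and]
        exact (h4.trans_le h3).ne'
      have h5 := Finset.card_le_card h2
      rw [Fin.card_Iic] at h5
      omega
    · intro hk h0
      have h2 : (Finset.univ.filter fun k => ev k ≠ 0) ⊆ Finset.Iio k := by
        intro j hj
        simp only [Finset.mem_filter, Finset.mem_univ, true_and] at hj
        rw [Finset.mem_Iio]
        by_contra hjk
        exact hj (le_antisymm ((hanti (not_lt.1 hjk)).trans h0.le) (hnn j))
      have h5 := Finset.card_le_card h2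
      rw [Fin.card_Iio] at h5
      omega
  obtain ⟨q, hq⟩ := Nat.exists_eq_add_of_le hL
  have hqd : L + q ≤ d := by rw [← hq, hrank]; exact (Fintype.card_subtype_le _).trans_eq (Fintype.card_fin d)
  let f : Fin L ⊕ Fin q → Fin d :=
    Sum.elim (fun l => ⟨l.val, by omega⟩) (fun j => ⟨L + j.val, by omega⟩)
  have hfinj : Function.Injective f := by
    rintro (a | a) (b | b) h <;> simp only [f, Sum.elim_inl, Sum.elim_inr, Fin.mk.injEq] at h
    · rw [Fin.ext h]
    · omega
    · omega
    · rw [Fin.ext (Nat.add_left_cancel h)]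
  have hfne : ∀ s, ev (f s) ≠ 0 := by
    rintro (a | a) <;> rw [hpos] <;> simp only [f, Sum.elim_inl, Sum.elim_inr] <;> omega
  have hsne : ∀ s, ((√(ev (f s)) : ℝ) : ℂ) ≠ 0 := fun s => by
    rw [Complex.ofReal_ne_zero, Real.sqrt_ne_zero (hnn _)]; exact hfne s
  have hBB : ∀ k k', ∑ i, star (B i k) * B i k' = if k = k' then (ev k : ℂ) else 0 := by
    intro k k'
    have := congrFun (congrFun hd k) k'
    simpa [Matrix.mul_apply, Matrix.diagonal_apply] using this
  have hB0 : ∀ k, ev k = 0 → ∀ i, B i k = 0 := by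
    intro k hk i
    have h1 := hBB k k
    rw [if_pos rfl, hk, Complex.ofReal_zero] at h1
    have h2 := (Finset.sum_eq_zero_iff_of_nonneg (fun i _ => star_mul_self_nonneg (B i k))).1 h1 i
      (Finset.mem_univ i)
    simpa using h2
  let U' : Matrix m (Fin L ⊕ Fin q) ℂ := Matrix.of fun i s => B i (f s) / (√(ev (f s)) : ℝ)
  let V' : Matrix n (Fin L ⊕ Fin q) ℂ := V.submatrix id f
  refine ⟨U'.toCols₁, q, V'.toCols₁, U'.toCols₂, V'.toCols₂, fun l => √(ev (f (Sum.inl l))),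
    fun j => √(ev (f (Sum.inr j))), ?_, ?_, ?_, fun _ => Real.sqrt_nonneg _,
    fun _ => Real.sqrt_nonneg _, fun j l => Real.sqrt_le_sqrt (hanti ?_)⟩
  · ext i j
    have h1 : A i j = ∑ k, B i k * star (V j k) := by
      conv_lhs => rw [← hA]
      simp [Matrix.mul_apply]
    have h2 : ∑ k, B i k * star (V j k) = ∑ s, B i (f s) * star (V j (f s)) := by
      -- The indices outside the range of `f` have zero eigenvalue, hence zero columns of `B`, and
      -- contribute nothing.
      refine (Finset.sum_of_injOn f hfinj.injOn (by simp) ?_ (fun _ _ => rfl)).symm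
      intro k _ hk
      rw [hB0 k ?_ i, zero_mul]
      by_contra h0
      apply hk
      have h3 := (hpos k).1 h0
      by_cases hkL : k.val < L
      · exact ⟨Sum.inl ⟨k.val, hkL⟩, by simp, Fin.ext rfl⟩
      · refine ⟨Sum.inr ⟨k.val - L, by omega⟩, by simp, Fin.ext ?_⟩
        simp only [f, Sum.elim_inr]; omega
    rw [h1, h2, Fintype.sum_sum_type, Matrix.add_apply, Matrix.mul_apply, Matrix.mul_apply]
    congr 1 <;> refine Finset.sum_congr rfl fun s _ => ?_ <;>
      simp only [Matrix.mul_diagonal, Matrix.toCols₁_apply, Matrix.toCols₂_apply,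
        Matrix.conjTranspose_apply, U', V', Matrix.of_apply, Matrix.submatrix_apply, id_eq] <;>
      rw [div_mul_cancel₀ _ (hsne _)]
  · rw [Matrix.fromCols_toCols]
    ext s s'
    have h3 : (U'ᴴ * U') s s' = (∑ i, star (B i (f s)) * B i (f s')) /
        ((√(ev (f s)) : ℝ) * (√(ev (f s')) : ℝ)) := by
      rw [Matrix.mul_apply, Finset.sum_div]
      refine Finset.sum_congr rfl fun i _ => ?_
      simp only [U', Matrix.conjTranspose_apply, Matrix.of_apply, star_div₀, Complex.star_def,
        Complex.conj_ofReal]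
      rw [div_mul_div_comm]
    rw [h3, hBB, Matrix.one_apply]
    by_cases hs : s = s'
    · subst hs
      rw [if_pos rfl, if_pos rfl, ← Complex.ofReal_mul, Real.mul_self_sqrt (hnn _), div_self]
      exact Complex.ofReal_ne_zero.2 (hfne s)
    · rw [if_neg (fun h => hs (hfinj h)), if_neg hs, zero_div]
  · rw [Matrix.fromCols_toCols]
    ext s s'
    have h3 : (V'ᴴ * V') s s' = (Vᴴ * V) (f s) (f s') := by simp [Matrix.mul_apply, V']
    rw [h3, hV, Matrix.one_apply, Matrix.one_apply]
    simp only [hfinj.eq_iff]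
  · simp only [f, Sum.elim_inl, Sum.elim_inr, Fin.mk_le_mk]; omega

end SVD

/-! ### Asymptotic calculus for products of rectangular matrices -/

section Asymptotics

open Asymptotics

variable {X a b c : Type*} [Fintype a] [Fintype b] [Fintype c] {l : Filter X}
  {f : X → Matrix a b ℂ} {g : X → Matrix b c ℂ} {u v : X → ℝ}

/-- The Frobenius norm is submultiplicative for factors of any compatible shapes, so `O` and `o`
multiply as for scalars. -/
theorem isBigO_matrix_mul (hf : f =O[l] u) (hg : g =O[l] v) :
    (fun x => f x * g x) =O[l] fun x => u x * v x :=
  (IsBigO.of_norm_le (g := fun x => ‖f x‖ * ‖g x‖)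
    fun x => Matrix.frobenius_norm_mul (f x) (g x)).trans
    (hf.norm_left.mul hg.norm_left)

theorem isLittleO_matrix_mul_right (hf : f =o[l] u) (hg : g =O[l] v) :
    (fun x => f x * g x) =o[l] fun x => u x * v x :=
  (IsBigO.of_norm_le (g := fun x => ‖f x‖ * ‖g x‖)
    fun x => Matrix.frobenius_norm_mul (f x) (g x)).trans_isLittleO
    (hf.norm_left.mul_isBigO hg.norm_left)

theorem isLittleO_matrix_mul_left (hf : f =O[l] u) (hg : g =o[l] v) :
    (fun x => f x * g x) =o[l] fun x => u x * v x :=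
  (IsBigO.of_norm_le (g := fun x => ‖f x‖ * ‖g x‖)
    fun x => Matrix.frobenius_norm_mul (f x) (g x)).trans_isLittleO
    (hf.norm_left.mul_isLittleO hg.norm_left)

theorem isBigO_one_matrix_mul (hf : f =O[l] fun _ => (1 : ℝ)) (hg : g =O[l] fun _ => (1 : ℝ)) :
    (fun x => f x * g x) =O[l] fun _ => (1 : ℝ) := by
  simpa using isBigO_matrix_mul hf hg

theorem tendsto_zero_matrix_mul_isBigO (hf : Tendsto f l (𝓝 0)) (hg : g =O[l] fun _ => (1 : ℝ)) :
    Tendsto (fun x => f x * g x) l (𝓝 0) := by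
  have := isLittleO_matrix_mul_right ((isLittleO_one_iff ℝ).2 hf) hg
  simp only [mul_one] at this
  exact (isLittleO_one_iff ℝ).1 this

theorem isBigO_matrix_mul_tendsto_zero (hf : f =O[l] fun _ => (1 : ℝ)) (hg : Tendsto g l (𝓝 0)) :
    Tendsto (fun x => f x * g x) l (𝓝 0) := by
  have := isLittleO_matrix_mul_left hf ((isLittleO_one_iff ℝ).2 hg)
  simp only [mul_one] at this
  exact (isLittleO_one_iff ℝ).1 this

theorem tendsto_matrix_mul {A : Matrix a b ℂ} {B : Matrix b c ℂ} (hf : Tendsto f l (𝓝 A))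
    (hg : Tendsto g l (𝓝 B)) : Tendsto (fun x => f x * g x) l (𝓝 (A * B)) := by
  have h1 : Tendsto (fun x => f x - A) l (𝓝 0) := by simpa using hf.sub_const A
  have h2 : Tendsto (fun x => g x - B) l (𝓝 0) := by simpa using hg.sub_const B
  have h3 := (tendsto_zero_matrix_mul_isBigO h1 (hg.isBigO_one ℝ)).add
    (isBigO_matrix_mul_tendsto_zero (isBigO_const_const A one_ne_zero l) h2)
  rw [add_zero] at h3
  have h4 := h3.add_const (A * B)
  rw [zero_add] at h4
  refine h4.congr fun x => ?_
  rw [Matrix.sub_mul, Matrix.mul_sub]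
  abel

theorem isBigO_matrix_conjTranspose (hf : f =O[l] u) : (fun x => (f x)ᴴ) =O[l] u :=
  (IsBigO.of_norm_le fun x => (Matrix.frobenius_norm_conjTranspose (f x)).le).trans hf.norm_left

theorem tendsto_matrix_conjTranspose {A : Matrix a b ℂ} (hf : Tendsto f l (𝓝 A)) :
    Tendsto (fun x => (f x)ᴴ) l (𝓝 Aᴴ) := by
  have h1 : Tendsto (fun x => f x - A) l (𝓝 0) := by simpa using hf.sub_const A
  have h3 : Tendsto (fun x => (f x - A)ᴴ) l (𝓝 0) := by
    refine tendsto_zero_iff_norm_tendsto_zero.2 ?_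
    simpa only [Matrix.frobenius_norm_conjTranspose] using
      tendsto_zero_iff_norm_tendsto_zero.1 h1
  have h4 := h3.add_const Aᴴ
  rw [zero_add] at h4
  exact h4.congr fun x => by rw [Matrix.conjTranspose_sub, sub_add_cancel]

theorem tendsto_matrix_inv [DecidableEq a] {f : X → Matrix a a ℂ} {A : Matrix a a ℂ}
    (hf : Tendsto f l (𝓝 A)) (hA : IsUnit A.det) : Tendsto (fun x => (f x)⁻¹) l (𝓝 A⁻¹) := by
  have h1 : ContinuousAt Ring.inverse A := by
    obtain ⟨u, rfl⟩ := (Matrix.isUnit_iff_isUnit_det A).2 hA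
    exact NormedRing.inverse_continuousAt u
  have h2 := h1.tendsto.comp hf
  simpa only [Matrix.nonsing_inv_eq_ringInverse, Function.comp_def] using h2

theorem eventually_isUnit_det [DecidableEq a] {f : X → Matrix a a ℂ} {A : Matrix a a ℂ}
    (hf : Tendsto f l (𝓝 A)) (hA : IsUnit A.det) : ∀ᶠ x in l, IsUnit (f x).det := by
  have h1 := ((Continuous.matrix_det continuous_id).tendsto A).comp hf
  filter_upwards [h1.eventually_ne hA.ne_zero] with x hx
  exact hx.isUnit

end Asymptotics

/-! ### Perturbation of the signal subspace -/

section SignalSubspace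

variable {m n : Type*} [Fintype m] [Fintype n]

theorem frobenius_norm_sq (A : Matrix m n ℂ) : ‖A‖ ^ 2 = ∑ i, ∑ j, ‖A i j‖ ^ 2 := by
  rw [Matrix.frobenius_norm_def, ← Real.sqrt_eq_rpow, Real.sq_sqrt (by positivity)]
  simp

theorem norm_sq_of_orthonormal {q : ℕ} {U : Matrix m (Fin q) ℂ} (hU : Uᴴ * U = 1) :
    ‖U‖ ^ 2 = q := by
  have h1 : ∀ j, ∑ i, ‖U i j‖ ^ 2 = 1 := by
    intro j
    have h2 := congrFun (congrFun hU j) j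
    rw [Matrix.mul_apply, Matrix.one_apply_eq] at h2
    have h3 : ((∑ i, ‖U i j‖ ^ 2 : ℝ) : ℂ) = 1 := by
      rw [← h2]
      push_cast
      refine Finset.sum_congr rfl fun i _ => ?_
      rw [Matrix.conjTranspose_apply, Complex.star_def, Complex.conj_mul']
    exact_mod_cast h3
  rw [frobenius_norm_sq, Finset.sum_comm]
  simp [h1]

theorem norm_le_of_orthonormal {q : ℕ} {U : Matrix m (Fin q) ℂ} (hU : Uᴴ * U = 1) :
    ‖U‖ ≤ q := by
  refine (sq_le_sq₀ (norm_nonneg _) (Nat.cast_nonneg q)).1 ?_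
  rw [norm_sq_of_orthonormal hU]
  exact_mod_cast Nat.le_self_pow two_ne_zero q

theorem norm_diagonal_le {q : ℕ} {σ : Fin q → ℝ} {c : ℝ} (hc : 0 ≤ c) (hσ : ∀ j, |σ j| ≤ c) :
    ‖Matrix.diagonal fun j => (σ j : ℂ)‖ ≤ q * c := by
  refine (sq_le_sq₀ (norm_nonneg _) (by positivity)).1 ?_
  have h1 : ‖Matrix.diagonal fun j => (σ j : ℂ)‖ ^ 2 = ∑ j, |σ j| ^ 2 := by
    rw [Matrix.frobenius_norm_diagonal, PiLp.norm_sq_eq_of_L2]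
    simp
  calc _ ≤ ∑ _j : Fin q, c ^ 2 := by
        rw [h1]
        exact Finset.sum_le_sum fun j _ => pow_le_pow_left₀ (abs_nonneg _) (hσ j) 2
    _ = q * c ^ 2 := by simp
    _ ≤ (q : ℝ) ^ 2 * c ^ 2 := by
        gcongr
        exact_mod_cast Nat.le_self_pow two_ne_zero q
    _ = (q * c) ^ 2 := by ring

theorem norm_mul_diagonal_mul_le {q : ℕ} {U : Matrix m (Fin q) ℂ} {V : Matrix n (Fin q) ℂ}
    {σ : Fin q → ℝ} {c : ℝ} (hU : Uᴴ * U = 1) (hV : Vᴴ * V = 1) (hc : 0 ≤ c)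
    (hσ : ∀ j, |σ j| ≤ c) :
    ‖U * Matrix.diagonal (fun j => (σ j : ℂ)) * Vᴴ‖ ≤ q ^ 3 * c := by
  calc _ ≤ ‖U‖ * ‖Matrix.diagonal fun j => (σ j : ℂ)‖ * ‖Vᴴ‖ :=
        (Matrix.frobenius_norm_mul _ _).trans
          (mul_le_mul_of_nonneg_right (Matrix.frobenius_norm_mul _ _) (norm_nonneg _))
    _ ≤ q * (q * c) * q := by
        rw [Matrix.frobenius_norm_conjTranspose]
        gcongr
        · exact norm_le_of_orthonormal hU
        · exact norm_diagonal_le hc hσ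
        · exact norm_le_of_orthonormal hV
    _ = q ^ 3 * c := by ring

theorem le_card_of_orthonormal {q : ℕ} {U : Matrix m (Fin q) ℂ} (hU : Uᴴ * U = 1) :
    q ≤ Fintype.card m := by
  have h1 : (Uᴴ * U).rank = q := by rw [hU, Matrix.rank_one, Fintype.card_fin]
  rw [← h1]
  exact (Matrix.rank_mul_le_left _ _).trans (Matrix.rank_le_card_width _)

theorem fromCols_orthonormal_iff {L q : ℕ} {U : Matrix m (Fin L) ℂ} {Un : Matrix m (Fin q) ℂ} :
    (Matrix.fromCols U Un)ᴴ * Matrix.fromCols U Un = 1 ↔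
      Uᴴ * U = 1 ∧ Uᴴ * Un = 0 ∧ Unᴴ * U = 0 ∧ Unᴴ * Un = 1 := by
  rw [Matrix.conjTranspose_fromCols_eq_fromRows_conjTranspose, Matrix.fromRows_mul_fromCols,
    ← Matrix.fromBlocks_one, Matrix.fromBlocks_inj]

/-- Near a matrix of rank at least `L` (as witnessed by one-sided inverses), the `L` leading
singular values are bounded away from zero. -/
theorem IsLeadingLeftSingular.exists_svd {L : ℕ} (PL : Matrix (Fin L) m ℂ)
    (WR : Matrix n (Fin L) ℂ) :
    ∃ c : ℝ, 0 < c ∧ ∀ (A : Matrix m n ℂ) (U : Matrix m (Fin L) ℂ),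
      IsLeadingLeftSingular A U → ‖1 - PL * A * WR‖ ≤ 1 / 2 →
      ∃ (V : Matrix n (Fin L) ℂ) (σ : Fin L → ℝ), Uᴴ * U = 1 ∧ Vᴴ * V = 1 ∧
        A * V = U * Matrix.diagonal (fun l => (σ l : ℂ)) ∧
        Uᴴ * A = Matrix.diagonal (fun l => (σ l : ℂ)) * Vᴴ ∧ ∀ l, c ≤ σ l := by
  -- A product `U Σ Vᴴ` with `q` orthonormal columns on each side and entries of `Σ` at most `c` has
  -- norm at most `q³ c`. With `c = 1 / (4 K)` two such terms, sandwiched between `PL` and `WR`,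
  -- have norm at most `(K - 1) c ≤ 1/4`.
  set K : ℝ := ‖PL‖ * ((L : ℝ) ^ 3 + (Fintype.card m : ℝ) ^ 3) * ‖WR‖ + 1 with hK
  have hK1 : 0 < K := by positivity
  refine ⟨1 / (4 * K), by positivity, ?_⟩
  rintro A U ⟨q, V, Un, Vn, σ, σn, hA, hU, hV, hσ, hσn, hle⟩ hnear
  obtain ⟨u1, u2, u3, u4⟩ := fromCols_orthonormal_iff.1 hU
  obtain ⟨v1, v2, v3, v4⟩ := fromCols_orthonormal_iff.1 hV
  refine ⟨V, σ, u1, v1, ?_, ?_, ?_⟩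
  · rw [hA, Matrix.add_mul, Matrix.mul_assoc _ Vᴴ, v1, Matrix.mul_assoc _ Vnᴴ, v3]
    simp
  · rw [hA, Matrix.mul_add, ← Matrix.mul_assoc, ← Matrix.mul_assoc, u1, ← Matrix.mul_assoc,
      ← Matrix.mul_assoc, u2]
    simp
  · intro l
    by_contra! hlt
    set c := 1 / (4 * K) with hc
    have hc0 : 0 < c := by positivity
    -- If the singular value with index `l` were below `c`, so would be all of `σn`. Removing it and
    -- the whole `Σₙ` part changes `PL A WR` by at most `1/4` and leaves a singular matrix `B`. But
    -- `‖1 - B‖ ≤ 1/2 + 1/4 < 1` makes `B` invertible.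
    let σ' : Fin L → ℝ := Function.update σ l 0
    let τ : Fin L → ℝ := Function.update 0 l (σ l)
    have hsum : Matrix.diagonal (fun l => (σ l : ℂ)) =
        Matrix.diagonal (fun l => (σ' l : ℂ)) + Matrix.diagonal (fun l => (τ l : ℂ)) := by
      rw [Matrix.diagonal_add]
      congr 1
      ext k
      by_cases hk : k = l
      · subst hk; simp [σ', τ]
      · simp [σ', τ, hk]
    set B := PL * (U * Matrix.diagonal (fun l => (σ' l : ℂ)) * Vᴴ) * WR with hB
    have hBdet : B.det = 0 := by
      have h1 : B = PL * U * Matrix.diagonal (fun l => (σ' l : ℂ)) * (Vᴴ * WR) := by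
        simp only [hB, Matrix.mul_assoc]
      rw [h1, Matrix.det_mul, Matrix.det_mul, Matrix.det_diagonal,
        Finset.prod_eq_zero (Finset.mem_univ l) (by simp [σ'])]
      simp
    have hdiff : PL * A * WR - B = PL * (U * Matrix.diagonal (fun l => (τ l : ℂ)) * Vᴴ
        + Un * Matrix.diagonal (fun j => (σn j : ℂ)) * Vnᴴ) * WR := by
      rw [hB, hA, hsum]
      simp only [Matrix.mul_add, Matrix.add_mul]
      abel
    have h2 : ‖PL * A * WR - B‖ ≤ ‖PL‖ * ((L : ℝ) ^ 3 * c + (Fintype.card m : ℝ) ^ 3 * c) * ‖WR‖ := by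
      rw [hdiff]
      refine (Matrix.frobenius_norm_mul _ _).trans (mul_le_mul_of_nonneg_right ?_ (norm_nonneg _))
      refine (Matrix.frobenius_norm_mul _ _).trans (mul_le_mul_of_nonneg_left ?_ (norm_nonneg _))
      refine (norm_add_le _ _).trans (add_le_add ?_ ?_)
      · refine norm_mul_diagonal_mul_le u1 v1 hc0.le fun j => ?_
        by_cases hj : j = l
        · subst hj; simp [τ, abs_of_nonneg (hσ j), hlt.le]
        · simp [τ, hj, hc0.le]
      · refine (norm_mul_diagonal_mul_le u4 v4 hc0.le fun j => ?_).trans ?_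
        · rw [abs_of_nonneg (hσn j)]; exact (hle j l).trans hlt.le
        · have := le_card_of_orthonormal u4
          gcongr
    have h3 : ‖PL * A * WR - B‖ ≤ 1 / 4 := by
      refine h2.trans ?_
      have : ‖PL‖ * ((L : ℝ) ^ 3 * c + (Fintype.card m : ℝ) ^ 3 * c) * ‖WR‖ = (K - 1) * c := by
        rw [hK]; ring
      rw [this, hc, mul_one_div, div_le_div_iff₀ (by positivity) (by norm_num)]
      linarith
    have h4 : ‖1 - B‖ < 1 := by
      have : 1 - B = (1 - PL * A * WR) + (PL * A * WR - B) := by abel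
      rw [this]
      refine (norm_add_le _ _).trans_lt ?_
      linarith
    have h5 := isUnit_one_sub_of_norm_lt_one h4
    rw [sub_sub_cancel, Matrix.isUnit_iff_isUnit_det, hBdet] at h5
    exact not_isUnit_zero h5

open Asymptotics in
/-- Let `A` tend to `P W`, where `P` has a left inverse `PL` and `W` the right inverse `WR` for which
`WR W` is an orthogonal projection. Then any leading left singular vectors of `A` span the columns
of `A Y`, where `Y` tends to `WR`. -/
theorem exists_tendsto_signal_subspace {X : Type*} {l : Filter X} {L : ℕ}
    {A : X → Matrix m n ℂ} {U : X → Matrix m (Fin L) ℂ}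
    (hU : ∀ᶠ x in l, IsLeadingLeftSingular (A x) (U x))
    {P : Matrix m (Fin L) ℂ} {W : Matrix (Fin L) n ℂ} {PL : Matrix (Fin L) m ℂ}
    {WR : Matrix n (Fin L) ℂ} (hA : Tendsto A l (𝓝 (P * W))) (hPL : PL * P = 1)
    (hWR : W * WR = 1) (hWH : (WR * W)ᴴ = WR * W) :
    ∃ Y : X → Matrix n (Fin L) ℂ, Tendsto Y l (𝓝 WR) ∧
      ∀ᶠ x in l, IsUnit (PL * U x).det ∧ A x * Y x * (PL * U x) = U x := by
  classical
  obtain ⟨c, hc, hsvd⟩ := IsLeadingLeftSingular.exists_svd PL WR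
  have hone : Tendsto (fun x => PL * A x * WR) l (𝓝 1) := by
    have := tendsto_matrix_mul (tendsto_matrix_mul (tendsto_const_nhds (x := PL)) hA)
      (tendsto_const_nhds (x := WR))
    rwa [← Matrix.mul_assoc PL, hPL, Matrix.one_mul, hWR] at this
  have hnear : ∀ᶠ x in l, ‖1 - PL * A x * WR‖ ≤ 1 / 2 := by
    have h1 : Tendsto (fun x => ‖1 - PL * A x * WR‖) l (𝓝 0) := by
      have := (tendsto_const_nhds (x := (1 : Matrix (Fin L) (Fin L) ℂ))).sub hone
      rw [sub_self] at this
      exact tendsto_zero_iff_norm_tendsto_zero.1 this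
    exact h1.eventually_le_const (by norm_num)
  have hex : ∀ᶠ x in l, ∃ (V : Matrix n (Fin L) ℂ) (σ : Fin L → ℝ), (U x)ᴴ * U x = 1 ∧
      Vᴴ * V = 1 ∧ A x * V = U x * Matrix.diagonal (fun l => (σ l : ℂ)) ∧
      (U x)ᴴ * A x = Matrix.diagonal (fun l => (σ l : ℂ)) * Vᴴ ∧ ∀ l, c ≤ σ l := by
    filter_upwards [hU, hnear] with x h1 h2 using hsvd _ _ h1 h2
  choose! V σ hVσ using fun x (hx : ∃ (V : Matrix n (Fin L) ℂ) (σ : Fin L → ℝ), (U x)ᴴ * U x = 1 ∧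
      Vᴴ * V = 1 ∧ A x * V = U x * Matrix.diagonal (fun l => (σ l : ℂ)) ∧
      (U x)ᴴ * A x = Matrix.diagonal (fun l => (σ l : ℂ)) * Vᴴ ∧ ∀ l, c ≤ σ l) => hx
  replace hVσ := hex.mono hVσ
  clear hex
  let Si : X → Matrix (Fin L) (Fin L) ℂ := fun x => Matrix.diagonal fun l => (((σ x l)⁻¹ : ℝ) : ℂ)
  have hUb : U =O[l] fun _ => (1 : ℝ) := by
    refine IsBigO.of_bound L ?_
    filter_upwards [hVσ] with x hx
    simpa using norm_le_of_orthonormal hx.1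
  have hVb : V =O[l] fun _ => (1 : ℝ) := by
    refine IsBigO.of_bound L ?_
    filter_upwards [hVσ] with x hx
    simpa using norm_le_of_orthonormal hx.2.1
  have hSb : Si =O[l] fun _ => (1 : ℝ) := by
    refine IsBigO.of_bound (L * c⁻¹) ?_
    filter_upwards [hVσ] with x hx
    rw [norm_one, mul_one]
    refine norm_diagonal_le (inv_nonneg.2 hc.le) fun j => ?_
    have := hx.2.2.2.2 j
    rw [abs_of_nonneg (inv_nonneg.2 (hc.le.trans this))]
    exact inv_anti₀ hc this
  have hSS : ∀ᶠ x in l, Matrix.diagonal (fun l => (σ x l : ℂ)) * Si x = 1 := by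
    filter_upwards [hVσ] with x hx
    rw [Matrix.diagonal_mul_diagonal, ← Matrix.diagonal_one]
    congr 1
    ext j
    rw [← Complex.ofReal_mul, mul_inv_cancel₀ (hc.trans_le (hx.2.2.2.2 j)).ne', Complex.ofReal_one]
  have hUeq : ∀ᶠ x in l, U x = A x * V x * Si x := by
    filter_upwards [hVσ, hSS] with x hx hs
    rw [hx.2.2.1, Matrix.mul_assoc, hs, Matrix.mul_one]
  have hVeq : ∀ᶠ x in l, V x = (A x)ᴴ * U x * Si x := by
    filter_upwards [hVσ, hSS] with x hx hs
    have h1 := congrArg Matrix.conjTranspose hx.2.2.2.1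
    rw [Matrix.conjTranspose_mul, Matrix.conjTranspose_mul, Matrix.conjTranspose_conjTranspose,
      Matrix.conjTranspose_conjTranspose] at h1
    have h2 : (Matrix.diagonal fun l => (σ x l : ℂ))ᴴ = Matrix.diagonal fun l => (σ x l : ℂ) := by
      rw [Matrix.diagonal_conjTranspose]
      congr 1
      ext j
      simp
    rw [h1, h2, Matrix.mul_assoc, hs, Matrix.mul_one]
  -- From here on only bounds on `U`, `V` and `Σ⁻¹` are used; none of them is claimed to converge.
  have hE : Tendsto (fun x => A x - P * W) l (𝓝 0) := by
    simpa using hA.sub (tendsto_const_nhds (x := P * W))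
  set R : X → Matrix (Fin L) (Fin L) ℂ := fun x => PL * U x with hR
  have hRb : R =O[l] fun _ => (1 : ℝ) := isBigO_one_matrix_mul (isBigO_const_const _ one_ne_zero _) hUb
  -- `1 - P PL` annihilates `P W`, so applied to `U = A V Σ⁻¹` it only sees the error `A - P W`.
  have hδ : Tendsto (fun x => U x - P * R x) l (𝓝 0) := by
    have h1 : Tendsto (fun x => (1 - P * PL) * (A x - P * W) * V x * Si x) l (𝓝 0) :=
      tendsto_zero_matrix_mul_isBigO (tendsto_zero_matrix_mul_isBigO
        (isBigO_matrix_mul_tendsto_zero (isBigO_const_const _ one_ne_zero _) hE) hVb) hSb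
    refine h1.congr' ?_
    filter_upwards [hUeq] with x hx
    have h2 : (1 - P * PL) * (A x - P * W) = (1 - P * PL) * A x := by
      rw [Matrix.mul_sub, Matrix.sub_mul _ _ (P * W), Matrix.mul_assoc P PL, ← Matrix.mul_assoc PL,
        hPL]
      simp
    rw [h2, Matrix.mul_assoc, Matrix.mul_assoc, ← Matrix.mul_assoc (A x), ← hx, Matrix.sub_mul,
      Matrix.one_mul, Matrix.mul_assoc]
  -- `P R` is close to `U`, so its Gram matrix is close to `Uᴴ U = 1`. This expresses `R⁻¹` through
  -- bounded quantities.
  have hS : Tendsto (fun x => (R x)ᴴ * (Pᴴ * P) * R x) l (𝓝 1) := by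
    have h1 : Tendsto (fun x => 1 - (U x - P * R x)ᴴ * U x - (U x)ᴴ * (U x - P * R x)
        + (U x - P * R x)ᴴ * (U x - P * R x)) l (𝓝 1) := by
      have hδH := tendsto_matrix_conjTranspose hδ
      rw [Matrix.conjTranspose_zero] at hδH
      have t1 := tendsto_zero_matrix_mul_isBigO hδH hUb
      have t2 := isBigO_matrix_mul_tendsto_zero (isBigO_matrix_conjTranspose hUb) hδ
      have t3 := tendsto_matrix_mul hδH hδ
      have := ((tendsto_const_nhds (x := (1 : Matrix (Fin L) (Fin L) ℂ))).sub t1).sub t2 |>.add t3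
      simpa using this
    refine h1.congr' ?_
    filter_upwards [hVσ] with x hx
    rw [← hx.1]
    simp only [Matrix.conjTranspose_sub, Matrix.conjTranspose_mul, Matrix.sub_mul, Matrix.mul_sub,
      Matrix.mul_assoc]
    abel
  have hSinv := tendsto_matrix_inv hS (by simp)
  rw [inv_one] at hSinv
  have hRunit : ∀ᶠ x in l, IsUnit (R x).det ∧
      (R x)⁻¹ = ((R x)ᴴ * (Pᴴ * P) * R x)⁻¹ * ((R x)ᴴ * (Pᴴ * P)) := by
    filter_upwards [eventually_isUnit_det hS (by simp)] with x hx
    have h1 : IsUnit (R x).det := by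
      rw [Matrix.det_mul] at hx
      exact isUnit_of_mul_isUnit_right hx
    refine ⟨h1, ?_⟩
    refine Matrix.inv_eq_left_inv ?_
    rw [Matrix.mul_assoc, Matrix.nonsing_inv_mul _ hx]
  have hRi : (fun x => (R x)⁻¹) =O[l] fun _ => (1 : ℝ) := by
    refine IsBigO.congr' (isBigO_one_matrix_mul (hSinv.isBigO_one ℝ) (isBigO_one_matrix_mul
      (isBigO_matrix_conjTranspose hRb) (isBigO_const_const (Pᴴ * P) one_ne_zero l))) ?_ EventuallyEq.rfl
    filter_upwards [hRunit] with x hx using hx.2.symm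
  let Y : X → Matrix n (Fin L) ℂ := fun x => V x * Si x * (R x)⁻¹
  have hYb : Y =O[l] fun _ => (1 : ℝ) := isBigO_one_matrix_mul (isBigO_one_matrix_mul hVb hSb) hRi
  have hAY : ∀ᶠ x in l, A x * Y x * R x = U x := by
    filter_upwards [hRunit, hUeq] with x hx hu
    rw [Matrix.mul_assoc, Matrix.mul_assoc, Matrix.nonsing_inv_mul _ hx.1, Matrix.mul_one,
      ← Matrix.mul_assoc, ← hu]
  refine ⟨Y, ?_, ?_⟩
  -- `Y` is split as `WR (W Y) + (1 - WR W) Y`. In the first part `W Y → 1`, because `PL A Y = 1`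
  -- and `A` is close to `P W`.
  · have hWY : Tendsto (fun x => W * Y x) l (𝓝 1) := by
      have h1 : Tendsto (fun x => 1 - PL * (A x - P * W) * Y x) l (𝓝 1) := by
        have := (tendsto_const_nhds (x := (1 : Matrix (Fin L) (Fin L) ℂ))).sub
          (tendsto_zero_matrix_mul_isBigO
          (isBigO_matrix_mul_tendsto_zero (isBigO_const_const PL (one_ne_zero (α := ℝ)) l) hE) hYb)
        simpa using this
      refine h1.congr' ?_
      filter_upwards [hAY, hRunit] with x hx hr
      have h2 : PL * A x * Y x = 1 := by
        have h3 : PL * A x * Y x * R x = R x := by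
          rw [Matrix.mul_assoc, Matrix.mul_assoc, ← Matrix.mul_assoc (A x), hx]
        calc PL * A x * Y x = PL * A x * Y x * R x * (R x)⁻¹ := by
              rw [Matrix.mul_assoc _ (R x), Matrix.mul_nonsing_inv _ hr.1, Matrix.mul_one]
          _ = 1 := by rw [h3, Matrix.mul_nonsing_inv _ hr.1]
      rw [Matrix.mul_sub, Matrix.sub_mul, h2, ← Matrix.mul_assoc PL, hPL, Matrix.one_mul]
      abel
    -- Here `V = Aᴴ U Σ⁻¹` is used: the self-adjoint projection `1 - WR W` annihilates `Wᴴ`, so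
    -- applied to `Aᴴ` it leaves only the error.
    have hN : Tendsto (fun x => (1 - WR * W) * Y x) l (𝓝 0) := by
      have hEH := tendsto_matrix_conjTranspose hE
      rw [Matrix.conjTranspose_zero] at hEH
      have h1 : Tendsto (fun x => (1 - WR * W) * (A x - P * W)ᴴ * U x * Si x * Si x * (R x)⁻¹) l
          (𝓝 0) :=
        tendsto_zero_matrix_mul_isBigO (tendsto_zero_matrix_mul_isBigO
          (tendsto_zero_matrix_mul_isBigO (tendsto_zero_matrix_mul_isBigO
          (isBigO_matrix_mul_tendsto_zero (isBigO_const_const _ one_ne_zero _) hEH) hUb) hSb) hSb) hRi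
      refine h1.congr' ?_
      filter_upwards [hVeq] with x hx
      have h2 : (1 - WR * W) * (A x - P * W)ᴴ = (1 - WR * W) * (A x)ᴴ := by
        have h3 : W * (1 - WR * W) = 0 := by
          rw [Matrix.mul_sub, ← Matrix.mul_assoc, hWR]; simp
        have h4 := congrArg Matrix.conjTranspose h3
        rw [Matrix.conjTranspose_mul, Matrix.conjTranspose_sub, hWH, Matrix.conjTranspose_one,
          Matrix.conjTranspose_zero] at h4
        rw [Matrix.conjTranspose_sub, Matrix.mul_sub, Matrix.conjTranspose_mul P,
          ← Matrix.mul_assoc _ Wᴴ, h4, Matrix.zero_mul, sub_zero]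
      simp only [Y]
      rw [h2]
      conv_rhs => rw [hx]
      simp only [Matrix.mul_assoc]
    have h5 := (tendsto_matrix_mul (tendsto_const_nhds (x := WR)) hWY).add hN
    rw [Matrix.mul_one, add_zero] at h5
    refine h5.congr fun x => ?_
    rw [Matrix.sub_mul, Matrix.one_mul, ← Matrix.mul_assoc]
    abel
  · filter_upwards [hAY, hRunit] with x hx hr using ⟨hr.1, hx⟩

end SignalSubspace

/-! ### Perturbation of simple eigenvalues -/

section Eigen

open Asymptotics

theorem norm_entry_le {m n : Type*} [Fintype m] [Fintype n] (A : Matrix m n ℂ) (i : m) (j : n) :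
    ‖A i j‖ ≤ ‖A‖ := by
  refine (sq_le_sq₀ (norm_nonneg _) (norm_nonneg _)).1 ?_
  rw [frobenius_norm_sq]
  exact (Finset.single_le_sum (f := fun j => ‖A i j‖ ^ 2) (fun _ _ => by positivity)
    (Finset.mem_univ j)).trans (Finset.single_le_sum (f := fun i => ∑ j, ‖A i j‖ ^ 2)
    (fun _ _ => by positivity) (Finset.mem_univ i))

theorem frobenius_norm_le_sum {m n : Type*} [Fintype m] [Fintype n] (A : Matrix m n ℂ) :
    ‖A‖ ≤ ∑ i, ∑ j, ‖A i j‖ := by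
  refine (sq_le_sq₀ (norm_nonneg _) (by positivity)).1 ?_
  rw [frobenius_norm_sq, ← Finset.sum_product', ← Finset.sum_product']
  exact Finset.sum_sq_le_sq_sum_of_nonneg fun _ _ => norm_nonneg _

theorem isLittleO_entry {X m n : Type*} [Fintype m] [Fintype n] {l : Filter X}
    {f : X → Matrix m n ℂ} {g : X → ℝ} (hf : f =o[l] g) (i : m) (j : n) :
    (fun x => f x i j) =o[l] g :=
  (IsBigO.of_norm_le fun x => norm_entry_le (f x) i j).trans_isLittleO hf.norm_left

theorem isBigO_of_entries {X m n : Type*} [Fintype m] [Fintype n] {l : Filter X}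
    {f : X → Matrix m n ℂ} {g : X → ℝ} (hf : ∀ i j, (fun x => f x i j) =O[l] g) : f =O[l] g := by
  refine (IsBigO.of_norm_le fun x => frobenius_norm_le_sum (f x)).trans ?_
  have h1 := IsBigO.sum (s := Finset.univ) fun i _ =>
    IsBigO.sum (s := Finset.univ) fun j _ => (hf i j).norm_left
  simpa only [Finset.sum_fn] using h1

variable {L : ℕ}

theorem exists_separation {Λ : Fin L → ℂ} (hΛ : Function.Injective Λ) :
    ∃ d : ℝ, 0 < d ∧ d ≤ 1 ∧ ∀ k l, k ≠ l → d ≤ ‖Λ k - Λ l‖ := by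
  -- Stated as an eventual property as `d ↓ 0`, so that a positive `d` exists also when there is no
  -- pair of distinct indices.
  have h1 : ∀ᶠ d in 𝓝[>] (0 : ℝ), ∀ k l, k ≠ l → d ≤ ‖Λ k - Λ l‖ := by
    simp only [eventually_all]
    intro k l hkl
    have h2 : 0 < ‖Λ k - Λ l‖ := norm_pos_iff.2 (sub_ne_zero.2 fun h => hkl (hΛ h))
    exact nhdsWithin_le_nhds (eventually_le_nhds h2)
  obtain ⟨d, ⟨h1, h2⟩, h3⟩ := ((h1.and (nhdsWithin_le_nhds (eventually_le_nhds one_pos))).and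
    self_mem_nhdsWithin).exists
  exact ⟨d, h3, h2, h1⟩

/-- An approximate eigenvector of a diagonal matrix with separated entries concentrates on a single
coordinate. -/
theorem eigenvector_concentration {H F : Matrix (Fin L) (Fin L) ℂ} {Λ ev : Fin L → ℂ} {d : ℝ}
    (hd : 0 < d) (hsep : ∀ k l, k ≠ l → d ≤ ‖Λ k - Λ l‖) (hF : IsUnit F.det)
    (hev : H * F = F * Matrix.diagonal ev) (hlab : ∀ l k, ‖ev l - Λ l‖ ≤ ‖ev l - Λ k‖)
    (hsmall : 4 * (L * ‖H - Matrix.diagonal Λ‖) ≤ d) (l : Fin L) :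
    F l l ≠ 0 ∧ ∀ k, k ≠ l → ‖F k l‖ ≤ 2 / d * (L * ‖H - Matrix.diagonal Λ‖) * ‖F l l‖ := by
  set G := H - Matrix.diagonal Λ with hG
  have heq : ∀ k, (ev l - Λ k) * F k l = ∑ j, G k j * F j l := by
    intro k
    have h1 : (G * F) k l = (F * Matrix.diagonal ev) k l - (Matrix.diagonal Λ * F) k l := by
      rw [hG, Matrix.sub_mul, Matrix.sub_apply, hev]
    rw [Matrix.mul_diagonal, Matrix.diagonal_mul, Matrix.mul_apply] at h1
    rw [h1]; ring
  -- At the largest entry of the column, the eigenvalue equation puts `ev l` within `L ‖G‖` of `Λ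
  -- k₀`, hence of `Λ l` by the labelling. All other `Λ k` are then at distance at least `d / 2`,
  -- which makes the entries `k ≠ l` small and forces `k₀ = l`.
  obtain ⟨k₀, -, hk₀⟩ := Finset.exists_max_image Finset.univ (fun k => ‖F k l‖) ⟨l, Finset.mem_univ l⟩
  replace hk₀ : ∀ k, ‖F k l‖ ≤ ‖F k₀ l‖ := fun k => hk₀ k (Finset.mem_univ k)
  have hbound : ∀ k, ‖ev l - Λ k‖ * ‖F k l‖ ≤ L * ‖G‖ * ‖F k₀ l‖ := by
    intro k
    rw [← norm_mul, heq]
    calc ‖∑ j, G k j * F j l‖ ≤ ∑ _j : Fin L, ‖G‖ * ‖F k₀ l‖ := norm_sum_le_of_le _ fun j _ => by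
          rw [norm_mul]
          exact mul_le_mul (norm_entry_le G k j) (hk₀ j) (norm_nonneg _) (norm_nonneg _)
      _ = L * ‖G‖ * ‖F k₀ l‖ := by simp; ring
  have hpos : 0 < ‖F k₀ l‖ := by
    by_contra h0
    have h1 : ∀ k, F k l = 0 := fun k => norm_le_zero_iff.1 ((hk₀ k).trans (not_lt.1 h0))
    exact hF.ne_zero (Matrix.det_eq_zero_of_column_eq_zero l h1)
  have hlam : ‖ev l - Λ l‖ ≤ L * ‖G‖ :=
    (hlab l k₀).trans (le_of_mul_le_mul_right (hbound k₀) hpos)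
  have hne : ∀ k, k ≠ l → ‖F k l‖ ≤ 2 / d * (L * ‖G‖) * ‖F k₀ l‖ := by
    intro k hk
    have h1 : d / 2 ≤ ‖ev l - Λ k‖ := by
      have h2 := norm_sub_le (ev l - Λ k) (ev l - Λ l)
      have h3 : ev l - Λ k - (ev l - Λ l) = Λ l - Λ k := by ring
      rw [h3] at h2
      have h4 := hsep l k hk.symm
      linarith [norm_nonneg G]
    have h5 : d / 2 * ‖F k l‖ ≤ L * ‖G‖ * ‖F k₀ l‖ :=
      (mul_le_mul_of_nonneg_right h1 (norm_nonneg _)).trans (hbound k)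
    calc ‖F k l‖ = 2 / d * (d / 2 * ‖F k l‖) := by field_simp
      _ ≤ 2 / d * (L * ‖G‖ * ‖F k₀ l‖) := by gcongr
      _ = _ := by ring
  have hk : k₀ = l := by
    by_contra h
    have h1 := hne k₀ h
    have h2 : 2 / d * (L * ‖G‖) ≤ 1 / 2 := by
      rw [div_mul_eq_mul_div, div_le_div_iff₀ hd two_pos]
      linarith
    nlinarith
  subst hk
  exact ⟨norm_pos_iff.1 hpos, hne⟩

/-- If `F` diagonalizes a small perturbation of a diagonal matrix with distinct entries, and `K` is
a perturbation of a diagonal matrix, then the diagonals of `F⁻¹ K F` and `K` agree to first order. -/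
theorem isLittleO_diag_conj_sub {X : Type*} {l : Filter X} {g : X → ℝ} (hg : Tendsto g l (𝓝 0))
    {H F K : X → Matrix (Fin L) (Fin L) ℂ} {Λ φ : Fin L → ℂ} {ev : X → Fin L → ℂ}
    (hΛ : Function.Injective Λ) (hH : (fun x => H x - Matrix.diagonal Λ) =O[l] g)
    (hK : (fun x => K x - Matrix.diagonal φ) =O[l] g)
    (hF : ∀ᶠ x in l, IsUnit (F x).det ∧ H x * F x = F x * Matrix.diagonal (ev x) ∧
      ∀ l k, ‖ev x l - Λ l‖ ≤ ‖ev x l - Λ k‖) (i : Fin L) :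
    (fun x => ((F x)⁻¹ * K x * F x) i i - K x i i) =o[l] g := by
  obtain ⟨d, hd, -, hsep⟩ := exists_separation hΛ
  have hsmall : ∀ᶠ x in l, 4 * (L * ‖H x - Matrix.diagonal Λ‖) ≤ d := by
    have h1 : Tendsto (fun x => 4 * (L * ‖H x - Matrix.diagonal Λ‖)) l (𝓝 (4 * (L * 0))) :=
      ((tendsto_zero_iff_norm_tendsto_zero.1 (hH.trans_tendsto hg)).const_mul _).const_mul _
    rw [mul_zero, mul_zero] at h1
    exact h1.eventually_le_const hd
  have hconc := hF.and hsmall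
  -- Dividing each column by its diagonal entry removes the free scaling of eigenvectors. It does
  -- not affect the diagonal of the conjugated matrix.
  let D : X → Matrix (Fin L) (Fin L) ℂ := fun x => Matrix.diagonal fun l => (F x l l)⁻¹
  let N : X → Matrix (Fin L) (Fin L) ℂ := fun x => F x * D x
  have hgo : g =o[l] fun _ => (1 : ℝ) := (isLittleO_one_iff ℝ).2 hg
  have hN1 : (fun x => N x - 1) =O[l] g := by
    refine IsBigO.trans (isBigO_of_entries (g := fun x => ‖H x - Matrix.diagonal Λ‖)
      fun k j => ?_) hH.norm_left
    refine IsBigO.of_bound (2 / d * L) ?_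
    filter_upwards [hconc] with x ⟨⟨h1, h2, h3⟩, h4⟩
    obtain ⟨h5, h6⟩ := eigenvector_concentration hd hsep h1 h2 h3 h4 j
    simp only [N, D, Matrix.sub_apply, Matrix.mul_diagonal, norm_norm]
    by_cases hkj : k = j
    · subst hkj
      rw [mul_inv_cancel₀ h5, Matrix.one_apply_eq, sub_self, norm_zero]
      positivity
    · rw [Matrix.one_apply_ne hkj, sub_zero, norm_mul, norm_inv, ← div_eq_mul_inv,
        div_le_iff₀ (norm_pos_iff.2 h5)]
      exact (h6 k hkj).trans_eq (by ring)
  have hN : Tendsto N l (𝓝 1) := by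
    have := (hN1.trans_tendsto hg).add_const (1 : Matrix (Fin L) (Fin L) ℂ)
    rw [zero_add] at this
    exact this.congr fun x => sub_add_cancel _ _
  have hNi : Tendsto (fun x => (N x)⁻¹ - 1) l (𝓝 0) := by
    have := (tendsto_matrix_inv hN (by simp)).sub_const (1 : Matrix (Fin L) (Fin L) ℂ)
    simpa using this
  have hKb : K =O[l] fun _ => (1 : ℝ) := by
    have := ((hK.trans hgo.isBigO).add
      (isBigO_const_const (Matrix.diagonal φ) (one_ne_zero (α := ℝ)) l))
    simpa using this
  have hC : (fun x => K x * (N x - 1) - (N x - 1) * K x) =O[l] g := by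
    have h1 := isBigO_matrix_mul hKb hN1
    have h2 := isBigO_matrix_mul hN1 hKb
    simp only [one_mul, mul_one] at h1 h2
    exact h1.sub h2
  have ho1 : (fun x => ((N x)⁻¹ - 1) * (K x * (N x - 1) - (N x - 1) * K x)) =o[l] g := by
    simpa using isLittleO_matrix_mul_right ((isLittleO_one_iff ℝ).2 hNi) hC
  have hKo : (fun x => K x - Matrix.diagonal φ) =o[l] fun _ => (1 : ℝ) := hK.trans_isLittleO hgo
  have ho2 : (fun x => (K x - Matrix.diagonal φ) * (N x - 1)
      - (N x - 1) * (K x - Matrix.diagonal φ)) =o[l] g := by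
    have h1 := isLittleO_matrix_mul_right hKo hN1
    have h2 := isLittleO_matrix_mul_left hN1 hKo
    simp only [one_mul, mul_one] at h1 h2
    exact h1.sub h2
  refine (isLittleO_entry (ho1.add ho2) i i).congr' ?_ EventuallyEq.rfl
  filter_upwards [hconc] with x ⟨⟨h1, h2, h3⟩, h4⟩
  have hne : ∀ j, F x j j ≠ 0 := fun j => (eigenvector_concentration hd hsep h1 h2 h3 h4 j).1
  have hDu : IsUnit (D x).det := by
    simp only [D, Matrix.det_diagonal]
    exact (Finset.prod_ne_zero_iff.2 fun j _ => inv_ne_zero (hne j)).isUnit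
  have hNu : IsUnit (N x).det := by
    simp only [N, Matrix.det_mul]; exact h1.mul hDu
  have e1 : ((F x)⁻¹ * K x * F x) i i = ((N x)⁻¹ * K x * N x) i i := by
    have hDi : (D x)⁻¹ = Matrix.diagonal fun l => F x l l := by
      refine Matrix.inv_eq_left_inv ?_
      simp only [D, Matrix.diagonal_mul_diagonal]
      rw [← Matrix.diagonal_one]
      congr 1; ext j; exact mul_inv_cancel₀ (hne j)
    have e2 : (N x)⁻¹ * K x * N x = (D x)⁻¹ * ((F x)⁻¹ * K x * F x) * D x := by
      simp only [N, Matrix.mul_inv_rev, Matrix.mul_assoc]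
    rw [e2, hDi]
    simp only [D, Matrix.mul_diagonal, Matrix.diagonal_mul]
    rw [mul_comm (F x i i)]
    exact (mul_inv_cancel_right₀ (hne i) _).symm
  -- The first two terms are of higher order: `(N⁻¹ - 1)` times an `O(g)` commutator, and the
  -- commutator of two `O(g)` matrices. The last is a commutator with a diagonal matrix and has zero
  -- diagonal.
  have e3 : (N x)⁻¹ * K x * N x - K x =
      ((N x)⁻¹ - 1) * (K x * (N x - 1) - (N x - 1) * K x)
      + ((K x - Matrix.diagonal φ) * (N x - 1) - (N x - 1) * (K x - Matrix.diagonal φ))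
      + (Matrix.diagonal φ * (N x - 1) - (N x - 1) * Matrix.diagonal φ) := by
    have e4 : (N x)⁻¹ * N x = 1 := Matrix.nonsing_inv_mul _ hNu
    have e5 : (N x)⁻¹ * K x * N x - K x = (N x)⁻¹ * (K x * (N x - 1) - (N x - 1) * K x) := by
      calc _ = (N x)⁻¹ * K x * N x - (N x)⁻¹ * N x * K x := by rw [e4, one_mul]
        _ = _ := by noncomm_ring
    rw [e5]; noncomm_ring
  have e6 := congrFun (congrFun e3 i) i
  rw [Matrix.sub_apply, Matrix.add_apply, Matrix.sub_apply (Matrix.diagonal φ * _),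
    Matrix.diagonal_mul, Matrix.mul_diagonal, mul_comm (φ i), sub_self, add_zero] at e6
  rw [e1, e6]

theorem pow_card_le_norm_prod {δ : ℝ} (hδ : 0 ≤ δ) (s : Multiset ℂ) (h : ∀ r ∈ s, δ ≤ ‖r‖) :
    δ ^ s.card ≤ ‖s.prod‖ := by
  induction s using Multiset.induction_on with
  | empty => simp
  | cons a s ih =>
    rw [Multiset.card_cons, Multiset.prod_cons, norm_mul, pow_succ']
    exact mul_le_mul (h a (Multiset.mem_cons_self a s))
      (ih fun r hr => h r (Multiset.mem_cons_of_mem hr)) (by positivity) (norm_nonneg _)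

/-- The determinant is the product of the at most `L` characteristic roots; if all had modulus at
least `δ ≤ 1`, the product would have modulus at least `δ ^ L`. -/
theorem exists_small_eigenvalue {δ : ℝ} (hδ : 0 < δ) (hδ1 : δ ≤ 1) {M : Matrix (Fin L) (Fin L) ℂ}
    (hM : ‖M.det‖ < δ ^ L) : ∃ r : ℂ, ‖r‖ < δ ∧ ∃ v, v ≠ 0 ∧ M *ᵥ v = r • v := by
  rw [Matrix.det_eq_prod_roots_charpoly] at hM
  have h1 : ∃ r ∈ M.charpoly.roots, ‖r‖ < δ := by
    by_contra! h
    have h2 := pow_card_le_norm_prod hδ.le _ h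
    have h3 : M.charpoly.roots.card ≤ L := by
      refine (Polynomial.card_roots' _).trans ?_
      rw [Matrix.charpoly_natDegree_eq_dim, Fintype.card_fin]
    exact absurd hM (not_lt.2 ((pow_le_pow_of_le_one hδ.le hδ1 h3).trans h2))
  obtain ⟨r, hr, hrδ⟩ := h1
  refine ⟨r, hrδ, ?_⟩
  have h4 : (Matrix.scalar (Fin L) r - M).det = 0 := by
    rw [← Matrix.eval_charpoly]
    exact (Polynomial.mem_roots'.1 hr).2
  obtain ⟨v, hv, hv0⟩ := Matrix.exists_mulVec_eq_zero_iff.2 h4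
  refine ⟨v, hv, ?_⟩
  rw [Matrix.sub_mulVec, sub_eq_zero] at hv0
  rw [← hv0]
  ext i
  simp [Matrix.scalar_apply, Matrix.mulVec_diagonal]

/-- A matrix close to a diagonal matrix with distinct entries is diagonalizable, and each of its
eigenvalues is close to one of these entries. -/
theorem eventually_exists_diagonalization {X : Type*} {l : Filter X}
    {H : X → Matrix (Fin L) (Fin L) ℂ} {Λ : Fin L → ℂ} (hΛ : Function.Injective Λ)
    (hH : Tendsto H l (𝓝 (Matrix.diagonal Λ))) :
    ∀ᶠ x in l, ∃ (F : Matrix (Fin L) (Fin L) ℂ) (ev : Fin L → ℂ), IsUnit F.det ∧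
      H x * F = F * Matrix.diagonal ev ∧ ∀ l k, ‖ev l - Λ l‖ ≤ ‖ev l - Λ k‖ := by
  obtain ⟨d, hd, hd1, hsep⟩ := exists_separation hΛ
  have hdet : ∀ᶠ x in l, ∀ i, ‖(Matrix.scalar (Fin L) (Λ i) - H x).det‖ < (d / 2) ^ L := by
    rw [eventually_all]
    intro i
    have h1 : (Matrix.scalar (Fin L) (Λ i) - Matrix.diagonal Λ).det = 0 := by
      rw [Matrix.scalar_apply, Matrix.diagonal_sub, Matrix.det_diagonal]
      exact Finset.prod_eq_zero (Finset.mem_univ i) (sub_self _)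
    have h2 := hH.const_sub (Matrix.scalar (Fin L) (Λ i))
    have h3 := (((Continuous.matrix_det continuous_id).tendsto _).comp h2).norm
    simp only [Function.comp_def, id_eq, h1, norm_zero] at h3
    exact h3.eventually_lt_const (by positivity)
  filter_upwards [hdet] with x hx
  choose r hr v hv hrv using fun i =>
    exists_small_eigenvalue (half_pos hd) (by linarith) (hx i)
  -- `r i` is a small eigenvalue of `Λ i - H`, so `Λ i - r i` is an eigenvalue of `H`. These are
  -- distinct because they lie within `d / 2` of points that are `d` apart, and so their
  -- eigenvectors form a basis.
  let ev : Fin L → ℂ := fun i => Λ i - r i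
  have hclose : ∀ i, ‖ev i - Λ i‖ < d / 2 := fun i => by
    simpa [ev] using hr i
  have hHv : ∀ i, H x *ᵥ v i = ev i • v i := by
    intro i
    have h1 := hrv i
    rw [Matrix.sub_mulVec, sub_eq_iff_eq_add] at h1
    have h2 : Matrix.scalar (Fin L) (Λ i) *ᵥ v i = Λ i • v i := by
      ext j; simp [Matrix.scalar_apply, Matrix.mulVec_diagonal]
    rw [h2] at h1
    simp only [ev, sub_smul, h1]
    abel
  have hfar : ∀ i k, k ≠ i → d / 2 < ‖ev i - Λ k‖ := by
    intro i k hk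
    have h1 := hsep i k hk.symm
    have h2 := norm_sub_le (ev i - Λ k) (ev i - Λ i)
    have h3 : ev i - Λ k - (ev i - Λ i) = Λ i - Λ k := by ring
    rw [h3] at h2
    linarith [hclose i]
  have hinj : Function.Injective ev := by
    intro i j hij
    by_contra hne
    have h1 := hfar i j (Ne.symm hne)
    rw [hij] at h1
    linarith [hclose j]
  have hli : LinearIndependent ℂ v := by
    refine Module.End.eigenvectors_linearIndependent' (Matrix.toLin' (H x)) ev hinj v fun i => ?_
    rw [Module.End.hasEigenvector_iff, Module.End.mem_eigenspace_iff]
    exact ⟨by rw [Matrix.toLin'_apply, hHv], hv i⟩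
  refine ⟨(Matrix.of v)ᵀ, ev, ?_, ?_, ?_⟩
  · rw [Matrix.det_transpose, ← Matrix.isUnit_iff_isUnit_det]
    exact Matrix.linearIndependent_rows_iff_isUnit.1 hli
  · ext a b
    have h1 := congrFun (hHv b) a
    rw [Matrix.mul_diagonal]
    simp only [Matrix.mul_apply, Matrix.transpose_apply, Matrix.of_apply]
    rw [mul_comm]
    simpa [Matrix.mulVec, dotProduct] using h1
  · intro i k
    by_cases hk : k = i
    · rw [hk]
    · exact ((hclose i).trans (hfar i k hk)).le

end Eigen

/-! ### Perturbation of the shift-invariance equation -/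

section ShiftInvariance

open Asymptotics

/-- The normalization `PL A Y = 1` gives `A Y = P + ΔZ` with `ΔZ = (1 - P PL)(A - P W) Y`. Since `J₂
P = J₁ P diag(φ)`, the deviation of the solution from `diag(φ)` is exactly `(J₁ A Y)† (J₂ ΔZ - J₁ ΔZ
diag(φ))`. Replacing the pseudoinverse and `Y` by their limits costs only `o(g)`. -/
theorem shift_solution_perturbation {X : Type*} {l : Filter X} {g : X → ℝ}
    (hg : Tendsto g l (𝓝 0)) {m n r : Type*} [Fintype m] [Fintype n] [Fintype r] [DecidableEq m]
    {L : ℕ}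
    {P : Matrix m (Fin L) ℂ} {W : Matrix (Fin L) n ℂ} {PL : Matrix (Fin L) m ℂ}
    {WR : Matrix n (Fin L) ℂ} {A : X → Matrix m n ℂ} {Y : X → Matrix n (Fin L) ℂ}
    {J₁ J₂ : Matrix r m ℂ} {φ : Fin L → ℂ} (hJ : J₂ * P = J₁ * P * Matrix.diagonal φ)
    (hr : (J₁ * P).rank = L) (hPL : PL * P = 1) (hA : (fun x => A x - P * W) =O[l] g)
    (hY : Tendsto Y l (𝓝 WR)) (hZ : ∀ᶠ x in l, PL * (A x * Y x) = 1) :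
    (∀ᶠ x in l, IsUnit ((J₁ * (A x * Y x))ᴴ * (J₁ * (A x * Y x))).det) ∧
    (fun x => pinv (J₁ * (A x * Y x)) * (J₂ * (A x * Y x)) - Matrix.diagonal φ) =O[l] g ∧
    ∀ i, (fun x => (pinv (J₁ * (A x * Y x)) * (J₂ * (A x * Y x))) i i - φ i
      - (pinv (J₁ * P) * (J₂ - φ i • J₁) * (A x - P * W) * WR) i i) =o[l] g := by
  have hgo : g =o[l] fun _ => (1 : ℝ) := (isLittleO_one_iff ℝ).2 hg
  have hYb : Y =O[l] fun _ => (1 : ℝ) := hY.isBigO_one ℝ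
  set EY : X → Matrix m (Fin L) ℂ := fun x => (A x - P * W) * Y x with hEY
  have hEYg : EY =O[l] g := by simpa using isBigO_matrix_mul hA hYb
  set ΔZ : X → Matrix m (Fin L) ℂ := fun x => EY x - P * (PL * EY x) with hΔZ
  have hΔg : ΔZ =O[l] g := by
    have h1 := isBigO_matrix_mul (isBigO_const_const P (one_ne_zero (α := ℝ)) l)
      (isBigO_matrix_mul (isBigO_const_const PL (one_ne_zero (α := ℝ)) l) hEYg)
    simp only [one_mul] at h1
    exact hEYg.sub h1
  have hZeq : ∀ᶠ x in l, A x * Y x = P + ΔZ x := by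
    filter_upwards [hZ] with x hx
    have h1 : P * (PL * EY x) = P - P * (W * Y x) := by
      simp only [hEY]
      rw [Matrix.sub_mul, Matrix.mul_sub, hx, Matrix.mul_assoc P W, ← Matrix.mul_assoc PL P, hPL,
        Matrix.one_mul, Matrix.mul_sub, Matrix.mul_one]
    simp only [hΔZ]
    rw [h1]
    simp only [hEY, Matrix.sub_mul, Matrix.mul_assoc]
    abel
  have hΔ0 : Tendsto ΔZ l (𝓝 0) := hΔg.trans_tendsto hg
  have hJZ : Tendsto (fun x => J₁ * (A x * Y x)) l (𝓝 (J₁ * P)) := by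
    have h1 : Tendsto (fun x => P + ΔZ x) l (𝓝 P) := by
      have := hΔ0.const_add P
      rwa [add_zero] at this
    refine tendsto_matrix_mul (tendsto_const_nhds (x := J₁)) (h1.congr' ?_)
    filter_upwards [hZeq] with x hx using hx.symm
  have hu : IsUnit ((J₁ * P)ᴴ * (J₁ * P)).det :=
    isUnit_det_conjTranspose_mul_self (by rw [hr, Fintype.card_fin])
  have hgram := tendsto_matrix_mul (tendsto_matrix_conjTranspose hJZ) hJZ
  have hunit := eventually_isUnit_det hgram hu
  have hpinv : Tendsto (fun x => pinv (J₁ * (A x * Y x))) l (𝓝 (pinv (J₁ * P))) := by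
    rw [pinv_eq_of_isUnit hu]
    refine (tendsto_matrix_mul (tendsto_matrix_inv hgram hu)
      (tendsto_matrix_conjTranspose hJZ)).congr' ?_
    filter_upwards [hunit] with x hx
    rw [pinv_eq_of_isUnit hx]
  set T : X → Matrix r (Fin L) ℂ := fun x => J₂ * ΔZ x - J₁ * ΔZ x * Matrix.diagonal φ with hT
  have hTg : T =O[l] g := by
    have h1 := isBigO_matrix_mul (isBigO_const_const J₂ (one_ne_zero (α := ℝ)) l) hΔg
    have h2 := isBigO_matrix_mul (isBigO_matrix_mul
      (isBigO_const_const J₁ (one_ne_zero (α := ℝ)) l) hΔg)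
      (isBigO_const_const (Matrix.diagonal φ) (one_ne_zero (α := ℝ)) l)
    simp only [one_mul, mul_one] at h1 h2
    exact h1.sub h2
  have hH : ∀ᶠ x in l, pinv (J₁ * (A x * Y x)) * (J₂ * (A x * Y x)) - Matrix.diagonal φ =
      pinv (J₁ * (A x * Y x)) * T x := by
    filter_upwards [hunit, hZeq] with x hx hz
    have h1 : pinv (J₁ * (A x * Y x)) * (J₁ * (A x * Y x)) = 1 := by
      rw [pinv_eq_of_isUnit hx, Matrix.mul_assoc, Matrix.nonsing_inv_mul _ hx]
    have h2 : T x = J₂ * (A x * Y x) - J₁ * (A x * Y x) * Matrix.diagonal φ := by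
      rw [hz]
      simp only [hT, Matrix.mul_add, Matrix.add_mul, hJ]
      abel
    rw [h2, Matrix.mul_sub, ← Matrix.mul_assoc _ (J₁ * _), h1, Matrix.one_mul]
  refine ⟨hunit, ?_, fun i => ?_⟩
  · have h1 := isBigO_matrix_mul (hpinv.isBigO_one ℝ) hTg
    simp only [one_mul] at h1
    exact h1.congr' (hH.mono fun x hx => hx.symm) EventuallyEq.rfl
  · have hd : Tendsto (fun x => pinv (J₁ * (A x * Y x)) - pinv (J₁ * P)) l (𝓝 0) := by
      have := hpinv.sub_const (pinv (J₁ * P))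
      rwa [sub_self] at this
    have o1 := isLittleO_matrix_mul_right ((isLittleO_one_iff ℝ).2 hd) hTg
    have hYd : Tendsto (fun x => Y x - WR) l (𝓝 0) := by
      have := hY.sub_const WR
      rwa [sub_self] at this
    have o2 := isLittleO_matrix_mul_left (isBigO_matrix_mul
      (isBigO_const_const (pinv (J₁ * P) * (J₂ - φ i • J₁)) (one_ne_zero (α := ℝ)) l) hA)
      ((isLittleO_one_iff ℝ).2 hYd)
    simp only [one_mul, mul_one] at o1 o2
    refine ((isLittleO_entry o1 i i).add (isLittleO_entry o2 i i)).congr' ?_ EventuallyEq.rfl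
    filter_upwards [hH] with x hx
    have hx' := congrFun (congrFun hx i) i
    rw [Matrix.sub_apply, Matrix.diagonal_apply_eq] at hx'
    rw [hx']
    -- The component `P PL EY` of `ΔZ` contributes the commutator of `diag(φ)` and `PL EY`, which
    -- vanishes on the diagonal. What remains does not involve `PL`.
    have h2 : (pinv (J₁ * P) * T x) i i = (pinv (J₁ * P) * (J₂ - φ i • J₁) * EY x) i i := by
      have hpp : pinv (J₁ * P) * (J₁ * P) = 1 := pinv_mul_self (by rw [hr, Fintype.card_fin])
      have h3 : pinv (J₁ * P) * T x = pinv (J₁ * P) * (J₂ * EY x)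
          - pinv (J₁ * P) * (J₁ * EY x) * Matrix.diagonal φ
          - (Matrix.diagonal φ * (PL * EY x) - PL * EY x * Matrix.diagonal φ) := by
        simp only [hT, hΔZ, Matrix.mul_sub, Matrix.sub_mul]
        rw [← Matrix.mul_assoc J₂ P, hJ, ← Matrix.mul_assoc J₁ P]
        simp only [Matrix.mul_assoc]
        rw [← Matrix.mul_assoc J₁ P, ← Matrix.mul_assoc J₁ P, ← Matrix.mul_assoc (pinv _) (J₁ * P),
          ← Matrix.mul_assoc (pinv _) (J₁ * P), hpp, Matrix.one_mul, Matrix.one_mul]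
        abel
      rw [h3]
      simp only [Matrix.sub_apply, Matrix.diagonal_mul, Matrix.mul_diagonal, Matrix.mul_sub,
        Matrix.sub_mul, Matrix.mul_smul, Matrix.smul_mul, Matrix.smul_apply, smul_eq_mul]
      simp only [Matrix.mul_assoc]
      ring
    have h4 : EY x = (A x - P * W) * WR + (A x - P * W) * (Y x - WR) := by
      simp only [hEY, Matrix.mul_sub]; abel
    have h5 : (pinv (J₁ * (A x * Y x)) * T x) i i = (pinv (J₁ * P) * T x) i i +
        ((pinv (J₁ * (A x * Y x)) - pinv (J₁ * P)) * T x) i i := by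
      rw [Matrix.sub_mul, Matrix.sub_apply]; ring
    rw [h5, h2, h4, Matrix.mul_add, Matrix.add_apply, ← Matrix.mul_assoc _ (A x - P * W),
      ← Matrix.mul_assoc _ (A x - P * W)]
    ring

end ShiftInvariance

namespace Scenario

variable {L : ℕ} {M N : Fin 4 → ℕ} {K₅ L₅ : ℕ} (S : Scenario L M N K₅ L₅)

/-! ### Structure of the noise-free channel -/

theorem Φ_eq_pow (l : Fin L) (n : Mode) (i : ℕ) :
    Complex.exp (Complex.I * ((i : ℂ) * S.ω l n)) = S.Φ l n ^ i := by
  rw [Φ, ← Complex.exp_nat_mul]; congr 1; ring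

/-- Mixed-product rule: a Kronecker product acts on a Khatri-Rao product factor by factor. -/
theorem kron_mul_khatriRao {a b : ℕ} (X : (n : Fin 4) → Matrix (Fin (N n)) (Fin (N n)) ℂ)
    (Y : Matrix (Fin a) (Fin b) ℂ) (r : Beam N × Fin a) (l : Fin L) :
    (kron X Y * S.khatriRao b) r l =
      (∏ n, (X n * S.B n) (r.1 n) l) * (Y * S.A none b) r.2 l := by
  simp only [Matrix.mul_apply, kron, khatriRao, Matrix.of_apply, Fintype.sum_prod_type]
  rw [Finset.prod_univ_sum, Fintype.piFinset_univ, Finset.sum_mul]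
  refine Finset.sum_congr rfl fun p _ => ?_
  rw [Finset.mul_sum]
  refine Finset.sum_congr rfl fun k _ => ?_
  rw [Finset.prod_mul_distrib]
  ring

theorem kron_one_mul_P {a : ℕ} (Y : Matrix (Fin a) (Fin K₅) ℂ) (r : Beam N × Fin a) (l : Fin L) :
    (kron (N := N) (fun _ => 1) Y * S.P) r l = (∏ n, S.B n (r.1 n) l) * (Y * S.A none K₅) r.2 l := by
  rw [Scenario.P, kron_mul_khatriRao]
  simp only [Matrix.one_mul]

theorem kron_update_mul_P (n : Fin 4) (X : Matrix (Fin (N n)) (Fin (N n)) ℂ)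
    (r : Beam N × Fin K₅) (l : Fin L) :
    (kron (Function.update (fun _ => 1) n X) (1 : Matrix (Fin K₅) (Fin K₅) ℂ) * S.P) r l =
      (X * S.B n) (r.1 n) l * (∏ k ∈ Finset.univ \ {n}, S.B k (r.1 k) l) * S.A none K₅ r.2 l := by
  rw [P, kron_mul_khatriRao, Matrix.one_mul]
  congr 1
  have h1 : (fun k => (Function.update (fun k => (1 : Matrix (Fin (N k)) (Fin (N k)) ℂ)) n X k *
      S.B k) (r.1 k) l) = Function.update (fun k => S.B k (r.1 k) l) n ((X * S.B n) (r.1 n) l) := by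
    ext k
    by_cases hk : k = n
    · subst hk; simp
    · simp [hk]
  have h2 := congrArg (fun f => ∏ k, f k) h1
  simp only at h2
  rw [h2, Finset.prod_update_of_mem (Finset.mem_univ n)]

variable {S}

/-- In each spatial mode, `Q_n` restores the shift invariance in beamspace. -/
theorem Admissible.Q_mul_F_mul_B (hS : S.Admissible) (n : Fin 4) :
    S.Q n * (S.F n)ᴴ * S.B n = S.Q n * S.B n * Matrix.diagonal fun l => S.Φ l (some n) := by
  -- Row `i` of the shift relation says that row `i` of `T` is row `i + 1` times `F`; its conjugate
  -- transpose is `Fᴴ t_{i+1} = t_i`.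
  have hcol : ∀ (i : ℕ) (hi : i + 1 < M n),
      (S.F n)ᴴ *ᵥ (fun j => (S.T n)ᴴ j ⟨i + 1, hi⟩) = fun j => (S.T n)ᴴ j ⟨i, by omega⟩ := by
    intro i hi
    have h1 := (hS.shift n).2
    have h2 : ∀ (j : Fin (N n)), (selFirst (M n) * S.T n) ⟨i, by omega⟩ j = S.T n ⟨i, by omega⟩ j := by
      intro j
      rw [Matrix.mul_apply, Finset.sum_eq_single ⟨i, by omega⟩]
      · simp [selFirst]
      · intro b _ hb
        have : b.val ≠ i := fun h => hb (Fin.ext h)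
        simp [selFirst, this]
      · simp
    have h3 : ∀ (j : Fin (N n)), (selLast (M n) * S.T n) ⟨i, by omega⟩ j = S.T n ⟨i + 1, hi⟩ j := by
      intro j
      rw [Matrix.mul_apply, Finset.sum_eq_single ⟨i + 1, hi⟩]
      · simp [selLast]
      · intro b _ hb
        have : b.val ≠ i + 1 := fun h => hb (Fin.ext h)
        simp [selLast, this]
      · simp
    ext j
    have h4 := congrFun (congrFun h1 ⟨i, by omega⟩) j
    rw [h2, Matrix.mul_apply] at h4
    simp only [h3] at h4
    simp only [Matrix.mulVec, dotProduct, Matrix.conjTranspose_apply]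
    rw [h4, star_sum]
    refine Finset.sum_congr rfl fun k _ => ?_
    rw [star_mul']
    ring
  have hB : ∀ (X : Matrix (Fin (N n)) (Fin (N n)) ℂ) (a : Fin (N n)) (l : Fin L),
      (X * S.B n) a l = ∑ i : Fin (M n), (X *ᵥ fun j => (S.T n)ᴴ j i) a * S.Φ l (some n) ^ i.val := by
    intro X a l
    rw [B, ← Matrix.mul_assoc, Matrix.mul_apply]
    refine Finset.sum_congr rfl fun i _ => ?_
    simp only [A, Matrix.of_apply, Φ_eq_pow]
    rfl
  ext a l
  rw [Matrix.mul_diagonal, hB, hB, Finset.sum_mul]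
  -- Without antennas both sums are empty. Otherwise the first term on the left is killed by
  -- `Q_first`, the last on the right by `Q_last`, and the others match after a shift of the index.
  obtain hM | ⟨k, hM⟩ : M n = 0 ∨ ∃ k, M n = k + 1 := by
    cases M n
    · exact Or.inl rfl
    · exact Or.inr ⟨_, rfl⟩
  · have : IsEmpty (Fin (M n)) := by rw [hM]; infer_instance
    simp
  · let e : Fin (k + 1) ≃ Fin (M n) := finCongr hM.symm
    rw [← e.sum_comp, ← e.sum_comp, Fin.sum_univ_succ, Fin.sum_univ_castSucc]
    have h0 := congrFun (hS.Q_first n (e 0) (by simp [e])) a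
    have h1 := congrFun (hS.Q_last n (e (Fin.last k)) (by simp [e, hM])) a
    rw [Matrix.mulVec_mulVec] at h0
    rw [h0, h1]
    simp only [Pi.zero_apply, zero_mul, zero_add, add_zero]
    refine Finset.sum_congr rfl fun i _ => ?_
    have h2 : e i.succ = ⟨i.val + 1, by rw [hM]; omega⟩ := Fin.ext (by simp [e])
    have h3 : e i.castSucc = ⟨i.val, by rw [hM]; omega⟩ := Fin.ext (by simp [e])
    rw [h2, h3, ← Matrix.mulVec_mulVec, hcol, pow_succ]
    ring

theorem selLast_mul_A (K : ℕ) :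
    selLast K * S.A none K = selFirst K * S.A none K * Matrix.diagonal fun l => S.Φ l none := by
  ext i l
  have hi := i.isLt
  rw [Matrix.mul_diagonal, Matrix.mul_apply, Matrix.mul_apply,
    Finset.sum_eq_single ⟨i.val + 1, by omega⟩, Finset.sum_eq_single ⟨i.val, by omega⟩]
  · simp only [selLast, selFirst, A, Matrix.of_apply, if_true, one_mul, Φ_eq_pow, pow_succ]
  · intro b _ hb
    have : b.val ≠ i.val := fun h => hb (Fin.ext h)
    simp [selFirst, this]
  · simp
  · intro b _ hb
    have : b.val ≠ i.val + 1 := fun h => hb (Fin.ext h)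
    simp [selLast, this]
  · simp

theorem Admissible.shift_invariance (hS : S.Admissible) (n : Mode) :
    S.J₂ n * S.P = S.J₁ n * S.P * Matrix.diagonal fun l => S.Φ l n := by
  ext r l
  rw [Matrix.mul_diagonal]
  rcases n with _ | n
  · refine (S.kron_one_mul_P (selLast K₅) r l).trans ?_
    rw [selLast_mul_A, Matrix.mul_diagonal]
    refine Eq.trans ?_ (congrArg (· * S.Φ l none) (S.kron_one_mul_P (selFirst K₅) r l).symm)
    ring
  · have h1 := congrFun (congrFun (hS.Q_mul_F_mul_B n) (r.1 n)) l
    rw [Matrix.mul_diagonal] at h1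
    refine (S.kron_update_mul_P n _ r l).trans ?_
    rw [h1]
    refine Eq.trans ?_ (congrArg (· * S.Φ l (some n)) (S.kron_update_mul_P n (S.Q n) r l).symm)
    ring

/-- `diag(γ) Gᵀ`: the noise-free smoothed channel matrix is `P` times this matrix. -/
def rightFactor (S : Scenario L M N K₅ L₅) : Matrix (Fin L) (Fin L₅) ℂ :=
  Matrix.diagonal S.γ * S.Gᵀ

/-- The pseudoinverse of `rightFactor`. -/
def rightFactorInv (S : Scenario L M N K₅ L₅) : Matrix (Fin L₅) (Fin L) ℂ :=
  pinv S.Gᵀ * Matrix.diagonal fun l => (S.γ l)⁻¹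

/-- Splitting `Φ^(k+s) = Φ^k Φ^s` separates the position in the window from the window. -/
theorem smooth_h : smooth S.h = S.P * S.rightFactor := by
  ext r s
  rw [rightFactor, ← Matrix.mul_assoc, Matrix.mul_apply]
  simp only [smooth, h, Matrix.of_apply, Matrix.mulVec, dotProduct, Matrix.mul_diagonal, khatriRao, P, G,
    Matrix.transpose_apply, A, Φ_eq_pow]
  refine Finset.sum_congr rfl fun l _ => ?_
  rw [pow_add]
  ring

theorem Admissible.transpose_mul_pinv (hS : S.Admissible) : S.Gᵀ * pinv S.Gᵀ = 1 ∧
    (pinv S.Gᵀ * S.Gᵀ)ᴴ = pinv S.Gᵀ * S.Gᵀ := by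
  have h1 : IsUnit (S.Gᵀ * S.Gᵀᴴ).det := by
    have h2 : (S.Gᵀᴴ).rank = Fintype.card (Fin L) := by
      open scoped ComplexOrder in
      rw [Matrix.rank_conjTranspose, Matrix.rank_transpose, hS.rank_G, Fintype.card_fin]
    have h3 := isUnit_det_conjTranspose_mul_self h2
    rwa [Matrix.conjTranspose_conjTranspose] at h3
  rw [pinv_eq_of_isUnit_mul_conjTranspose h1]
  refine ⟨?_, ?_⟩
  · rw [← Matrix.mul_assoc, Matrix.mul_nonsing_inv _ h1]
  · simp [Matrix.conjTranspose_mul, Matrix.conjTranspose_nonsing_inv, Matrix.mul_assoc]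

theorem Admissible.rightFactor_mul_inv (hS : S.Admissible) :
    S.rightFactor * S.rightFactorInv = 1 := by
  rw [rightFactor, rightFactorInv, Matrix.mul_assoc, ← Matrix.mul_assoc S.Gᵀ,
    hS.transpose_mul_pinv.1, Matrix.one_mul, Matrix.diagonal_mul_diagonal, ← Matrix.diagonal_one]
  congr 1; ext l; exact mul_inv_cancel₀ (hS.γ_ne l)

theorem Admissible.rightFactorInv_mul (hS : S.Admissible) :
    (S.rightFactorInv * S.rightFactor)ᴴ = S.rightFactorInv * S.rightFactor := by
  have h1 : S.rightFactorInv * S.rightFactor = pinv S.Gᵀ * S.Gᵀ := by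
    rw [rightFactor, rightFactorInv, Matrix.mul_assoc, ← Matrix.mul_assoc (Matrix.diagonal _),
      Matrix.diagonal_mul_diagonal]
    have : (Matrix.diagonal fun l => (S.γ l)⁻¹ * S.γ l) = 1 := by
      rw [← Matrix.diagonal_one]; congr 1; ext l; exact inv_mul_cancel₀ (hS.γ_ne l)
    rw [this, Matrix.one_mul]
  rw [h1, hS.transpose_mul_pinv.2]

theorem Admissible.exists_left_inverse_P (hS : S.Admissible) :
    ∃ PL : Matrix (Fin L) (Beam N × Fin K₅) ℂ, PL * S.P = 1 :=
  ⟨pinv (S.J₁ none * S.P) * S.J₁ none, by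
    rw [Matrix.mul_assoc, pinv_mul_self (by rw [hS.rank_P, Fintype.card_fin])]⟩

open Asymptotics in
theorem smooth_sub_isBigO :
    (fun x : Idx N K₅ L₅ → ℂ => smooth x - S.P * S.rightFactor) =O[𝓝 S.h] fun x => ‖x - S.h‖ := by
  refine isBigO_of_entries fun r s => IsBigO.of_bound 1 (Eventually.of_forall fun x => ?_)
  rw [← smooth_h, one_mul, norm_norm]
  exact norm_le_pi_norm (x - S.h) _

theorem tendsto_norm_sub (h : Idx N K₅ L₅ → ℂ) : Tendsto (fun x => ‖x - h‖) (𝓝 h) (𝓝 0) :=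
  tendsto_iff_norm_sub_tendsto_zero.1 tendsto_id

theorem tendsto_smooth :
    Tendsto (fun x : Idx N K₅ L₅ → ℂ => smooth x) (𝓝 S.h) (𝓝 (S.P * S.rightFactor)) := by
  have h1 := (smooth_sub_isBigO (S := S)).trans_tendsto (tendsto_norm_sub S.h)
  have h2 := h1.add_const (S.P * S.rightFactor)
  rw [zero_add] at h2
  exact h2.congr fun x => sub_add_cancel _ _

theorem mul_mul_apply {a b c d : Type*} [Fintype b] [Fintype c] (X : Matrix a b ℂ)
    (D : Matrix b c ℂ) (Y : Matrix c d ℂ) (i : a) (j : d) :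
    (X * D * Y) i j = ∑ p, ∑ s, X i p * D p s * Y s j := by
  simp only [Matrix.mul_apply, Finset.sum_mul]
  exact Finset.sum_comm

/-- First-order perturbation of `Φ_{l,n}` caused by the perturbation `ε` of the channel. -/
def phaseJac (S : Scenario L M N K₅ L₅) (l : Fin L) (n : Mode) : (Idx N K₅ L₅ → ℂ) →L[ℂ] ℂ :=
  (S.γ l)⁻¹ • ∑ i, star (S.ξ l n i) • ContinuousLinearMap.proj i

theorem phaseJac_apply (l : Fin L) (n : Mode) (ε : Idx N K₅ L₅ → ℂ) :
    S.phaseJac l n ε = (S.γ l)⁻¹ * ∑ i, star (S.ξ l n i) * ε i := by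
  simp [phaseJac]

/-- The error entry at window position `k` of window `s` depends only on `k + s`. Collecting the
coefficients of each subcarrier produces the convolution `ξ`. -/
theorem phaseJac_sub (l : Fin L) (n : Mode) (x : Idx N K₅ L₅ → ℂ) :
    (pinv (S.J₁ n * S.P) * (S.J₂ n - S.Φ l n • S.J₁ n) * (smooth x - S.P * S.rightFactor)
      * S.rightFactorInv) l l = S.phaseJac l n (x - S.h) := by
  rw [← smooth_h, rightFactorInv, ← Matrix.mul_assoc, Matrix.mul_diagonal, mul_comm,
    phaseJac_apply]
  congr 1
  have h1 : ∀ i, star (S.ξ l n i) = ∑ k : Fin K₅, ∑ s : Fin L₅, if k.val + s.val = i.2.val then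
      (pinv (S.J₁ n * S.P) * (S.J₂ n - S.Φ l n • S.J₁ n)) l (i.1, k) * pinv S.Gᵀ s l else 0 := by
    intro i
    simp only [ξ, star_sum, apply_ite star, star_zero, star_mul', lam, χ, star_star]
  simp only [h1, Finset.sum_mul]
  rw [mul_mul_apply, Fintype.sum_prod_type, Fintype.sum_prod_type]
  refine Finset.sum_congr rfl fun b _ => ?_
  refine Eq.trans ?_ Finset.sum_comm
  refine Finset.sum_congr rfl fun k _ => ?_
  refine Eq.trans ?_ Finset.sum_comm
  refine Finset.sum_congr rfl fun s _ => ?_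
  rw [Finset.sum_eq_single ⟨k.val + s.val, by omega⟩]
  · simp only [if_true, smooth, Matrix.sub_apply, Matrix.of_apply, Pi.sub_apply]
    exact mul_right_comm _ _ _
  · intro j _ hj
    rw [if_neg fun h => hj (Fin.ext h.symm), zero_mul]
  · simp

end Scenario

namespace Scenario

variable {L : ℕ} {M N : Fin 4 → ℕ} {K₅ L₅ : ℕ} {S : Scenario L M N K₅ L₅}

/-! ### First-order perturbation of the frequency estimates -/

open Asymptotics in
/-- In a suitable basis of the signal subspace, the solutions of the shift-invariance equations are
perturbations of diagonal matrices. -/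
theorem Admissible.exists_common_basis (hS : S.Admissible)
    {U : (Idx N K₅ L₅ → ℂ) → Matrix (Beam N × Fin K₅) (Fin L) ℂ}
    (hU : ∀ᶠ x in 𝓝 S.h, IsLeadingLeftSingular (smooth x) (U x)) :
    ∃ (R : (Idx N K₅ L₅ → ℂ) → Matrix (Fin L) (Fin L) ℂ)
      (H : (Idx N K₅ L₅ → ℂ) → Mode → Matrix (Fin L) (Fin L) ℂ),
      (∀ᶠ x in 𝓝 S.h, IsUnit (R x).det ∧ ∀ n, S.Γ (U x) n = (R x)⁻¹ * H x n * R x) ∧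
      (∀ n, (fun x => H x n - Matrix.diagonal fun l => S.Φ l n) =O[𝓝 S.h] fun x => ‖x - S.h‖) ∧
      ∀ n l, (fun x => H x n l l - S.Φ l n - S.phaseJac l n (x - S.h)) =o[𝓝 S.h]
        fun x => ‖x - S.h‖ := by
  obtain ⟨PL, hPL⟩ := hS.exists_left_inverse_P
  obtain ⟨Y, hY, hYU⟩ := exists_tendsto_signal_subspace hU tendsto_smooth hPL
    hS.rightFactor_mul_inv hS.rightFactorInv_mul
  have hZ : ∀ᶠ x in 𝓝 S.h, PL * (smooth x * Y x) = 1 := by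
    filter_upwards [hYU] with x ⟨h1, h2⟩
    have h3 : PL * (smooth x * Y x) * (PL * U x) = PL * U x := by
      rw [Matrix.mul_assoc, h2]
    calc _ = PL * (smooth x * Y x) * (PL * U x) * (PL * U x)⁻¹ := by
          rw [Matrix.mul_assoc _ (PL * U x), Matrix.mul_nonsing_inv _ h1, Matrix.mul_one]
      _ = 1 := by rw [h3, Matrix.mul_nonsing_inv _ h1]
  have key := fun n => shift_solution_perturbation (tendsto_norm_sub S.h) (hS.shift_invariance n)
    (hS.rank_P n) hPL smooth_sub_isBigO hY hZ
  refine ⟨fun x => PL * U x, fun x n => pinv (S.J₁ n * (smooth x * Y x)) *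
    (S.J₂ n * (smooth x * Y x)), ?_, fun n => (key n).2.1, fun n l => ?_⟩
  · filter_upwards [hYU, eventually_all.2 fun n => (key n).1] with x ⟨h1, h2⟩ h3
    refine ⟨h1, fun n => ?_⟩
    -- `U` is the basis `A Y` times `R` for both selection matrices and all modes, so the change of
    -- basis becomes a common conjugation.
    have h4 : ∀ J : Matrix (Beam N × Fin (selRows K₅ n)) (Beam N × Fin K₅) ℂ,
        J * U x = J * (smooth x * Y x) * (PL * U x) := fun J => by
      rw [Matrix.mul_assoc, h2]
    rw [Γ, h4, h4, pinv_mul_of_isUnit (h3 n) h1]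
    simp only [Matrix.mul_assoc]
  · have h1 := (key n).2.2 l
    simpa only [phaseJac_sub] using h1

open Asymptotics in
theorem sum_smul_sub_diagonal_isBigO
    {H : (Idx N K₅ L₅ → ℂ) → Mode → Matrix (Fin L) (Fin L) ℂ}
    (hH : ∀ n, (fun x => H x n - Matrix.diagonal fun l => S.Φ l n) =O[𝓝 S.h] fun x => ‖x - S.h‖) :
    (fun x => ∑ n, S.β n • H x n - Matrix.diagonal S.Λ) =O[𝓝 S.h] fun x => ‖x - S.h‖ := by
  have h1 := IsBigO.sum (s := Finset.univ) fun n _ => (hH n).const_smul_left (S.β n)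
  refine h1.congr_left fun x => ?_
  have h2 : Matrix.diagonal S.Λ = ∑ n, S.β n • Matrix.diagonal fun l => S.Φ l n := by
    ext i j
    rw [Matrix.sum_apply]
    by_cases hij : i = j
    · subst hij; simp [Λ]
    · simp [hij]
  rw [h2, ← Finset.sum_sub_distrib, Finset.sum_apply]
  simp only [Pi.smul_apply, smul_sub]

theorem sum_smul_conj (R : Matrix (Fin L) (Fin L) ℂ) {G H : Mode → Matrix (Fin L) (Fin L) ℂ}
    (hG : ∀ n, G n = R⁻¹ * H n * R) (β : Mode → ℂ) :
    ∑ n, β n • G n = R⁻¹ * (∑ n, β n • H n) * R := by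
  simp only [hG, Matrix.mul_sum, Matrix.sum_mul, Matrix.mul_smul, Matrix.smul_mul]

/-- Nonzero `cos az` and elevations in `(0, π)` keep the spatial frequencies strictly inside `(-π,
π)`; the delay bound does so in the frequency mode. Thus the principal logarithm recovers each
frequency and is differentiable at `Φ`. -/
theorem Admissible.ω_mem (hS : S.Admissible) (l : Fin L) (n : Mode) :
    S.ω l n ∈ Set.Ioo (-Real.pi) Real.pi := by
  have hpi := Real.pi_pos
  have hcos : ∀ t ∈ Set.Ioo 0 Real.pi, |Real.cos t| < 1 := fun t ht => by
    have h1 := Real.sin_pos_of_mem_Ioo ht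
    have h2 := Real.sin_sq_add_cos_sq t
    rw [← sq_lt_one_iff_abs_lt_one]
    nlinarith
  have hsin : ∀ a t, Real.cos a ≠ 0 → |Real.sin a * Real.sin t| < 1 := fun a t ha => by
    have h1 : 0 < Real.cos a ^ 2 := by positivity
    have h2 := Real.sin_sq_add_cos_sq a
    rw [← sq_lt_one_iff_abs_lt_one, mul_pow]
    nlinarith [Real.sin_sq_le_one t, sq_nonneg (Real.sin a), sq_nonneg (Real.sin t)]
  have key : ∀ t, |t| < 1 → Real.pi * t ∈ Set.Ioo (-Real.pi) Real.pi := fun t ht => by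
    rw [abs_lt] at ht
    constructor <;> nlinarith
  rcases n with _ | n
  · have h1 := mul_pos hS.Δf_pos (hS.τ_pos l)
    have h2 := hS.τ_lt l
    simp only [ω, PathParams.freq]
    constructor <;> nlinarith
  · fin_cases n
    · simpa [ω, PathParams.freq, mul_assoc] using key _ (hsin _ (S.par l).ϕel (hS.ϕaz_ne l))
    · simpa [ω, PathParams.freq] using key _ (hcos _ (hS.ϕel_mem l))
    · simpa [ω, PathParams.freq, mul_assoc] using key _ (hsin _ (S.par l).θel (hS.θaz_ne l))
    · simpa [ω, PathParams.freq] using key _ (hcos _ (hS.θel_mem l))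

theorem Admissible.log_Φ (hS : S.Admissible) (l : Fin L) (n : Mode) :
    Complex.log (S.Φ l n) = Complex.I * S.ω l n := by
  have h1 := hS.ω_mem l n
  refine Complex.log_exp ?_ ?_ <;> simp [h1.1, h1.2.le]

theorem Admissible.Φ_mem_slitPlane (hS : S.Admissible) (l : Fin L) (n : Mode) :
    S.Φ l n ∈ Complex.slitPlane := by
  rw [Complex.mem_slitPlane_iff_arg, ← Complex.log_im, hS.log_Φ]
  exact ⟨by simpa using (hS.ω_mem l n).2.ne, Complex.exp_ne_zero _⟩

/-- First-order perturbation of `ω_{l,n}` caused by the perturbation `ε` of the channel. -/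
def freqJac (S : Scenario L M N K₅ L₅) (l : Fin L) (n : Mode) : (Idx N K₅ L₅ → ℂ) →L[ℝ] ℝ :=
  Complex.imCLM.comp (((S.Φ l n)⁻¹ • S.phaseJac l n).restrictScalars ℝ)

/-- As `|Φ| = 1`, dividing by `Φ` is multiplication by its conjugate, which gives the factor `Φ /
γ^*` in `υ`. -/
theorem freqJac_apply (l : Fin L) (n : Mode) (ε : Idx N K₅ L₅ → ℂ) :
    S.freqJac l n ε = (∑ i, star (S.υ l n i) * ε i).im := by
  have h1 : (S.Φ l n)⁻¹ = star (S.Φ l n) := by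
    rw [Φ, ← Complex.exp_neg, Complex.star_def, ← Complex.exp_conj]
    simp
  simp only [freqJac, ContinuousLinearMap.comp_apply, ContinuousLinearMap.coe_restrictScalars',
    _root_.smul_apply, Complex.imCLM_apply, phaseJac_apply, smul_eq_mul]
  congr 1
  rw [h1, Finset.mul_sum, Finset.mul_sum]
  refine Finset.sum_congr rfl fun i _ => ?_
  simp only [υ, Pi.smul_apply, smul_eq_mul, star_mul', star_div₀, star_star]
  ring

open Asymptotics in
/-- Any frequencies returned by ESPRIT are differentiable functions of the channel. -/
theorem Admissible.hasFDerivAt_frequencyEstimate (hS : S.Admissible)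
    {ω' : (Idx N K₅ L₅ → ℂ) → Fin L → Mode → ℝ}
    (hω : ∀ᶠ x in 𝓝 S.h, S.IsFrequencyEstimate x (ω' x)) (l : Fin L) (n : Mode) :
    ω' S.h l n = S.ω l n ∧ HasFDerivAt (fun x => ω' x l n) (S.freqJac l n) S.h := by
  -- A pointwise choice without any regularity; the values at points where no estimate exists are
  -- arbitrary.
  choose! U E ev hUEe using fun x (hx : S.IsFrequencyEstimate x (ω' x)) => hx
  replace hUEe := hω.mono hUEe
  obtain ⟨R, H, hR, hHO, hHo⟩ := hS.exists_common_basis (hUEe.mono fun x hx => hx.1)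
  -- In the basis `A Y` the eigenvector matrix is `R E`, and `E⁻¹ Γ E = (R E)⁻¹ H (R E)`.
  have hdiag := isLittleO_diag_conj_sub (tendsto_norm_sub S.h) (F := fun x => R x * E x)
    (ev := ev) hS.Λ_inj (sum_smul_sub_diagonal_isBigO hHO) (hHO n) (by
      filter_upwards [hUEe, hR] with x ⟨_, hE, hd, hlab, _⟩ ⟨hRu, hΓ⟩
      refine ⟨by rw [Matrix.det_mul]; exact hRu.mul hE, ?_, hlab⟩
      rw [sum_smul_conj _ hΓ] at hd
      rw [Matrix.mul_assoc, ← hd, ← Matrix.mul_assoc, ← Matrix.mul_assoc, ← Matrix.mul_assoc,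
        ← Matrix.mul_assoc, Matrix.mul_nonsing_inv _ hRu, Matrix.one_mul, Matrix.mul_assoc]) l
  have hsum := hdiag.add (hHo n l)
  set f : (Idx N K₅ L₅ → ℂ) → ℂ := fun x => ((E x)⁻¹ * S.Γ (U x) n * E x) l l with hf
  have hfo : (fun x => f x - S.Φ l n - S.phaseJac l n (x - S.h)) =o[𝓝 S.h] fun x => x - S.h := by
    rw [← isLittleO_norm_right]
    refine hsum.congr' ?_ EventuallyEq.rfl
    filter_upwards [hR] with x ⟨hRu, hΓ⟩
    simp only [hf, hΓ n, Matrix.mul_inv_rev, Matrix.mul_assoc]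
    ring
  have hfh : f S.h = S.Φ l n := by
    -- The little-o estimate also holds at `x = h` itself, where it forces `f h = Φ`.
    have h1 := (hfo.def one_pos).self_of_nhds
    rw [sub_self, map_zero, sub_zero, norm_zero, mul_zero, norm_le_zero_iff, sub_eq_zero] at h1
    exact h1
  have hfd : HasFDerivAt f (S.phaseJac l n) S.h := by
    rw [hasFDerivAt_iff_isLittleO, hfh]
    exact hfo
  have hlog := hfd.clog (by rw [hfh]; exact hS.Φ_mem_slitPlane l n)
  rw [hfh] at hlog
  have him := (Complex.imCLM.hasFDerivAt (x := Complex.log (f S.h))).comp S.h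
    (hlog.restrictScalars ℝ)
  refine ⟨?_, him.congr_of_eventuallyEq ?_⟩
  · rw [hUEe.self_of_nhds.2.2.2.2 l n]
    change (Complex.log (f S.h)).im = _
    rw [hfh, hS.log_Φ]
    simp
  · filter_upwards [hUEe] with x hx using hx.2.2.2.2 l n

/-- Near the noise-free channel, ESPRIT returns frequencies. -/
theorem Admissible.eventually_exists_frequencyEstimate (hS : S.Admissible) :
    ∀ᶠ x in 𝓝 S.h, ∃ ω', S.IsFrequencyEstimate x ω' := by
  have hrank : ∀ᶠ x : Idx N K₅ L₅ → ℂ in 𝓝 S.h, L ≤ (smooth x).rank := by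
    obtain ⟨PL, hPL⟩ := hS.exists_left_inverse_P
    have h1 := tendsto_matrix_mul (tendsto_matrix_mul (tendsto_const_nhds (x := PL))
      (tendsto_smooth (S := S))) (tendsto_const_nhds (x := S.rightFactorInv))
    rw [← Matrix.mul_assoc PL, hPL, Matrix.one_mul, hS.rightFactor_mul_inv] at h1
    -- `PL A WR` tends to the identity; once it is invertible, `A` has rank at least `L`.
    filter_upwards [eventually_isUnit_det h1 (by simp)] with x hx
    have h2 := Matrix.rank_of_isUnit _ ((Matrix.isUnit_iff_isUnit_det _).2 hx)
    rw [Fintype.card_fin] at h2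
    calc L = (PL * smooth x * S.rightFactorInv).rank := h2.symm
      _ ≤ (PL * smooth x).rank := Matrix.rank_mul_le_left _ _
      _ ≤ (smooth x).rank := Matrix.rank_mul_le_right _ _
  choose! U hU using fun (x : Idx N K₅ L₅ → ℂ) (hx : L ≤ (smooth x).rank) =>
    exists_isLeadingLeftSingular (smooth x) hx
  replace hU := hrank.mono hU
  obtain ⟨R, H, hR, hHO, -⟩ := hS.exists_common_basis hU
  have hHt : Tendsto (fun x => ∑ n, S.β n • H x n) (𝓝 S.h) (𝓝 (Matrix.diagonal S.Λ)) := by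
    have h1 := (sum_smul_sub_diagonal_isBigO hHO).trans_tendsto (tendsto_norm_sub S.h)
    have h2 := h1.add_const (Matrix.diagonal S.Λ)
    rw [zero_add] at h2
    exact h2.congr fun x => sub_add_cancel _ _
  filter_upwards [hU, hR, eventually_exists_diagonalization hS.Λ_inj hHt]
    with x hx ⟨hRu, hΓ⟩ ⟨F, ev, hF, hd, hlab⟩
  refine ⟨fun l n => (Complex.log ((((R x)⁻¹ * F)⁻¹ * S.Γ (U x) n * ((R x)⁻¹ * F)) l l)).im,
    U x, (R x)⁻¹ * F, ev, hx, ?_, ?_, hlab, fun _ _ => rfl⟩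
  · rw [Matrix.det_mul]
    exact (Matrix.isUnit_nonsing_inv_det _ hRu).mul hF
  · rw [sum_smul_conj _ hΓ, Matrix.mul_assoc _ F, ← hd, Matrix.mul_assoc, ← Matrix.mul_assoc (R x),
      Matrix.mul_nonsing_inv _ hRu, Matrix.one_mul, Matrix.mul_assoc]

end Scenario

/-! ### First-order perturbation of the path parameters -/

section Calculus

variable {E : Type*} [NormedAddCommGroup E] [NormedSpace ℝ E] {x₀ : E}

theorem elevationOf_pi_mul_cos {el : ℝ} (hel : el ∈ Set.Ioo 0 Real.pi) :
    elevationOf (Real.pi * Real.cos el) = el := by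
  rw [elevationOf, mul_div_cancel_left₀ _ Real.pi_ne_zero, Real.arccos_cos hel.1.le hel.2.le]

theorem hasFDerivAt_elevationOf {el : ℝ} (hel : el ∈ Set.Ioo 0 Real.pi) {ω₂ : E → ℝ}
    {w₂ : E →L[ℝ] ℝ} (h₂ : HasFDerivAt ω₂ w₂ x₀) (h₂0 : ω₂ x₀ = Real.pi * Real.cos el) :
    HasFDerivAt (fun x => elevationOf (ω₂ x)) ((-(1 / (Real.pi * Real.sin el))) • w₂) x₀ := by
  have hsin := Real.sin_pos_of_mem_Ioo hel
  have hsq := Real.sin_sq_add_cos_sq el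
  have h1 : Real.cos el ≠ -1 := fun h => by rw [h] at hsq; nlinarith
  have h2 : Real.cos el ≠ 1 := fun h => by rw [h] at hsq; nlinarith
  have h3 : ω₂ x₀ / Real.pi = Real.cos el := by
    rw [h₂0, mul_div_cancel_left₀ _ Real.pi_ne_zero]
  have h4 := Real.hasDerivAt_arccos h1 h2
  rw [← h3] at h4
  have h5 := h4.comp_hasFDerivAt x₀ (h₂.mul_const Real.pi⁻¹)
  refine h5.congr_fderiv ?_
  have h6 : √(1 - (ω₂ x₀ / Real.pi) ^ 2) = Real.sin el := by
    rw [h3, ← Real.sqrt_sq hsin.le]; congr 1; linarith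
  rw [h6, smul_smul]
  congr 1
  field_simp

/-- The derivative of `arcsin` at `sin az` is `1 / |cos az|`, and the branch for the back half space
restores the sign of `cos az`. The azimuth is recovered only modulo `2π`, which is why the values
are given as sine and cosine. -/
theorem hasFDerivAt_azimuthOf {front : Prop} [Decidable front] {az el : ℝ}
    (hel : el ∈ Set.Ioo 0 Real.pi) (haz : Real.cos az ≠ 0) (hfront : front ↔ 0 < Real.cos az)
    {ω₁ ω₂ : E → ℝ} {w₁ w₂ : E →L[ℝ] ℝ} (h₁ : HasFDerivAt ω₁ w₁ x₀) (h₂ : HasFDerivAt ω₂ w₂ x₀)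
    (h₁0 : ω₁ x₀ = Real.pi * Real.sin az * Real.sin el) (h₂0 : ω₂ x₀ = Real.pi * Real.cos el) :
    HasFDerivAt (fun x => azimuthOf front (ω₁ x) (elevationOf (ω₂ x)))
      ((1 / (Real.pi * Real.cos az * Real.sin el)) • w₁
        + (Real.sin az * Real.cos el / (Real.pi * Real.cos az * Real.sin el ^ 2)) • w₂) x₀ ∧
    Real.sin (azimuthOf front (ω₁ x₀) (elevationOf (ω₂ x₀))) = Real.sin az ∧
    Real.cos (azimuthOf front (ω₁ x₀) (elevationOf (ω₂ x₀))) = Real.cos az := by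
  have hsin := Real.sin_pos_of_mem_Ioo hel
  have hpi := Real.pi_pos
  have hel0 : elevationOf (ω₂ x₀) = el := by rw [h₂0, elevationOf_pi_mul_cos hel]
  have harg : ω₁ x₀ / (Real.pi * Real.sin (elevationOf (ω₂ x₀))) = Real.sin az := by
    rw [hel0, h₁0]; field_simp
  have hsq := Real.sin_sq_add_cos_sq az
  have hcos2 : 0 < Real.cos az ^ 2 := by positivity
  have hs1 : Real.sin az ≠ -1 := fun h => by rw [h] at hsq; nlinarith
  have hs2 : Real.sin az ≠ 1 := fun h => by rw [h] at hsq; nlinarith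
  have hroot : √(1 - Real.sin az ^ 2) = |Real.cos az| := by
    rw [← Real.sqrt_sq_eq_abs]; congr 1; linarith
  have hel' := hasFDerivAt_elevationOf hel h₂ h₂0
  have hden : HasFDerivAt (fun x => (Real.pi * Real.sin (elevationOf (ω₂ x)))⁻¹)
      ((Real.cos el / (Real.pi ^ 2 * Real.sin el ^ 3)) • w₂) x₀ := by
    have h1 : HasFDerivAt (fun x => Real.pi * Real.sin (elevationOf (ω₂ x)))
        (Real.pi • (Real.cos (elevationOf (ω₂ x₀)) • ((-(1 / (Real.pi * Real.sin el))) • w₂))) x₀ :=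
      (hel'.sin).const_mul Real.pi
    have h2 := (hasDerivAt_inv (x := Real.pi * Real.sin (elevationOf (ω₂ x₀)))
      (by rw [hel0]; positivity)).comp_hasFDerivAt x₀ h1
    refine h2.congr_fderiv ?_
    rw [hel0, smul_smul, smul_smul, smul_smul]
    congr 1
    field_simp
  have hs := h₁.mul hden
  have h4 := Real.hasDerivAt_arcsin hs1 hs2
  rw [← harg] at h4
  have h5 := h4.comp_hasFDerivAt x₀ (f := fun x => ω₁ x / (Real.pi * Real.sin (elevationOf (ω₂ x)))) hs
  rw [harg, hroot, hel0, h₁0] at h5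
  have hasin := Real.sin_arcsin (Real.neg_one_le_sin az) (Real.sin_le_one az)
  have hacos := Real.cos_arcsin (Real.sin az)
  rw [hroot] at hacos
  by_cases hf : front
  · have hc := hfront.1 hf
    rw [abs_of_pos hc] at h5 hacos
    simp only [azimuthOf, if_pos hf, harg]
    refine ⟨h5.congr_fderiv ?_, hasin, hacos⟩
    ext ε
    simp only [_root_.smul_apply, _root_.add_apply, smul_eq_mul]
    field_simp
    ring
  · have hc : Real.cos az < 0 := lt_of_le_of_ne (not_lt.1 fun h => hf (hfront.2 h)) haz
    rw [abs_of_neg hc] at h5 hacos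
    simp only [azimuthOf, if_neg hf, harg]
    refine ⟨(h5.const_sub Real.pi).congr_fderiv ?_, ?_, ?_⟩
    · ext ε
      simp only [_root_.smul_apply, _root_.add_apply, _root_.neg_apply, smul_eq_mul]
      field_simp
      ring
    · rw [Real.sin_pi_sub, hasin]
    · rw [Real.cos_pi_sub, hacos, neg_neg]

theorem hasFDerivAt_direction {az el : E → ℝ} {a e : E →L[ℝ] ℝ} (ha : HasFDerivAt az a x₀)
    (he : HasFDerivAt el e x₀) (i : Fin 3) :
    HasFDerivAt (fun x => direction (az x) (el x) i)
      (Scenario.Ω (az x₀) (el x₀) i 0 • a + Scenario.Ω (az x₀) (el x₀) i 1 • e) x₀ := by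
  fin_cases i
  · refine ((ha.cos).mul (he.sin)).congr_fderiv ?_
    ext ε
    simp [Scenario.Ω]
    ring
  · refine ((ha.sin).mul (he.sin)).congr_fderiv ?_
    ext ε
    simp [Scenario.Ω]
    ring
  · refine (he.cos).congr_fderiv ?_
    ext ε
    simp [Scenario.Ω]

theorem hasFDerivAt_dotProduct {n : Type*} [Fintype n] {u v : E → n → ℝ} {u' v' : n → E →L[ℝ] ℝ}
    (hu : ∀ i, HasFDerivAt (fun x => u x i) (u' i) x₀)
    (hv : ∀ i, HasFDerivAt (fun x => v x i) (v' i) x₀) :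
    HasFDerivAt (fun x => u x ⬝ᵥ v x) (∑ i, (u x₀ i • v' i + v x₀ i • u' i)) x₀ :=
  HasFDerivAt.fun_sum fun i _ => (hu i).mul (hv i)

/-- Derivative of `C(μ) d`, where `C` is the weight matrix of a path. -/
theorem hasFDerivAt_weightMatrix_mulVec {isLOS : Prop} [Decidable isLOS] (ι : ℝ)
    {μ d : E → Fin 3 → ℝ} {μ' d' : Fin 3 → E →L[ℝ] ℝ}
    (hμ : ∀ i, HasFDerivAt (fun x => μ x i) (μ' i) x₀)
    (hd : ∀ i, HasFDerivAt (fun x => d x i) (d' i) x₀) (hne : ¬isLOS → μ x₀ ⬝ᵥ μ x₀ ≠ 0)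
    {CB : Matrix (Fin 3) (Fin 3) ℝ}
    (hCB : CB = if isLOS then 0 else
      ι • ((2 * (μ x₀ ⬝ᵥ d x₀) / (μ x₀ ⬝ᵥ μ x₀) ^ 2) • Matrix.vecMulVec (μ x₀) (μ x₀)
      - (μ x₀ ⬝ᵥ μ x₀)⁻¹ • ((μ x₀ ⬝ᵥ d x₀) • (1 : Matrix (Fin 3) (Fin 3) ℝ)
        + Matrix.vecMulVec (μ x₀) (d x₀)))) (i : Fin 3) :
    HasFDerivAt (fun x => (weightMatrix isLOS ι (μ x) *ᵥ d x) i)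
      (∑ j, weightMatrix isLOS ι (μ x₀) i j • d' j + ∑ j, CB i j • μ' j) x₀ := by
  by_cases hL : isLOS
  · simp only [weightMatrix, if_pos hL] at hCB ⊢
    have h1 : (fun x => ((ι • (1 : Matrix (Fin 3) (Fin 3) ℝ)) *ᵥ d x) i) = fun x => ι * d x i := by
      ext x; simp [Matrix.smul_mulVec]
    rw [h1, hCB]
    refine ((hd i).const_mul ι).congr_fderiv ?_
    ext ε
    simp [Matrix.one_apply]
  · simp only [weightMatrix, if_neg hL] at hCB ⊢
    have h1 : (fun x => ((ι • ((1 : Matrix (Fin 3) (Fin 3) ℝ) -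
        (μ x ⬝ᵥ μ x)⁻¹ • Matrix.vecMulVec (μ x) (μ x))) *ᵥ d x) i) =
        fun x => ι * (d x i - (μ x ⬝ᵥ μ x)⁻¹ * (μ x i * (μ x ⬝ᵥ d x))) := by
      ext x
      rw [Matrix.smul_mulVec, Matrix.sub_mulVec, Matrix.smul_mulVec, Matrix.one_mulVec,
        Matrix.vecMulVec_mulVec]
      simp [mul_comm (μ x i)]
    rw [h1]
    have hinv := (hasDerivAt_inv (hne hL)).comp_hasFDerivAt x₀ (hasFDerivAt_dotProduct hμ hμ)
    refine (((hd i).sub (hinv.mul ((hμ i).mul (hasFDerivAt_dotProduct hμ hd)))).const_mul ι).congr_fderiv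
      ?_
    rw [hCB]
    ext ε
    have hm := hne hL
    set q := μ x₀ ⬝ᵥ μ x₀ with hq
    set s := μ x₀ ⬝ᵥ d x₀ with hs
    simp only [Function.comp_apply, ← hq, Fin.sum_univ_three, _root_.smul_apply, _root_.add_apply,
      _root_.sub_apply, smul_eq_mul, Matrix.smul_apply, Matrix.sub_apply, Matrix.add_apply,
      Matrix.vecMulVec_apply, Matrix.one_apply]
    fin_cases i <;> simp <;> field_simp <;> ring

/-- In the product rule the term with the derivative of `f` carries the factor `q x₀ = 0`, so
continuity of `f` suffices. -/
theorem hasFDerivAt_mul_of_eq_zero {f q : E → ℝ} {q' : E →L[ℝ] ℝ} (hf : ContinuousAt f x₀)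
    (hq : HasFDerivAt q q' x₀) (h0 : q x₀ = 0) :
    HasFDerivAt (fun x => f x * q x) (f x₀ • q') x₀ := by
  rw [hasFDerivAt_iff_isLittleO] at hq ⊢
  have h1 : (fun x => f x - f x₀) =o[𝓝 x₀] fun _ => (1 : ℝ) := by
    rw [Asymptotics.isLittleO_one_iff]
    have := hf.tendsto.sub_const (f x₀)
    rwa [sub_self] at this
  have h2 : q =O[𝓝 x₀] fun x => x - x₀ := by
    have h3 := hq.isBigO.add (q'.isBigO_sub (𝓝 x₀) x₀)
    refine h3.congr_left fun x => ?_
    rw [h0]; ring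
  have h4 := h1.mul_isBigO h2.norm_right
  have h5 := hq.const_mul_left (f x₀)
  simp only [one_mul] at h4
  refine (h4.of_norm_right.add h5).congr_left fun x => ?_
  rw [h0]
  simp only [_root_.smul_apply, smul_eq_mul]
  ring

end Calculus

namespace Scenario

variable {L : ℕ} {M N : Fin 4 → ℕ} {K₅ L₅ : ℕ} {S : Scenario L M N K₅ L₅}

/-! ### First-order perturbation of the position estimate -/

/-- The real-linear functional `ε ↦ Im (vᴴ ε)`. -/
def imDot {ι : Type*} [Fintype ι] (v : ι → ℂ) : (ι → ℂ) →L[ℝ] ℝ :=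
  Complex.imCLM.comp ((∑ i, star (v i) • (ContinuousLinearMap.proj i :
    (ι → ℂ) →L[ℂ] ℂ)).restrictScalars ℝ)

theorem imDot_apply {ι : Type*} [Fintype ι] (v ε : ι → ℂ) :
    imDot v ε = (∑ i, star (v i) * ε i).im := by
  simp [imDot]

theorem imDot_add {ι : Type*} [Fintype ι] (v w : ι → ℂ) : imDot (v + w) = imDot v + imDot w := by
  ext ε
  simp only [imDot_apply, _root_.add_apply, Pi.add_apply, star_add, add_mul,
    Finset.sum_add_distrib, Complex.add_im]

theorem imDot_smul {ι : Type*} [Fintype ι] (r : ℝ) (v : ι → ℂ) : imDot (r • v) = r • imDot v := by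
  ext ε
  have h1 : ∀ i, star ((r • v) i) * ε i = (r : ℂ) * (star (v i) * ε i) := fun i => by
    simp [mul_assoc]
  simp only [imDot_apply, h1, ← Finset.mul_sum, _root_.smul_apply, smul_eq_mul, Complex.im_ofReal_mul]

theorem freqJac_eq_imDot (l : Fin L) (n : Mode) : S.freqJac l n = imDot (S.υ l n) := by
  ext ε
  rw [freqJac_apply, imDot_apply]

variable {ω' : (Idx N K₅ L₅ → ℂ) → Fin L → Mode → ℝ}

/-- Values and derivatives of the estimated parameters of a path. The azimuths are only determined
modulo `2π`. -/
theorem Admissible.estParams_perturbation (hS : S.Admissible) (l : Fin L)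
    (hω : ∀ n, ω' S.h l n = S.ω l n ∧ HasFDerivAt (fun x => ω' x l n) (S.freqJac l n) S.h) :
    (HasFDerivAt (fun x => (S.estParams (ω' x) l).ϕaz) (imDot (S.κ l 0)) S.h ∧
      Real.sin (S.estParams (ω' S.h) l).ϕaz = Real.sin (S.par l).ϕaz ∧
      Real.cos (S.estParams (ω' S.h) l).ϕaz = Real.cos (S.par l).ϕaz) ∧
    (HasFDerivAt (fun x => (S.estParams (ω' x) l).ϕel) (imDot (S.κ l 1)) S.h ∧
      (S.estParams (ω' S.h) l).ϕel = (S.par l).ϕel) ∧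
    (HasFDerivAt (fun x => (S.estParams (ω' x) l).θaz) (imDot (S.κ l 2)) S.h ∧
      Real.sin (S.estParams (ω' S.h) l).θaz = Real.sin (S.par l).θaz ∧
      Real.cos (S.estParams (ω' S.h) l).θaz = Real.cos (S.par l).θaz) ∧
    (HasFDerivAt (fun x => (S.estParams (ω' x) l).θel) (imDot (S.κ l 3)) S.h ∧
      (S.estParams (ω' S.h) l).θel = (S.par l).θel) ∧
    (HasFDerivAt (fun x => (S.estParams (ω' x) l).τ) (imDot (S.κ l 4)) S.h ∧
      (S.estParams (ω' S.h) l).τ = (S.par l).τ) := by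
  simp only [freqJac_eq_imDot] at hω
  have h0 : ω' S.h l (some 0) = Real.pi * Real.sin (S.par l).ϕaz * Real.sin (S.par l).ϕel :=
    (hω _).1
  have h1 : ω' S.h l (some 1) = Real.pi * Real.cos (S.par l).ϕel := (hω _).1
  have h2 : ω' S.h l (some 2) = Real.pi * Real.sin (S.par l).θaz * Real.sin (S.par l).θel :=
    (hω _).1
  have h3 : ω' S.h l (some 3) = Real.pi * Real.cos (S.par l).θel := (hω _).1
  have h4 : ω' S.h l none = -(2 * Real.pi * S.Δf * (S.par l).τ) := (hω _).1
  have hΔ := hS.Δf_pos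
  have hpi := Real.pi_pos
  refine ⟨?_, ⟨?_, ?_⟩, ?_, ⟨?_, ?_⟩, ?_, ?_⟩
  · have := hasFDerivAt_azimuthOf (hS.ϕel_mem l) (hS.ϕaz_ne l) Iff.rfl (hω (some 0)).2
      (hω (some 1)).2 h0 h1
    have h5 : S.κ l 0 = κaz (S.par l).ϕaz (S.par l).ϕel (S.υ l (some 0)) (S.υ l (some 1)) := rfl
    rw [h5, κaz, imDot_add, imDot_smul, imDot_smul]
    exact this
  · have := hasFDerivAt_elevationOf (hS.ϕel_mem l) (hω (some 1)).2 h1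
    have h5 : S.κ l 1 = κel (S.par l).ϕel (S.υ l (some 1)) := rfl
    rw [h5, κel, imDot_smul]
    exact this
  · simp only [estParams, paramsOf, h1, elevationOf_pi_mul_cos (hS.ϕel_mem l)]
  · have := hasFDerivAt_azimuthOf (hS.θel_mem l) (hS.θaz_ne l) Iff.rfl (hω (some 2)).2
      (hω (some 3)).2 h2 h3
    have h5 : S.κ l 2 = κaz (S.par l).θaz (S.par l).θel (S.υ l (some 2)) (S.υ l (some 3)) := rfl
    rw [h5, κaz, imDot_add, imDot_smul, imDot_smul]
    exact this
  · have := hasFDerivAt_elevationOf (hS.θel_mem l) (hω (some 3)).2 h3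
    have h5 : S.κ l 3 = κel (S.par l).θel (S.υ l (some 3)) := rfl
    rw [h5, κel, imDot_smul]
    exact this
  · simp only [estParams, paramsOf, h3, elevationOf_pi_mul_cos (hS.θel_mem l)]
  · have h5 : S.κ l 4 = (-(1 / (2 * Real.pi * S.Δf))) • S.υ l none := rfl
    rw [h5, imDot_smul]
    refine (((hω none).2.neg).mul_const (2 * Real.pi * S.Δf)⁻¹).congr_fderiv ?_
    ext ε
    simp only [_root_.smul_apply, _root_.neg_apply, smul_eq_mul]
    ring
  · simp only [estParams, paramsOf, h4]
    field_simp

theorem Ω_congr {az el az' el' : ℝ} (hs : Real.sin az' = Real.sin az) (hc : Real.cos az' = Real.cos az)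
    (he : el' = el) : Ω az' el' = Ω az el := by
  simp only [Ω, hs, hc, he]

theorem direction_congr {az el az' el' : ℝ} (hs : Real.sin az' = Real.sin az)
    (hc : Real.cos az' = Real.cos az) (he : el' = el) : direction az' el' = direction az el := by
  simp only [direction, hs, hc, he]

/-- Values and derivatives of `μ_l` and `δ_l` at the estimated parameters. -/
theorem Admissible.μ_δ_perturbation (hS : S.Admissible) (l : Fin L)
    (hω : ∀ n, ω' S.h l n = S.ω l n ∧ HasFDerivAt (fun x => ω' x l n) (S.freqJac l n) S.h) :
    (S.estParams (ω' S.h) l).μ S.c = (S.par l).μ S.c ∧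
    (S.estParams (ω' S.h) l).δ S.c S.pT = (S.par l).δ S.c S.pT ∧
    (∀ i, HasFDerivAt (fun x => (S.estParams (ω' x) l).μ S.c i)
      (S.c • ∑ j, μJac (S.par l) i j • imDot (S.κ l j)) S.h) ∧
    ∀ i, HasFDerivAt (fun x => (S.estParams (ω' x) l).δ S.c S.pT i)
      (-S.c • ∑ j, δJac (S.par l) i j • imDot (![S.κ l 2, S.κ l 3, S.κ l 4] j)) S.h := by
  obtain ⟨⟨d1, s1, c1⟩, ⟨d2, e2⟩, ⟨d3, s3, c3⟩, ⟨d4, e4⟩, ⟨d5, e5⟩⟩ :=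
    hS.estParams_perturbation l hω
  have hT : (S.estParams (ω' S.h) l).fT = (S.par l).fT := direction_congr s1 c1 e2
  have hR : (S.estParams (ω' S.h) l).fR = (S.par l).fR := direction_congr s3 c3 e4
  have dT := fun i => hasFDerivAt_direction d1 d2 i
  have dR := fun i => hasFDerivAt_direction d3 d4 i
  rw [Ω_congr s1 c1 e2] at dT
  rw [Ω_congr s3 c3 e4] at dR
  refine ⟨?_, ?_, fun i => ?_, fun i => ?_⟩
  · simp only [PathParams.μ, hT, hR, e5]
  · simp only [PathParams.δ, hR, e5]
  · refine ((d5.const_mul S.c).mul ((dT i).add (dR i))).congr_fderiv ?_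
    have h1 : direction (S.estParams (ω' S.h) l).ϕaz (S.estParams (ω' S.h) l).ϕel = (S.par l).fT := hT
    have h2 : direction (S.estParams (ω' S.h) l).θaz (S.estParams (ω' S.h) l).θel = (S.par l).fR := hR
    simp only [Pi.add_apply, h1, h2, e5]
    ext ε
    simp [Fin.sum_univ_five, μJac]
    ring
  · refine (((d5.const_mul S.c).mul (dR i)).const_sub (S.pT i)).congr_fderiv ?_
    have h2 : direction (S.estParams (ω' S.h) l).θaz (S.estParams (ω' S.h) l).θel = (S.par l).fR := hR
    rw [h2, e5]
    ext ε
    simp [Fin.sum_univ_three, δJac]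
    ring

theorem Admissible.μ_ne_zero (hS : S.Admissible) {l : Fin L} (hl : l ∉ S.los) :
    (S.par l).μ S.c ⬝ᵥ (S.par l).μ S.c ≠ 0 := by
  rw [ne_eq, dotProduct_self_eq_zero, PathParams.μ, smul_eq_zero, not_or]
  refine ⟨(mul_pos hS.c_pos (hS.τ_pos l)).ne', fun h => hl ((hS.los_iff l).2 ?_)⟩
  exact eq_neg_of_add_eq_zero_right h

/-- Without noise, the receiver satisfies the weighted equation of every path. -/
theorem Admissible.C_mulVec_eq_zero (hS : S.Admissible) (l : Fin L) :
    S.C l *ᵥ ((S.par l).δ S.c S.pT - S.pR) = 0 := by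
  obtain ⟨r, -, -, hr⟩ := hS.geometry l
  have hct := (mul_pos hS.c_pos (hS.τ_pos l)).ne'
  have hd : (S.par l).δ S.c S.pT - S.pR = -r • ((S.par l).fT + (S.par l).fR) := by
    ext i
    have := congrFun hr i
    simp only [Pi.add_apply, Pi.smul_apply, smul_eq_mul] at this
    simp only [PathParams.δ, Pi.sub_apply, Pi.add_apply, Pi.smul_apply, smul_eq_mul]
    linarith
  by_cases hl : l ∈ S.los
  · rw [hd, (hS.los_iff l).1 hl]
    simp
  · have hμ : (S.par l).δ S.c S.pT - S.pR = (-r / (S.c * (S.par l).τ)) • (S.par l).μ S.c := by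
      rw [hd, PathParams.μ, smul_smul, div_mul_cancel₀ _ hct]
    -- `C` is a multiple of the projection orthogonal to `μ`, and the residual is parallel to `μ`.
    rw [hμ, C, weightMatrix, if_neg hl, Matrix.mulVec_smul, Matrix.smul_mulVec, Matrix.sub_mulVec,
      Matrix.smul_mulVec, Matrix.one_mulVec, Matrix.vecMulVec_mulVec, op_smul_eq_smul,
      inv_smul_smul₀ (hS.μ_ne_zero hl), sub_self, smul_zero, smul_zero]

theorem continuousAt_weightMatrix {X : Type*} [TopologicalSpace X] {x₀ : X} {isLOS : Prop}
    [Decidable isLOS] (ι : ℝ) {μ : X → Fin 3 → ℝ} (hμ : ContinuousAt μ x₀)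
    (hne : ¬isLOS → μ x₀ ⬝ᵥ μ x₀ ≠ 0) :
    ContinuousAt (fun x => weightMatrix isLOS ι (μ x)) x₀ := by
  by_cases hL : isLOS
  · simp only [weightMatrix, if_pos hL]
    exact continuousAt_const
  · have hdot : ContinuousAt (fun x => μ x ⬝ᵥ μ x) x₀ :=
      (Continuous.dotProduct continuous_id continuous_id).continuousAt.comp hμ
    refine continuousAt_pi.2 fun i => continuousAt_pi.2 fun j => ?_
    simp only [weightMatrix, if_neg hL, Matrix.smul_apply, Matrix.sub_apply, Matrix.vecMulVec_apply,
      smul_eq_mul]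
    exact continuousAt_const.mul (continuousAt_const.sub ((hdot.inv₀ (hne hL)).mul
      ((continuousAt_pi.1 hμ i).mul (continuousAt_pi.1 hμ j))))

/-- The matrices `D̆` and `Ĕ` are real, so taking imaginary parts commutes with them. -/
theorem Ψ_mulVec_im (ε : Idx N K₅ L₅ → ℂ) (i : Fin 3) :
    ((S.Ψ *ᵥ ε) i).im = ∑ l, ((S.Dbreve l *ᵥ fun m => imDot (![S.κ l 2, S.κ l 3, S.κ l 4] m) ε) i
      + (S.Ebreve l *ᵥ fun m => imDot (S.κ l m) ε) i) := by
  have key : ∀ {k : ℕ} (D : Matrix (Fin 3) (Fin k) ℝ) (v : Fin k → Idx N K₅ L₅ → ℂ),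
      (((D.map (fun t : ℝ => (t : ℂ)) * (Matrix.of v).map star) *ᵥ ε) i).im =
        (D *ᵥ fun m => imDot (v m) ε) i := by
    intro k D v
    rw [← Matrix.mulVec_mulVec]
    simp only [Matrix.mulVec, dotProduct, Matrix.map_apply, Matrix.of_apply, Complex.im_sum,
      Complex.im_ofReal_mul, imDot_apply]
  rw [Ψ, Matrix.sum_mulVec, Finset.sum_apply, Complex.im_sum]
  refine Finset.sum_congr rfl fun l _ => ?_
  rw [Matrix.add_mulVec, Pi.add_apply, Complex.add_im, key, key]

/-- The position estimate is differentiable at the noise-free channel, with derivative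
`ε ↦ Im (Ψ ε)`. -/
theorem Admissible.hasFDerivAt_wlsPosition (hS : S.Admissible)
    (hω : ∀ l n, ω' S.h l n = S.ω l n ∧ HasFDerivAt (fun x => ω' x l n) (S.freqJac l n) S.h) :
    S.wlsPosition (S.estParams (ω' S.h)) = S.pR ∧
    ∀ i, HasFDerivAt (fun x => S.wlsPosition (S.estParams (ω' x)) i)
      (imDot fun j => star (S.Ψ i j)) S.h := by
  have hpert := fun l => hS.μ_δ_perturbation l (hω l)
  set μ : (Idx N K₅ L₅ → ℂ) → Fin L → Fin 3 → ℝ := fun x l => (S.estParams (ω' x) l).μ S.c with hμdef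
  set d : (Idx N K₅ L₅ → ℂ) → Fin L → Fin 3 → ℝ :=
    fun x l => (S.estParams (ω' x) l).δ S.c S.pT - S.pR with hddef
  set W : (Idx N K₅ L₅ → ℂ) → Fin L → Matrix (Fin 3) (Fin 3) ℝ :=
    fun x l => weightMatrix (l ∈ S.los) (S.ι l) (μ x l) with hWdef
  have hμ0 : ∀ l, μ S.h l = (S.par l).μ S.c := fun l => (hpert l).1
  have hd0 : ∀ l, d S.h l = (S.par l).δ S.c S.pT - S.pR := fun l => by
    simp only [hddef, (hpert l).2.1]
  have hW0 : ∀ l, W S.h l = S.C l := fun l => by simp only [hWdef, hμ0, C]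
  have hμne : ∀ l, l ∉ S.los → μ S.h l ⬝ᵥ μ S.h l ≠ 0 := fun l hl => by
    rw [hμ0]; exact hS.μ_ne_zero hl
  have hMc : ContinuousAt (fun x => ∑ l, W x l) S.h := by
    refine tendsto_finsetSum _ fun l _ => ?_
    exact continuousAt_weightMatrix _
      (continuousAt_pi.2 fun i => ((hpert l).2.2.1 i).continuousAt) (hμne l)
  have hM0 : ∑ l, W S.h l = ∑ l, S.C l := Finset.sum_congr rfl fun l _ => hW0 l
  have hMunit : ∀ᶠ x in 𝓝 S.h, IsUnit (∑ l, W x l).det := by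
    have h1 : ContinuousAt (fun x => (∑ l, W x l).det) S.h :=
      (Continuous.matrix_det continuous_id).continuousAt.comp hMc
    have h2 : (∑ l, W S.h l).det ≠ 0 := by rw [hM0]; exact hS.C_unit.ne_zero
    filter_upwards [h1.eventually_ne h2] with x hx using hx.isUnit
  set q : (Idx N K₅ L₅ → ℂ) → Fin 3 → ℝ := fun x => ∑ l, W x l *ᵥ d x l with hqdef
  -- Writing `δ = p_R + d` splits off the true position exactly and leaves the inverse times a
  -- vector `q` that vanishes at `h`.
  have hpos : ∀ x, IsUnit (∑ l, W x l).det →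
      S.wlsPosition (S.estParams (ω' x)) = S.pR + (∑ l, W x l)⁻¹ *ᵥ q x := by
    intro x hx
    have h1 : ∑ l, W x l *ᵥ (S.estParams (ω' x) l).δ S.c S.pT = (∑ l, W x l) *ᵥ S.pR + q x := by
      rw [hqdef, Matrix.sum_mulVec, ← Finset.sum_add_distrib]
      refine Finset.sum_congr rfl fun l _ => ?_
      rw [← Matrix.mulVec_add]
      congr 1
      simp [hddef]
    change (∑ l, W x l)⁻¹ *ᵥ (∑ l, W x l *ᵥ (S.estParams (ω' x) l).δ S.c S.pT) = _
    rw [h1, Matrix.mulVec_add, Matrix.mulVec_mulVec, Matrix.nonsing_inv_mul _ hx, Matrix.one_mulVec]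
  have hq0 : q S.h = 0 := by
    simp only [hqdef]
    refine Finset.sum_eq_zero fun l _ => ?_
    rw [hW0, hd0, hS.C_mulVec_eq_zero]
  refine ⟨by rw [hpos _ hMunit.self_of_nhds, hq0, Matrix.mulVec_zero, add_zero], fun i => ?_⟩
  have hdd : ∀ l j, HasFDerivAt (fun x => d x l j)
      (-S.c • ∑ m, δJac (S.par l) j m • imDot (![S.κ l 2, S.κ l 3, S.κ l 4] m)) S.h :=
    fun l j => ((hpert l).2.2.2 j).sub_const (S.pR j)
  have hqd : ∀ k, HasFDerivAt (fun x => q x k)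
      (∑ l, (∑ j, S.C l k j • (-S.c • ∑ m, δJac (S.par l) j m •
          imDot (![S.κ l 2, S.κ l 3, S.κ l 4] m))
        + ∑ j, S.Cbreve l k j • (S.c • ∑ m, μJac (S.par l) j m • imDot (S.κ l m)))) S.h := by
    intro k
    have h1 : (fun x => q x k) = fun x => ∑ l, (W x l *ᵥ d x l) k := by
      ext x; simp [hqdef]
    rw [h1]
    refine HasFDerivAt.fun_sum fun l _ => ?_
    have h2 := hasFDerivAt_weightMatrix_mulVec (isLOS := l ∈ S.los) (S.ι l) (hpert l).2.2.1 (hdd l)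
      (hμne l) (CB := S.Cbreve l) (by
        simp only [Cbreve]
        have h3 := hμ0 l
        simp only [hμdef] at h3
        rw [h3, hd0]) k
    have h4 := hW0 l
    simp only [hWdef, hμdef] at h4
    rw [h4] at h2
    exact h2
  have hinv : ContinuousAt (fun x => (∑ l, W x l)⁻¹) S.h := by
    have h1 : ContinuousAt Ring.inverse (∑ l, W S.h l).det := by
      have h2 : IsUnit (∑ l, W S.h l).det := hMunit.self_of_nhds
      rw [Ring.inverse_eq_inv']
      exact continuousAt_inv₀ h2.ne_zero
    exact ContinuousAt.comp (g := fun A : Matrix (Fin 3) (Fin 3) ℝ => A⁻¹)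
      (continuousAt_matrix_inv _ h1) hMc
  have hterm : ∀ k, HasFDerivAt (fun x => (∑ l, W x l)⁻¹ i k * q x k) _ S.h := fun k =>
    hasFDerivAt_mul_of_eq_zero (continuousAt_pi.1 (continuousAt_pi.1 hinv i) k) (hqd k)
      (congrFun hq0 k)
  have hfin := (HasFDerivAt.fun_sum (u := Finset.univ) fun k _ => hterm k).const_add (S.pR i)
  refine (hfin.congr_of_eventuallyEq ?_).congr_fderiv ?_
  · filter_upwards [hMunit] with x hx
    rw [hpos x hx]
    rfl
  · ext ε
    rw [imDot_apply]
    simp only [star_star]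
    change _ = ((S.Ψ *ᵥ ε) i).im
    rw [Ψ_mulVec_im, hM0]
    have hD : ∀ l, S.Dbreve l *ᵥ (fun m => imDot (![S.κ l 2, S.κ l 3, S.κ l 4] m) ε) =
        (∑ k, S.C k)⁻¹ *ᵥ (S.C l *ᵥ (-S.c • (δJac (S.par l) *ᵥ
          fun m => imDot (![S.κ l 2, S.κ l 3, S.κ l 4] m) ε))) := fun l => by
      rw [Dbreve, Matrix.smul_mulVec, Matrix.mulVec_smul, Matrix.mulVec_smul, Matrix.mulVec_mulVec,
        Matrix.mulVec_mulVec, Matrix.mul_assoc]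
    have hE : ∀ l, S.Ebreve l *ᵥ (fun m => imDot (S.κ l m) ε) =
        (∑ k, S.C k)⁻¹ *ᵥ (S.Cbreve l *ᵥ (S.c • (μJac (S.par l) *ᵥ
          fun m => imDot (S.κ l m) ε))) := fun l => by
      rw [Ebreve, Matrix.smul_mulVec, Matrix.mulVec_smul, Matrix.mulVec_smul, Matrix.mulVec_mulVec,
        Matrix.mulVec_mulVec, Matrix.mul_assoc]
    have h6 : ∑ l, ((S.Dbreve l *ᵥ fun m => imDot (![S.κ l 2, S.κ l 3, S.κ l 4] m) ε) i
        + (S.Ebreve l *ᵥ fun m => imDot (S.κ l m) ε) i) =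
        ((∑ k, S.C k)⁻¹ *ᵥ ∑ l, (S.C l *ᵥ (-S.c • (δJac (S.par l) *ᵥ
          fun m => imDot (![S.κ l 2, S.κ l 3, S.κ l 4] m) ε)) + S.Cbreve l *ᵥ (S.c •
          (μJac (S.par l) *ᵥ fun m => imDot (S.κ l m) ε)))) i := by
      rw [Matrix.mulVec_sum, Finset.sum_apply]
      refine Finset.sum_congr rfl fun l _ => ?_
      rw [hD, hE, Matrix.mulVec_add, Pi.add_apply]
    rw [h6]
    simp only [Matrix.mulVec, dotProduct, _root_.sum_apply, _root_.smul_apply,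
      _root_.add_apply, smul_eq_mul, Finset.sum_apply, Pi.add_apply, Pi.smul_apply]

end Scenario

/-! ### Moments of circular Gaussian noise -/

section Noise

/-- `Im (b z) = Re b · Im z + Im b · Re z` is a sum of two independent centred terms, each
coordinate having variance `v / 2`. -/
theorem circularGaussian_im_mul (v : ℝ≥0) (b : ℂ) :
    MemLp (fun z : ℂ => (b * z).im) 2 (circularGaussian v) ∧
    (∫ z, (b * z).im ∂circularGaussian v) = 0 ∧
    Var[fun z : ℂ => (b * z).im; circularGaussian v] = v / 2 * ‖b‖ ^ 2 := by
  set ν := gaussianReal 0 (v / 2) with hν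
  have hmk : Measurable fun z : ℝ × ℝ => (⟨z.1, z.2⟩ : ℂ) :=
    Complex.measurableEquivRealProd.symm.measurable
  have hm : Measurable fun z : ℂ => (b * z).im := by fun_prop
  have hid : MemLp (fun x : ℝ => x) 2 ν := memLp_id_gaussianReal 2
  have h1 : MemLp (fun z : ℝ × ℝ => b.im * z.1) 2 (ν.prod ν) :=
    (hid.comp_measurePreserving measurePreserving_fst).const_mul b.im
  have h2 : MemLp (fun z : ℝ × ℝ => b.re * z.2) 2 (ν.prod ν) :=
    (hid.comp_measurePreserving measurePreserving_snd).const_mul b.re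
  have hfun : (fun z : ℝ × ℝ => (b * (⟨z.1, z.2⟩ : ℂ)).im) =
      (fun z : ℝ × ℝ => b.re * z.2) + fun z => b.im * z.1 := by
    ext z; simp [Complex.mul_im]
  have e1 : ∫ x, x ∂ν = 0 := integral_id_gaussianReal
  have v1 : Var[fun x : ℝ => x; ν] = v / 2 := by
    rw [hν, variance_fun_id_gaussianReal, NNReal.coe_div, NNReal.coe_ofNat]
  have i1 : ∫ z : ℝ × ℝ, b.im * z.1 ∂(ν.prod ν) = 0 := by
    rw [integral_const_mul, integral_fun_fst (fun x : ℝ => x), e1]; simp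
  have i2 : ∫ z : ℝ × ℝ, b.re * z.2 ∂(ν.prod ν) = 0 := by
    rw [integral_const_mul, integral_fun_snd (fun x : ℝ => x), e1]; simp
  have hind : IndepFun (fun z : ℝ × ℝ => b.re * z.2) (fun z : ℝ × ℝ => b.im * z.1) (ν.prod ν) :=
    (indepFun_prod (X := fun x : ℝ => b.im * x) (Y := fun x : ℝ => b.re * x)
      (by fun_prop) (by fun_prop)).symm
  refine ⟨?_, ?_, ?_⟩
  · rw [circularGaussian, memLp_map_measure_iff hm.aestronglyMeasurable hmk.aemeasurable]
    change MemLp (fun z : ℝ × ℝ => (b * (⟨z.1, z.2⟩ : ℂ)).im) 2 (ν.prod ν)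
    rw [hfun]
    exact h2.add h1
  · rw [circularGaussian, integral_map hmk.aemeasurable hm.aestronglyMeasurable, ← hν, hfun]
    rw [integral_add' (h2.integrable one_le_two) (h1.integrable one_le_two), i1, i2, add_zero]
  · rw [circularGaussian, variance_map hm.aemeasurable hmk.aemeasurable]
    change Var[fun z : ℝ × ℝ => (b * (⟨z.1, z.2⟩ : ℂ)).im; ν.prod ν] = _
    rw [hfun, hind.variance_add h2 h1, variance_const_mul, variance_const_mul]
    have w1 : Var[fun z : ℝ × ℝ => z.1; ν.prod ν] = v / 2 := by
      rw [← v1]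
      exact measurePreserving_fst.variance_fun_comp (f := fun x : ℝ => x) (by fun_prop)
    have w2 : Var[fun z : ℝ × ℝ => z.2; ν.prod ν] = v / 2 := by
      rw [← v1]
      exact measurePreserving_snd.variance_fun_comp (f := fun x : ℝ => x) (by fun_prop)
    rw [w1, w2, Complex.sq_norm, Complex.normSq_apply]
    ring

variable {Ω : Type*} [MeasurableSpace Ω] {μ : Measure Ω} [IsProbabilityMeasure μ]

/-- Moments of a linear functional of a vector of independent circular Gaussian variables. -/
theorem imDot_moments {ι : Type*} [Fintype ι] {X : Ω → ι → ℂ} {v : ℝ≥0}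
    (hlaw : ∀ i, HasLaw (fun w => X w i) (circularGaussian v) μ)
    (hindep : iIndepFun (fun i w => X w i) μ) (a : ι → ℂ) :
    Integrable (fun w => Scenario.imDot a (X w)) μ ∧
    (∫ w, Scenario.imDot a (X w) ∂μ) = 0 ∧
    Integrable (fun w => Scenario.imDot a (X w) ^ 2) μ ∧
    (∫ w, Scenario.imDot a (X w) ^ 2 ∂μ) = v / 2 * ∑ i, ‖a i‖ ^ 2 := by
  let Y : ι → Ω → ℝ := fun i w => (star (a i) * X w i).im
  have hm : ∀ i, Measurable fun z : ℂ => (star (a i) * z).im := fun i => by fun_prop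
  have hY2 : ∀ i, MemLp (Y i) 2 μ := fun i => by
    have h1 := (circularGaussian_im_mul v (star (a i))).1
    rw [← (hlaw i).map_eq] at h1
    exact h1.comp_of_map (hlaw i).aemeasurable
  have hYm : ∀ i, ∫ w, Y i w ∂μ = 0 := fun i => by
    have h1 := (circularGaussian_im_mul v (star (a i))).2.1
    rw [← (hlaw i).map_eq, integral_map (hlaw i).aemeasurable (hm i).aestronglyMeasurable] at h1
    exact h1
  have hYv : ∀ i, Var[Y i; μ] = v / 2 * ‖a i‖ ^ 2 := fun i => by
    have h1 := (circularGaussian_im_mul v (star (a i))).2.2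
    rw [← (hlaw i).map_eq, variance_map (hm i).aemeasurable (hlaw i).aemeasurable, norm_star] at h1
    exact h1
  have hYi : iIndepFun Y μ := hindep.comp (fun i z => (star (a i) * z).im) hm
  have hsum : (fun w => Scenario.imDot a (X w)) = ∑ i, Y i := by
    ext w
    rw [Scenario.imDot_apply, Complex.im_sum, Finset.sum_apply]
  have hS2 : MemLp (∑ i, Y i) 2 μ := memLp_finsetSum' _ fun i _ => hY2 i
  have hSm : ∫ w, (∑ i, Y i) w ∂μ = 0 := by
    simp only [Finset.sum_apply]
    rw [integral_finsetSum _ fun i _ => (hY2 i).integrable one_le_two]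
    exact Finset.sum_eq_zero fun i _ => hYm i
  have hSv : Var[∑ i, Y i; μ] = v / 2 * ∑ i, ‖a i‖ ^ 2 := by
    rw [IndepFun.variance_sum (fun i _ => hY2 i) fun i _ j _ hij => hYi.indepFun hij,
      Finset.mul_sum]
    exact Finset.sum_congr rfl fun i _ => hYv i
  have hfun : ∀ w, Scenario.imDot a (X w) = (∑ i, Y i) w := congrFun hsum
  simp only [hfun]
  refine ⟨hS2.integrable one_le_two, hSm, hS2.integrable_sq, ?_⟩
  rw [← hSv, variance_of_integral_eq_zero hS2.aestronglyMeasurable.aemeasurable hSm]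

end Noise

/-! ### The position estimate as a differentiable map into Euclidean space -/

namespace Scenario

variable {L : ℕ} {M N : Fin 4 → ℕ} {K₅ L₅ : ℕ} {S : Scenario L M N K₅ L₅}

/-- The derivative `ε ↦ Im (Ψ ε)` of the position estimate. -/
def positionJac (S : Scenario L M N K₅ L₅) : (Idx N K₅ L₅ → ℂ) →L[ℝ] EuclideanSpace ℝ (Fin 3) :=
  ∑ i, (imDot fun j => star (S.Ψ i j)).smulRight (EuclideanSpace.single i (1 : ℝ))

theorem positionJac_apply (ε : Idx N K₅ L₅ → ℂ) : S.positionJac ε =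
    ∑ i, imDot (fun j => star (S.Ψ i j)) ε • EuclideanSpace.single i (1 : ℝ) := by
  simp [positionJac]

theorem positionJac_apply_apply (ε : Idx N K₅ L₅ → ℂ) (i : Fin 3) :
    S.positionJac ε i = imDot (fun j => star (S.Ψ i j)) ε := by
  rw [positionJac_apply, WithLp.ofLp_sum, Finset.sum_apply]
  simp

theorem Admissible.hasFDerivAt_positionEstimate (hS : S.Admissible)
    {pHat : (Idx N K₅ L₅ → ℂ) → EuclideanSpace ℝ (Fin 3)}
    (hp : ∀ᶠ x in 𝓝 S.h, S.IsPositionEstimate x (pHat x)) :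
    pHat S.h = WithLp.toLp 2 S.pR ∧ HasFDerivAt pHat S.positionJac S.h := by
  choose! ω' hω' using fun x (hx : S.IsPositionEstimate x (pHat x)) => hx
  replace hω' := hp.mono hω'
  obtain ⟨h1, h2⟩ := hS.hasFDerivAt_wlsPosition (ω' := ω') fun l n =>
    hS.hasFDerivAt_frequencyEstimate (hω'.mono fun x hx => hx.1) l n
  refine ⟨by rw [hω'.self_of_nhds.2, h1], ?_⟩
  rw [← hasFDerivWithinAt_univ, hasFDerivWithinAt_euclidean]
  intro i
  rw [hasFDerivWithinAt_univ]
  refine ((h2 i).congr_of_eventuallyEq ?_).congr_fderiv ?_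
  · filter_upwards [hω'] with x hx
    rw [hx.2]
  · ext ε
    exact (positionJac_apply_apply ε i).symm

end Scenario

end BeamspaceESPRIT
end

/-! ### Mean and mean square of the first-order position error -/

theorem proposition5 {L : ℕ} {M N : Fin 4 → ℕ} {K₅ L₅ : ℕ}
    (S : BeamspaceESPRIT.Scenario L M N K₅ L₅) (hS : S.Admissible)
    {Ω : Type*} [MeasurableSpace Ω] (μ : Measure Ω) [IsProbabilityMeasure μ]
    (Np : ℕ) (Es N₀ : ℝ) (hNp : 0 < Np) (hEs : 0 < Es) (hN₀ : 0 ≤ N₀)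
    (Δh : Ω → BeamspaceESPRIT.Idx N K₅ L₅ → ℂ)
    (hlaw : ∀ i, HasLaw (fun w => Δh w i)
      (BeamspaceESPRIT.circularGaussian (N₀ / (Np * Es)).toNNReal) μ)
    (hindep : iIndepFun (fun i w => Δh w i) μ) :
    (∀ᶠ x in 𝓝 S.h, ∃ p, S.IsPositionEstimate x p) ∧
    ∀ pHat : (BeamspaceESPRIT.Idx N K₅ L₅ → ℂ) → EuclideanSpace ℝ (Fin 3),
      (∀ᶠ x in 𝓝 S.h, S.IsPositionEstimate x (pHat x)) →
      pHat S.h = WithLp.toLp 2 S.pR ∧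
      DifferentiableAt ℝ pHat S.h ∧
      Integrable (fun w => fderiv ℝ pHat S.h (Δh w)) μ ∧
      (∫ w, fderiv ℝ pHat S.h (Δh w) ∂μ) = 0 ∧
      Integrable (fun w => ‖fderiv ℝ pHat S.h (Δh w)‖ ^ 2) μ ∧
      (∫ w, ‖fderiv ℝ pHat S.h (Δh w)‖ ^ 2 ∂μ) = N₀ * ‖S.Ψ‖ ^ 2 / (2 * Np * Es) := by
  refine ⟨?_, fun pHat hp => ?_⟩
  · filter_upwards [hS.eventually_exists_frequencyEstimate] with x ⟨ω', hω'⟩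
    exact ⟨_, ω', hω', rfl⟩
  obtain ⟨hval, hder⟩ := hS.hasFDerivAt_positionEstimate hp
  have hmom := fun i => BeamspaceESPRIT.imDot_moments hlaw hindep fun j => star (S.Ψ i j)
  have hnorm : ∀ w, ‖S.positionJac (Δh w)‖ ^ 2 =
      ∑ i, BeamspaceESPRIT.Scenario.imDot (fun j => star (S.Ψ i j)) (Δh w) ^ 2 := fun w => by
    rw [EuclideanSpace.norm_sq_eq]
    simp only [BeamspaceESPRIT.Scenario.positionJac_apply_apply, Real.norm_eq_abs, sq_abs]
  refine ⟨hval, hder.differentiableAt, ?_⟩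
  rw [hder.fderiv]
  simp only [hnorm]
  simp only [BeamspaceESPRIT.Scenario.positionJac_apply]
  refine ⟨integrable_finsetSum _ fun i _ => (hmom i).1.smul_const _, ?_,
    integrable_finsetSum _ fun i _ => (hmom i).2.2.1, ?_⟩
  · rw [integral_finsetSum _ fun i _ => (hmom i).1.smul_const _]
    refine Finset.sum_eq_zero fun i _ => ?_
    rw [integral_smul_const, (hmom i).2.1, zero_smul]
  · have hv : 0 ≤ N₀ / (Np * Es) := by positivity
    have hNp' : (Np : ℝ) ≠ 0 := by positivity
    rw [integral_finsetSum _ fun i _ => (hmom i).2.2.1]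
    simp only [(hmom _).2.2.2, norm_star]
    -- The sum over coordinates of the squared row norms of `Ψ` is its squared Frobenius norm; the
    -- variance is nonnegative, so `toNNReal` does not truncate it.
    rw [← Finset.mul_sum, ← BeamspaceESPRIT.frobenius_norm_sq, Real.coe_toNNReal _ hv]
    field_simp
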